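/- **Lattice.** Let $\mathbf w_i=\sqrt3(\cos\phi_i,\sin\phi_i)$, $\phi_i=\frac{\pi}{6}(2i-1)$, and $\mathbf u_i=(\cos\theta_i,\sin\theta_i)$, $\mathbf u_i^{\perp}=(-\sin\theta_i,\cos\theta_i)$, $\theta_i=\frac{\pi}{3}(i-1)$, for $i=1,\dots,6$; let $\mathbf v_1=\mathbf u_1$, $\mathbf v_2=\mathbf u_3$, $\mathbf v_3=\mathbf u_5$. Let $\Lambda_f$ be the triangular lattice generated by $\mathbf w_1,\mathbf w_2$, modulo a sublattice $\Gamma$ of finite index that contains none of the $\mathbf w_i$ (periodic boundary conditions). Let $\Lambda_p$ be the honeycomb lattice of the points $\mathbf R+\mathbf u_i$, $\mathbf R\in\Lambda_f$, modulo $\Gamma$, with sublattice $\Lambda_p^A=\{\mathbf R+\mathbf u_1\}$; so $|\Lambda_p|=2|\Lambda_f|$. Each $\mathbf R\in\Lambda_f$ carries one orbital $f$ and each $\mathbf r\in\Lambda_p$ carries two orbitals $p_x,p_y$, all for spin-$\frac12$ electrons with annihilation operators $f_{\mathbf R,\sigma}$, $\vec p_{\mathbf r,\sigma}=(p_{\mathbf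 r,x,\sigma},p_{\mathbf r,y,\sigma})$, $\sigma=\uparrow,\downarrow$ (also written $c_\sigma(o)$ for an orbital $o$), on the fermionic Fock space. Put $p_{\mathbf r,\mathbf v,\sigma}=\mathbf v\cdot\vec p_{\mathbf r,\sigma}$, $n_{o,\sigma}=c^\dagger_\sigma(o)c_\sigma(o)$, $n_o=n_{o,\uparrow}+n_{o,\downarrow}$, $\vec S_o=\frac12\sum_{\mu\nu}c_\mu^\dagger(o)\vec\sigma_{\mu\nu}c_\nu(o)$. **Hamiltonian.** Let $H=H_K+H_\mu+H_U+H_J$, where $$H_K=t_p\sum_{\mathbf r\in\Lambda_p^A}\sum_{\sigma}\sum_{i=1}^3\bigl(p^\dagger_{\mathbf r+\mathbf v_i,\mathbf v_i,\sigma}p_{\mathbf r,\mathbf v_i,\sigma}+h.c.\bigr)+t_f\sum_{\mathbf R\in\Lambda_f}\sum_\sigma\sum_{i=1}^6 f^\dagger_{\mathbf R+\mathbf w_i,\sigma}f_{\mathbf R,\sigma}+t_{fp}\sum_{\mathbf R\in\Lambda_f}\sum_\sigma\sum_{i=1}^6(-1)^{i-1}\bigl(f^\dagger_{\mathbf R,\sigma}p_{\mathbf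 R+\mathbf u_i,\mathbf u_i^\perp,\sigma}+h.c.\bigr),$$ $$H_\mu=-\mu_p\sum_{o\text{ a }p\text{ orbital}}n_o-\mu_f\sum_{o\text{ an }f\text{ orbital}}n_o,\qquad H_U=\sum_o U_o\bigl(n_{o,\uparrow}-\tfrac12\bigr)\bigl(n_{o,\downarrow}-\tfrac12\bigr),$$ with $U_o=U_p$ on $p$ orbitals and $U_o=U_f$ on $f$ orbitals, and $$H_J=-J\sum_{\mathbf r\in\Lambda_p}\bigl(\vec S_{\mathbf r,p_x}\cdot\vec S_{\mathbf r,p_y}-\tfrac14 n_{\mathbf r,p_x}n_{\mathbf r,p_y}\bigr).$$ **Cluster states.** Let $a_{\mathbf R,\sigma}=t_{fp}\,f_{\mathbf R,\sigma}+t_f\sum_{i=1}^6(-1)^{i-1}p_{\mathbf R+\mathbf u_i,\mathbf u_i^\perp,\sigma}$ annihilate the (unnormalized) localized state $\varphi_{\mathbf R}$ around $\mathbf R\in\Lambda_f$, and let $|F\rangle$ be the completely filled state. Two labels $\mathbf R,\mathbf R'$ overlap if $\varphi_{\mathbf R}$ and $\varphi_{\mathbf R'}$ are both nonzero on some orbital.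 A set $A\subset\Lambda_f$ is partitioned into clusters $C_1,\dots,C_n$, where two elements of $A$ belong to the same cluster iff they are joined by a path of successively overlapping elements of $A$. Let $V_k$ be the set of orbitals on which some $\varphi_{\mathbf R}$ with $\mathbf R\in C_k$ is nonzero, let $S^{(h)-}_{C_k}=\sum_{o\in V_k}c_\downarrow(o)c^\dagger_\uparrow(o)$, and for $m_k\in\{-\frac{|C_k|}2,-\frac{|C_k|}2+1,\dots,\frac{|C_k|}2\}$ put $$|\Phi_{A,\{m_k\}}\rangle=\prod_{k=1}^n\bigl(S^{(h)-}_{C_k}\bigr)^{\frac{|C_k|}2-m_k}\prod_{\mathbf R\in A}a_{\mathbf R,\uparrow}|F\rangle .$$ **Theorem 2.** Let $t_p,t_f,t_{fp},U_p,U_f,J>0$, $\mu_p\in\mathbb R$, $t_{fp}^2>3t_pt_f$, and $$\mu_f=\mu_p+6t_f+\tfrac32t_p-\frac{t_{fp}^2}{t_f}+\frac{U_f}2-\frac{U_p}2-\frac J2 .$$ Let $4|\Lambda_p|+|\Lambda_f|\le N_e\le 4|\Lambda_p|+2|\Lambda_f|$. Then the space of $N_e$-electron ground states of $H$ is spanned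 by the states $|\Phi_{A,\{m_k\}}\rangle$ with $A\subset\Lambda_f$, $|A|=4|\Lambda_p|+2|\Lambda_f|-N_e$. Each of these states is nonzero and has maximal spin on each of its clusters: $\bigl(\sum_{o\in V_k}\vec S_o\bigr)^2|\Phi_{A,\{m_k\}}\rangle=\frac{|C_k|}2\bigl(\frac{|C_k|}2+1\bigr)|\Phi_{A,\{m_k\}}\rangle$ for every $k$. In particular, at exact half filling $N_e=4|\Lambda_p|+|\Lambda_f|$ of the flat band, every ground state has total spin $\frac{|\Lambda_f|}2$, i.e. $\bigl(\sum_o\vec S_o\bigr)^2|\Psi\rangle=\frac{|\Lambda_f|}2\bigl(\frac{|\Lambda_f|}2+1\bigr)|\Psi\rangle$. -/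

import Mathlib

open Matrix

noncomputable section

/-! ### Fermionic Fock space over a finite set of modes

A state is a vector of amplitudes indexed by the sets of occupied modes, an operator is a
complex matrix over these sets, and the Hermitian conjugate is the conjugate transpose. -/

section Fock

variable {M : Type} [Fintype M] [DecidableEq M]

/-- The annihilation operator of the mode `m` in the occupation number basis, with the
Jordan-Wigner sign of a fixed enumeration of the modes. It maps the occupation state
`insert m S` (with `m ∉ S`) to `± S`, and kills the states in which `m` is empty. -/
def annih (m : M) : Matrix (Finset M) (Finset M) ℂ :=
  Matrix.of fun S T =>
    if m ∉ S ∧ T = insert m S then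
      (-1) ^ (S.filter fun x => Fintype.equivFin M x < Fintype.equivFin M m).card
    else 0

/-- The creation operator of the mode `m`. -/
def creat (m : M) : Matrix (Finset M) (Finset M) ℂ := (annih m)ᴴ

/-- The number operator of the mode `m`. -/
def num (m : M) : Matrix (Finset M) (Finset M) ℂ := creat m * annih m

/-- The state without particles. -/
def vacuum : Finset M → ℂ := Pi.single ∅ 1

/-- The space of states with exactly `N` particles. -/
def sector (N : ℕ) : Submodule ℂ (Finset M → ℂ) :=
  Module.End.eigenspace (Matrix.toLin' (∑ m : M, num m)) (N : ℂ)

/-- The lowest eigenvalue of `H` on the space of states with `N` particles. -/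
def groundEnergy (H : Matrix (Finset M) (Finset M) ℂ) (N : ℕ) : ℝ :=
  sInf {E : ℝ | ∃ Ψ ∈ sector (M := M) N, Ψ ≠ 0 ∧ H *ᵥ Ψ = (E : ℂ) • Ψ}

/-- The `N`-particle ground state space of `H`. -/
def groundSpace (H : Matrix (Finset M) (Finset M) ℂ) (N : ℕ) : Submodule ℂ (Finset M → ℂ) :=
  sector N ⊓ Module.End.eigenspace (Matrix.toLin' H) (groundEnergy H N : ℂ)

end Fock

/-! ### Spin one half: the index `0 : Fin 2` is spin up, `1 : Fin 2` is spin down -/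

section Spin

variable {O : Type} [Fintype O] [DecidableEq O]

/-- The three Pauli matrices. -/
def pauli : Fin 3 → Matrix (Fin 2) (Fin 2) ℂ :=
  ![!![0, 1; 1, 0], !![0, -Complex.I; Complex.I, 0], !![1, 0; 0, -1]]

/-- The `i`-th component of the spin operator of the orbital `o`. -/
def spinOp (o : O) (i : Fin 3) : Matrix (Finset (O × Fin 2)) (Finset (O × Fin 2)) ℂ :=
  (1 / 2 : ℂ) • ∑ μ : Fin 2, ∑ ν : Fin 2, pauli i μ ν • (creat (o, μ) * annih (o, ν))

/-- The squared total spin `(∑_{o ∈ V} S_o)²` of a set `V` of orbitals. -/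
def spinSq (V : Finset O) : Matrix (Finset (O × Fin 2)) (Finset (O × Fin 2)) ℂ :=
  ∑ i : Fin 3, (∑ o ∈ V, spinOp o i) ^ 2

/-- The number operator of the orbital `o`, both spins counted. -/
def numOrb (o : O) : Matrix (Finset (O × Fin 2)) (Finset (O × Fin 2)) ℂ :=
  ∑ σ : Fin 2, num (o, σ)

/-- The completely filled state `∏_o c†_{o↑} c†_{o↓} |0⟩`; the order of the pairs is immaterial. -/
def filled : Finset (O × Fin 2) → ℂ :=
  ((Finset.univ : Finset O).toList.map fun o => creat (o, (0 : Fin 2)) * creat (o, 1)).prod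
    *ᵥ vacuum

/-- The operator `∑_{o ∈ V} c_{o↓} c†_{o↑}` lowering the spin of holes in the orbitals of `V`. -/
def holeLower (V : Finset O) : Matrix (Finset (O × Fin 2)) (Finset (O × Fin 2)) ℂ :=
  ∑ o ∈ V, annih (o, (1 : Fin 2)) * creat (o, 0)

end Spin

/-! ### The two-layer lattice with periodic boundary conditions

The triangular lattice of plaquette centres is `{a w₁ + b w₂ : (a, b) ∈ ℤ²}`, with
`w₁ = (3/2, √3/2)` and `w₂ = (0, √3)`; it is taken modulo a period lattice `Γ`. The honeycomb
sites `(R, 0)` and `(R, 1)` are the points `R + u₁` (sublattice A) and `R + u₂` (sublattice B),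
with `u₁ = (1, 0)` and `u₂ = (1/2, √3/2)`. -/

/-- The sites of the f-orbital layer. -/
abbrev FSite (Γ : AddSubgroup (ℤ × ℤ)) : Type := (ℤ × ℤ) ⧸ Γ

/-- The sites of the p-orbital layer. -/
abbrev PSite (Γ : AddSubgroup (ℤ × ℤ)) : Type := FSite Γ × Fin 2

/-- The orbitals: one f orbital `Sum.inl R` on each f site, and the orbitals
`Sum.inr (r, 0)` (that is, `p_x`) and `Sum.inr (r, 1)` (that is, `p_y`) on each p site. -/
abbrev Orb (Γ : AddSubgroup (ℤ × ℤ)) : Type := FSite Γ ⊕ (PSite Γ × Fin 2)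

/-- The single-particle modes: orbital and spin. -/
abbrev Mode (Γ : AddSubgroup (ℤ × ℤ)) : Type := Orb Γ × Fin 2

/-- The operators on Fock space. -/
abbrev Op (Γ : AddSubgroup (ℤ × ℤ)) : Type := Matrix (Finset (Mode Γ)) (Finset (Mode Γ)) ℂ

instance instFintypeFSite (Γ : AddSubgroup (ℤ × ℤ)) [Γ.FiniteIndex] : Fintype (FSite Γ) :=
  Fintype.ofFinite _

instance instDecidableEqFSite (Γ : AddSubgroup (ℤ × ℤ)) : DecidableEq (FSite Γ) :=
  Classical.decEq _

/-- The nearest-neighbour vectors `w₁, …, w₆` of the triangular lattice. -/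
def wVec : Fin 6 → ℤ × ℤ := ![(1, 0), (0, 1), (-1, 1), (-1, 0), (0, -1), (1, -1)]

/-- The unit vectors `v₁, v₂, v₃` along the bonds from sublattice A to sublattice B. -/
def vHat (j : Fin 3) : Fin 2 → ℝ :=
  ![Real.cos (2 * Real.pi / 3 * (j : ℕ)), Real.sin (2 * Real.pi / 3 * (j : ℕ))]

/-- The unit vectors `uᵢ^⊥ = (-sin θᵢ, cos θᵢ)`, with `θ = 0, π/3, …, 5π/3`. -/
def uPerp (i : Fin 6) : Fin 2 → ℝ :=
  ![-Real.sin (Real.pi / 3 * (i : ℕ)), Real.cos (Real.pi / 3 * (i : ℕ))]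

variable {Γ : AddSubgroup (ℤ × ℤ)}

/-- The triangular lattice site `R + (a w₁ + b w₂)`. -/
def shift (R : FSite Γ) (x : ℤ × ℤ) : FSite Γ := R + QuotientAddGroup.mk x

/-- The six vertices `R + u₁, …, R + u₆` of the honeycomb plaquette around `R`. -/
def vertex (R : FSite Γ) : Fin 6 → PSite Γ :=
  ![(R, 0), (R, 1), (shift R (-1, 1), 0), (shift R (-1, 0), 1), (shift R (-1, 0), 0),
    (shift R (0, -1), 1)]

/-- The three neighbours `r + v₁, r + v₂, r + v₃` of the A site `r = R + u₁`. -/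
def bondEnd (R : FSite Γ) : Fin 3 → PSite Γ :=
  ![(shift R (1, -1), 1), (R, 1), (shift R (0, -1), 1)]

variable [Γ.FiniteIndex]

/-! ### The Hamiltonian -/

/-- The real parameters of the model. -/
structure Params where
  (tp tf tfp μp μf Up Uf J : ℝ)

/-- The annihilation operator of the f orbital at `R`. -/
def fOp (R : FSite Γ) (σ : Fin 2) : Op Γ := annih (Sum.inl R, σ)

/-- The annihilation operator `v · p_{r, σ}` of the p orbital at `r` in the direction `v`. -/
def pOp (r : PSite Γ) (v : Fin 2 → ℝ) (σ : Fin 2) : Op Γ :=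
  ∑ o : Fin 2, (v o : ℂ) • annih (Sum.inr (r, o), σ)

/-- Hopping in the p layer along the bonds of the honeycomb lattice. -/
def hopP (q : Params) : Op Γ :=
  (q.tp : ℂ) • ∑ R : FSite Γ, ∑ σ : Fin 2, ∑ j : Fin 3,
    ((pOp (bondEnd R j) (vHat j) σ)ᴴ * pOp (R, 0) (vHat j) σ
      + ((pOp (bondEnd R j) (vHat j) σ)ᴴ * pOp (R, 0) (vHat j) σ)ᴴ)

/-- Hopping in the f layer. The sum over `R` and over the six neighbours of `R` contains each
term together with its Hermitian conjugate, so every bond has the amplitude `t_f`. -/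
def hopF (q : Params) : Op Γ :=
  (q.tf : ℂ) • ∑ R : FSite Γ, ∑ σ : Fin 2, ∑ i : Fin 6,
    (fOp (shift R (wVec i)) σ)ᴴ * fOp R σ

/-- Hopping between the layers. -/
def hopFP (q : Params) : Op Γ :=
  (q.tfp : ℂ) • ∑ R : FSite Γ, ∑ σ : Fin 2, ∑ i : Fin 6, (-1 : ℂ) ^ (i : ℕ) •
    ((fOp R σ)ᴴ * pOp (vertex R i) (uPerp i) σ
      + ((fOp R σ)ᴴ * pOp (vertex R i) (uPerp i) σ)ᴴ)

/-- The chemical potentials of the two layers. -/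
def chemPot (q : Params) : Op Γ :=
  -(q.μp : ℂ) • ∑ x : PSite Γ × Fin 2, numOrb (Sum.inr x : Orb Γ)
    - (q.μf : ℂ) • ∑ R : FSite Γ, numOrb (Sum.inl R : Orb Γ)

/-- The particle-hole symmetric Hubbard interaction `(n_{o↑} - 1/2)(n_{o↓} - 1/2)`. -/
def hubbardTerm (o : Orb Γ) : Op Γ :=
  (num (o, (0 : Fin 2)) - (1 / 2 : ℂ) • 1) * (num (o, (1 : Fin 2)) - (1 / 2 : ℂ) • 1)

/-- The intra-orbital Hubbard interaction. -/
def hubbard (q : Params) : Op Γ :=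
  (q.Up : ℂ) • ∑ x : PSite Γ × Fin 2, hubbardTerm (Sum.inr x : Orb Γ)
    + (q.Uf : ℂ) • ∑ R : FSite Γ, hubbardTerm (Sum.inl R : Orb Γ)

/-- Hund's coupling `-J ∑_r (S_{r,x} · S_{r,y} - n_{r,x} n_{r,y} / 4)`. -/
def hund (q : Params) : Op Γ :=
  -(q.J : ℂ) • ∑ r : PSite Γ,
    ((∑ i : Fin 3, spinOp (Sum.inr (r, 0) : Orb Γ) i * spinOp (Sum.inr (r, 1) : Orb Γ) i)
      - (1 / 4 : ℂ) • (numOrb (Sum.inr (r, 0) : Orb Γ) * numOrb (Sum.inr (r, 1) : Orb Γ)))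

/-- The Hamiltonian of the model. -/
def hamiltonian (Γ : AddSubgroup (ℤ × ℤ)) [Γ.FiniteIndex] (q : Params) : Op Γ :=
  hopP q + hopF q + hopFP q + chemPot q + hubbard q + hund q

/-! ### Localized states, clusters and hole-cluster states -/

/-- The (unnormalized) localized wave function around `R`: amplitude `t_fp` on the f orbital at
`R`, and `t_f` times the alternating loop `∑ᵢ (-1)^(i-1) |R + uᵢ, uᵢ^⊥⟩`. -/
def localized (q : Params) (R : FSite Γ) : Orb Γ → ℝ
  | Sum.inl R' => if R' = R then q.tfp else 0
  | Sum.inr (r, o) => q.tf * ∑ i : Fin 6, if vertex R i = r then (-1) ^ (i : ℕ) * uPerp i o else 0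

/-- The annihilation operator `a_{R,σ}` of the localized state around `R`. -/
def aOp (q : Params) (R : FSite Γ) (σ : Fin 2) : Op Γ :=
  ∑ o : Orb Γ, (localized q R o : ℂ) • annih (o, σ)

/-- Two localized states overlap if some orbital carries a nonzero amplitude of both. -/
def Overlap (q : Params) (R R' : FSite Γ) : Prop :=
  ∃ o : Orb Γ, localized q R o ≠ 0 ∧ localized q R' o ≠ 0

open Classical in
/-- The cluster of `R` in `A`: the labels in `A` that are connected to `R` by a path of
successively overlapping labels in `A`. -/
def clusterOf (q : Params) (A : Finset (FSite Γ)) (R : FSite Γ) : Finset (FSite Γ) :=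
  A.filter fun R' => Relation.ReflTransGen (fun x y => x ∈ A ∧ y ∈ A ∧ Overlap q x y) R R'

/-- The partition of `A` into clusters. -/
def clusters (q : Params) (A : Finset (FSite Γ)) : Finset (Finset (FSite Γ)) :=
  A.image (clusterOf q A)

open Classical in
/-- The set `V` of orbitals on which some localized state of `C` is nonzero. -/
def clusterOrbitals (q : Params) (C : Finset (FSite Γ)) : Finset (Orb Γ) :=
  Finset.univ.filter fun o => ∃ R ∈ C, localized q R o ≠ 0

/-- The state `∏_k (S^{(h)-}_{C_k})^{n_k} ∏_{R ∈ A} a_{R↑} |F⟩`, where `n_k = |C_k|/2 - m_k`.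
The order of the first product is immaterial, that of the second one affects only the sign. -/
def holeClusterState (q : Params) (A : Finset (FSite Γ)) (n : Finset (FSite Γ) → ℕ) :
    Finset (Mode Γ) → ℂ :=
  (((clusters q A).toList.map fun C => holeLower (clusterOrbitals q C) ^ n C).prod
    * (A.toList.map fun R => aOp q R 0).prod) *ᵥ filled

end

/-! The argument is about holes in the completely filled state.

Write a one-particle amplitude as a pair `(f, z)` of f and p amplitudes. The flat band is spanned
by the localized states `φ_R`, and it is the kernel of `offBand`, which subtracts from `z` the
superposition of alternating plaquette loops determined by `f`. The Gram matrix of the loops is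
`6` minus the adjacency matrix of the triangular lattice (`loopSum_gram`), and a loop has opposite
components along a bond at the two ends of the bond (`along_loopSum_add`). These two facts turn the
hopping into a diagonal form minus `(t_fp² / t_f - 3 t_p) |offBand|² + t_p |bondDiff|²`
(`one_body_identity`), where `t_fp² > 3 t_p t_f` makes the first coefficient positive. In terms of
holes, the Hubbard terms penalize pairs of holes in one orbital, and the Hund term singlet pairs of
holes on one p site (`hund_term`). The value of `μ_f` equalizes the diagonal energies, so that the
Hamiltonian is a constant plus a multiple of the particle number plus a sum of positive terms
(`hamiltonian_decomposition`). A nonzero common zero of these terms exists for each `N_e` in the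
range, so the ground states are exactly the common zeros (`groundSpace_eq`, `IsFrustrationFree`): no
hole outside the flat band, no orbital doubly occupied by holes, no singlet pair on a p site.

The f orbital at `R` belongs to `φ_R` alone; hence the operators `addHole`, creating a hole in
`φ_R`, and `removeHole`, a multiple of the creation operator of that f orbital, are dual to each
other, and a state without holes outside the flat band is expanded in hole states whose
coefficients are what `removeAll` leaves (`exists_expansion`). On a p site the three localized
states that meet have amplitudes proportional to vectors `e_0, e_1, e_2` of the plane, whose
symmetrized products `e_k ⊙ e_l`, `k < l`, are linearly independent (`exchange_of_tensor_eqs`). So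
the conditions on doubly occupied orbitals and on singlets say precisely that no localized state is
doubly occupied, and that amplitudes are symmetric in the spins of holes in overlapping localized
states (`IsFrustrationFree.exchange`, `isFrustrationFree_of_exchange`). By connectedness the
amplitudes of a ground state depend on the numbers of flipped spins in the clusters only
(`removeAll_eq_of_profile`), while the powers of the lowering operators produce exactly the uniform
superpositions of the states with given such numbers (`prod_holeLower_mulVec`). Hence the
hole-cluster states are ground states and span them (`IsFrustrationFree.mem_span`).

The squared spin of a cluster is `spinSq V = L Lᴴ + Z² + Z` with the lowering operator `L`
(`spinSq_eq`); it commutes with all cluster lowering operators, and the fully polarized state is a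
highest weight vector. At half filling of the flat band all localized states carry a hole, and the
lattice is a single cluster containing all orbitals (`clusterOf_univ`, `clusterOrbitals_univ`). -/

noncomputable section

/-! ### Canonical anticommutation relations -/

section FockAlgebra

variable {M : Type} [Fintype M] [DecidableEq M]

/-- The Jordan-Wigner sign of the mode `m` in the occupation state `S`. -/
def jwSign (m : M) (S : Finset M) : ℂ :=
  (-1) ^ (S.filter fun x => Fintype.equivFin M x < Fintype.equivFin M m).card

lemma jwSign_mul_self (m : M) (S : Finset M) : jwSign m S * jwSign m S = 1 := by
  rw [jwSign, ← pow_add, ← two_mul, pow_mul]; simp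

lemma jwSign_insert {m n : M} {S : Finset M} (h : n ∉ S) :
    jwSign m (insert n S) =
      if Fintype.equivFin M n < Fintype.equivFin M m then -jwSign m S else jwSign m S := by
  unfold jwSign
  rw [Finset.filter_insert]
  split_ifs
  · rw [Finset.card_insert_of_notMem (by simp [h])]; ring
  · rfl

lemma annih_mulVec (m : M) (Ψ : Finset M → ℂ) (S : Finset M) :
    (annih m *ᵥ Ψ) S = if m ∈ S then 0 else jwSign m S * Ψ (insert m S) := by
  simp only [annih, mulVec, dotProduct, Matrix.of_apply, ite_mul, zero_mul]
  split_ifs with h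
  · simp [h]
  · simp [h, jwSign]

lemma creat_mulVec (m : M) (Ψ : Finset M → ℂ) (S : Finset M) :
    (creat m *ᵥ Ψ) S = if m ∈ S then jwSign m (S.erase m) * Ψ (S.erase m) else 0 := by
  simp only [creat, annih, mulVec, dotProduct, Matrix.conjTranspose_apply, Matrix.of_apply]
  split_ifs with h
  · rw [Finset.sum_eq_single (S.erase m)]
    · simp [Finset.insert_erase h, jwSign]
    · intro T _ hT
      rw [if_neg]
      · simp
      · rintro ⟨h1, rfl⟩; exact hT (by simp [h1])
    · simp
  · refine Finset.sum_eq_zero fun T _ => ?_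
    rw [if_neg]
    · simp
    · rintro ⟨h1, rfl⟩; simp at h

lemma ext_mulVec {n : Type} [Fintype n] [DecidableEq n] {A B : Matrix n n ℂ}
    (h : ∀ v, A *ᵥ v = B *ᵥ v) : A = B :=
  Matrix.toLin'.injective (LinearMap.ext fun v => by simpa using h v)

lemma equivFin_lt_or {m n : M} (h : m ≠ n) :
    (Fintype.equivFin M m < Fintype.equivFin M n ∧ ¬ Fintype.equivFin M n < Fintype.equivFin M m) ∨
    (Fintype.equivFin M n < Fintype.equivFin M m ∧
      ¬ Fintype.equivFin M m < Fintype.equivFin M n) := by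
  rcases lt_trichotomy (Fintype.equivFin M m) (Fintype.equivFin M n) with h1 | h1 | h1
  · exact Or.inl ⟨h1, h1.asymm⟩
  · exact absurd ((Fintype.equivFin M).injective h1) h
  · exact Or.inr ⟨h1, h1.asymm⟩

lemma annih_mul_annih (m n : M) : annih m * annih n = -(annih n * annih m) := by
  refine ext_mulVec fun v => ?_
  rw [Matrix.neg_mulVec, ← mulVec_mulVec, ← mulVec_mulVec]
  ext S
  simp only [annih_mulVec, Pi.neg_apply]
  by_cases hmn : m = n
  · subst hmn; simp
  by_cases hm : m ∈ S
  · simp [hm]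
  by_cases hn : n ∈ S
  · simp [hn]
  simp only [hm, hn, Finset.mem_insert, hmn, Ne.symm hmn, jwSign_insert hm, jwSign_insert hn,
    Finset.insert_comm m n S, or_self, if_false]
  rcases equivFin_lt_or hmn with ⟨h1, h2⟩ | ⟨h1, h2⟩ <;> simp only [h1, h2, if_true, if_false] <;>
    ring

lemma creat_mul_creat (m n : M) : creat m * creat n = -(creat n * creat m) := by
  rw [creat, creat, ← conjTranspose_mul, annih_mul_annih, conjTranspose_neg, conjTranspose_mul]

lemma annih_mul_creat (m n : M) :
    annih m * creat n = (if m = n then 1 else 0) - creat n * annih m := by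
  refine ext_mulVec fun v => ?_
  rw [Matrix.sub_mulVec, ← mulVec_mulVec, ← mulVec_mulVec]
  ext S
  by_cases hmn : m = n
  · subst hmn
    simp only [annih_mulVec, creat_mulVec, Pi.sub_apply]
    by_cases hm : m ∈ S
    · simp [hm, ← mul_assoc, jwSign_mul_self]
    · simp [hm, ← mul_assoc, jwSign_mul_self]
  · simp only [annih_mulVec, creat_mulVec, Pi.sub_apply]
    by_cases hm : m ∈ S
    · simp [hm, hmn]
    by_cases hn : n ∈ S
    · obtain ⟨T, hT, rfl⟩ : ∃ T, n ∉ T ∧ S = insert n T :=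
        ⟨S.erase n, by simp, by simp [hn]⟩
      have hm' : m ∉ T := fun h => hm (by simp [h])
      have e : (insert m (insert n T)).erase n = insert m T := by
        rw [Finset.insert_comm, Finset.erase_insert]
        simp [hT, Ne.symm hmn]
      simp only [hm, hmn, hT, Ne.symm hmn, e, jwSign_insert hT, jwSign_insert hm', if_false,
        Finset.mem_insert, true_or, or_true, if_true, Finset.erase_insert hT, Matrix.zero_mulVec,
        Pi.zero_apply, hm', or_false, or_self]
      rcases equivFin_lt_or hmn with ⟨h1, h2⟩ | ⟨h1, h2⟩ <;>
        simp only [h1, h2, if_true, if_false] <;> ring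
    · simp [hm, hn, hmn, Ne.symm hmn]

lemma conjTranspose_annih (m : M) : (annih m)ᴴ = creat m := rfl

lemma conjTranspose_creat (m : M) : (creat m)ᴴ = annih m := conjTranspose_conjTranspose _

/-! ### Particle number -/

lemma num_mulVec (m : M) (Ψ : Finset M → ℂ) (S : Finset M) :
    (num m *ᵥ Ψ) S = if m ∈ S then Ψ S else 0 := by
  rw [num, ← mulVec_mulVec]
  simp only [annih_mulVec, creat_mulVec]
  split_ifs with h
  · simp at *
  · simp [h, ← mul_assoc, jwSign_mul_self]
  · rfl

lemma mem_sector_iff {N : ℕ} {Ψ : Finset M → ℂ} :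
    Ψ ∈ sector N ↔ ∀ S, Ψ S ≠ 0 → S.card = N := by
  rw [sector, Module.End.mem_eigenspace_iff, Matrix.toLin'_apply, Matrix.sum_mulVec, funext_iff]
  refine forall_congr' fun S => ?_
  simp only [Finset.sum_apply, num_mulVec, Pi.smul_apply, smul_eq_mul, Finset.sum_ite_mem,
    Finset.univ_inter, Finset.sum_const, nsmul_eq_mul]
  constructor
  · intro h h0
    exact_mod_cast mul_right_cancel₀ h0 h
  · intro h
    by_cases h0 : Ψ S = 0
    · simp [h0]
    · rw [h h0]

lemma sum_num_mulVec {N : ℕ} {Ψ : Finset M → ℂ} (h : Ψ ∈ sector N) :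
    (∑ m : M, num m) *ᵥ Ψ = (N : ℂ) • Ψ := by
  rwa [sector, Module.End.mem_eigenspace_iff, Matrix.toLin'_apply] at h

lemma annih_mem_sector {N : ℕ} {Ψ : Finset M → ℂ} (h : Ψ ∈ sector (N + 1)) (m : M) :
    annih m *ᵥ Ψ ∈ sector N := by
  rw [mem_sector_iff] at *
  intro S hS
  rw [annih_mulVec] at hS
  split_ifs at hS with hm
  · exact absurd rfl hS
  · have := h _ (right_ne_zero_of_mul hS)
    rw [Finset.card_insert_of_notMem hm] at this
    omega

lemma creat_mem_sector {N : ℕ} {Ψ : Finset M → ℂ} (h : Ψ ∈ sector N) (m : M) :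
    creat m *ᵥ Ψ ∈ sector (N + 1) := by
  rw [mem_sector_iff] at *
  intro S hS
  rw [creat_mulVec] at hS
  split_ifs at hS with hm
  · have := h _ (right_ne_zero_of_mul hS)
    rw [Finset.card_erase_of_mem hm] at this
    have := Finset.card_pos.2 ⟨m, hm⟩
    omega
  · exact absurd rfl hS

lemma sector_eq_bot {N : ℕ} (h : Fintype.card M < N) : sector (M := M) N = ⊥ := by
  rw [eq_bot_iff]
  intro Ψ hΨ
  rw [mem_sector_iff] at hΨ
  rw [Submodule.mem_bot]
  ext S
  by_contra h0
  have := hΨ S h0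
  have := Finset.card_le_univ S
  omega

lemma eq_zero_of_mem_full_sector {Ψ : Finset M → ℂ} (h : Ψ ∈ sector (Fintype.card M))
    {S : Finset M} (hS : S ≠ Finset.univ) : Ψ S = 0 := by
  rw [mem_sector_iff] at h
  by_contra h0
  exact hS ((Finset.card_eq_iff_eq_univ S).1 (h S h0))

lemma creat_mulVec_eq_zero_of_full {Ψ : Finset M → ℂ} (h : Ψ ∈ sector (Fintype.card M)) (m : M) :
    creat m *ᵥ Ψ = 0 := by
  have := creat_mem_sector h m
  rwa [sector_eq_bot (Nat.lt_succ_self _), Submodule.mem_bot] at this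

end FockAlgebra

/-! ### The completely filled state -/

section Filled

variable {O : Type} [Fintype O] [DecidableEq O]

lemma creat_mulVec_single {M : Type} [Fintype M] [DecidableEq M] {m : M} {S : Finset M}
    (h : m ∉ S) (c : ℂ) : creat m *ᵥ (Pi.single S c) = Pi.single (insert m S) (jwSign m S * c) := by
  ext T
  rw [creat_mulVec, Pi.single_apply, Pi.single_apply]
  by_cases hT : T = insert m S
  · subst hT; simp [h]
  · rw [if_neg hT]
    split_ifs with h1 h2
    · exact absurd (by rw [← h2, Finset.insert_erase h1]) hT
    · simp
    · rfl

lemma filled_eq_single : ∃ c : ℂ, c ≠ 0 ∧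
    (filled : Finset (O × Fin 2) → ℂ) = Pi.single Finset.univ c := by
  have key : ∀ l : List O, l.Nodup → ∃ c : ℂ, c ≠ 0 ∧
      (l.map fun o => creat (o, (0 : Fin 2)) * creat (o, 1)).prod *ᵥ vacuum =
        Pi.single (l.toFinset ×ˢ Finset.univ) c := by
    intro l
    induction l with
    | nil => intro _; exact ⟨1, one_ne_zero, by rw [List.map_nil, List.prod_nil, one_mulVec]; simp [vacuum]⟩
    | cons o l ih =>
      intro hl
      rw [List.nodup_cons] at hl
      obtain ⟨c, hc, h⟩ := ih hl.2
      rw [List.map_cons, List.prod_cons, ← mulVec_mulVec, h, ← mulVec_mulVec,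
        creat_mulVec_single (by simp [hl.1]), creat_mulVec_single (by simp [hl.1])]
      refine ⟨_, ?_, congrArg₂ _ ?_ rfl⟩
      · exact mul_ne_zero (left_ne_zero_of_mul_eq_one (jwSign_mul_self _ _))
          (mul_ne_zero (left_ne_zero_of_mul_eq_one (jwSign_mul_self _ _)) hc)
      · ext ⟨o', σ⟩
        fin_cases σ <;> simp
  obtain ⟨c, hc, h⟩ := key _ (Finset.nodup_toList (Finset.univ : Finset O))
  refine ⟨c, hc, ?_⟩
  rw [filled, h]
  congr 1
  simp

lemma filled_ne_zero : (filled : Finset (O × Fin 2) → ℂ) ≠ 0 := by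
  obtain ⟨c, hc, h⟩ := filled_eq_single (O := O)
  rw [h]
  simpa using hc

lemma filled_mem_sector : (filled : Finset (O × Fin 2) → ℂ) ∈ sector (Fintype.card (O × Fin 2)) := by
  obtain ⟨c, hc, h⟩ := filled_eq_single (O := O)
  rw [h, mem_sector_iff]
  intro S hS
  rw [Pi.single_apply] at hS
  split_ifs at hS with h1
  · rw [h1, Finset.card_univ]
  · exact absurd rfl hS

lemma creat_mulVec_filled (m : O × Fin 2) : creat m *ᵥ filled = 0 :=
  creat_mulVec_eq_zero_of_full filled_mem_sector m

lemma exists_smul_filled {Ψ : Finset (O × Fin 2) → ℂ}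
    (h : Ψ ∈ sector (Fintype.card (O × Fin 2))) : ∃ c : ℂ, Ψ = c • filled := by
  obtain ⟨c, hc, hf⟩ := filled_eq_single (O := O)
  refine ⟨Ψ Finset.univ * c⁻¹, ?_⟩
  rw [hf]
  ext S
  by_cases hS : S = Finset.univ
  · subst hS; simp [hc]
  · simp [hS, eq_zero_of_mem_full_sector h hS]

end Filled

/-! ### Geometry of the two lattices and of the localized states -/

section Lattice

variable {Γ : AddSubgroup (ℤ × ℤ)}

lemma shift_zero (R : FSite Γ) : shift R (0, 0) = R := by
  have : ((0, 0) : ℤ × ℤ) = 0 := rfl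
  simp [shift, this]

lemma shift_shift (R : FSite Γ) (x y : ℤ × ℤ) : shift (shift R x) y = shift R (x + y) := by
  simp [shift, add_assoc]

lemma shift_eq_iff (R S : FSite Γ) (x : ℤ × ℤ) : shift R x = S ↔ R = shift S (-x) := by
  simp only [shift, QuotientAddGroup.mk_neg]
  exact eq_add_neg_iff_add_eq.symm

lemma shift_inj (R : FSite Γ) (x y : ℤ × ℤ) : shift R x = shift R y ↔ y - x ∈ Γ := by
  rw [shift, shift, add_right_inj, QuotientAddGroup.eq, sub_eq_neg_add]

/-- The amplitude vectors of the three plaquette states that meet at a honeycomb site. -/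
def eVec : Fin 3 → Fin 2 → ℝ := ![![0, 1], ![-(√3 / 2), -(1 / 2)], ![√3 / 2, -(1 / 2)]]

/-- The centres of the three plaquettes that share the honeycomb site `r`, listed so that the
localized state around `nbr r k` has the amplitude `t_f * eVec k` on `r`. -/
def nbr (r : PSite Γ) : Fin 3 → FSite Γ :=
  if r.2 = 0 then ![r.1, shift r.1 (1, -1), shift r.1 (1, 0)]
  else ![shift r.1 (1, 0), shift r.1 (0, 1), r.1]

lemma nbr_zero (S : FSite Γ) : nbr (S, 0) = ![S, shift S (1, -1), shift S (1, 0)] := rfl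

lemma nbr_one (S : FSite Γ) : nbr (S, 1) = ![shift S (1, 0), shift S (0, 1), S] := rfl

lemma nbr_injective (hΓ : ∀ i, wVec i ∉ Γ) (r : PSite Γ) : Function.Injective (nbr r) := by
  have h : ∀ x : ℤ × ℤ, (∃ i, wVec i = x) → x ∉ Γ := by
    rintro _ ⟨i, rfl⟩; exact hΓ i
  have h1 := h (1, 0) ⟨0, rfl⟩
  have h2 := h (0, 1) ⟨1, rfl⟩
  have h3 := h (-1, 1) ⟨2, rfl⟩
  have h4 := h (-1, 0) ⟨3, rfl⟩
  have h5 := h (0, -1) ⟨4, rfl⟩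
  have h6 := h (1, -1) ⟨5, rfl⟩
  have e0 : ∀ (R : FSite Γ) x, R = shift R x ↔ x ∈ Γ := fun R x => by
    conv_lhs => lhs; rw [← shift_zero R]
    rw [shift_inj, show ((0, 0) : ℤ × ℤ) = 0 from rfl, sub_zero]
  have e1 : ∀ (R : FSite Γ) x, shift R x = R ↔ -x ∈ Γ := fun R x => by
    conv_lhs => rhs; rw [← shift_zero R]
    rw [shift_inj, show ((0, 0) : ℤ × ℤ) = 0 from rfl, zero_sub]
  obtain ⟨S, τ⟩ := r
  intro k l hkl
  fin_cases τ <;> fin_cases k <;> fin_cases l <;>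
    simp_all [nbr_zero, nbr_one, shift_inj]

lemma uPerp_zero : uPerp 0 = ![0, 1] := by simp [uPerp]

lemma uPerp_one : uPerp 1 = ![-(√3 / 2), 1 / 2] := by simp [uPerp]

lemma sin_two_thirds : Real.sin (2 * Real.pi / 3) = √3 / 2 := by
  rw [show 2 * Real.pi / 3 = Real.pi - Real.pi / 3 by ring, Real.sin_pi_sub, Real.sin_pi_div_three]

lemma cos_two_thirds : Real.cos (2 * Real.pi / 3) = -(1 / 2) := by
  rw [show 2 * Real.pi / 3 = Real.pi - Real.pi / 3 by ring, Real.cos_pi_sub, Real.cos_pi_div_three]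

lemma sin_four_thirds : Real.sin (4 * Real.pi / 3) = -(√3 / 2) := by
  rw [show 4 * Real.pi / 3 = Real.pi / 3 + Real.pi by ring, Real.sin_add_pi,
    Real.sin_pi_div_three]

lemma cos_four_thirds : Real.cos (4 * Real.pi / 3) = -(1 / 2) := by
  rw [show 4 * Real.pi / 3 = Real.pi / 3 + Real.pi by ring, Real.cos_add_pi,
    Real.cos_pi_div_three]

lemma uPerp_two : uPerp 2 = ![-(√3 / 2), -(1 / 2)] := by
  have : Real.pi / 3 * ((2 : Fin 6) : ℕ) = 2 * Real.pi / 3 := by simp; ring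
  rw [uPerp, this, sin_two_thirds, cos_two_thirds]

lemma uPerp_three : uPerp 3 = ![0, -1] := by
  have : Real.pi / 3 * ((3 : Fin 6) : ℕ) = Real.pi := by simp
  rw [uPerp, this]; simp

lemma uPerp_four : uPerp 4 = ![√3 / 2, -(1 / 2)] := by
  have : Real.pi / 3 * ((4 : Fin 6) : ℕ) = 4 * Real.pi / 3 := by simp; ring
  rw [uPerp, this, sin_four_thirds, cos_four_thirds]; simp

lemma uPerp_five : uPerp 5 = ![√3 / 2, 1 / 2] := by
  have : Real.pi / 3 * ((5 : Fin 6) : ℕ) = -(Real.pi / 3) + 2 * Real.pi := by simp; ring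
  rw [uPerp, this, Real.sin_add_two_pi, Real.cos_add_two_pi, Real.sin_neg, Real.cos_neg,
    Real.sin_pi_div_three, Real.cos_pi_div_three]; simp

lemma vHat_zero : vHat 0 = ![1, 0] := by simp [vHat]

lemma vHat_one : vHat 1 = ![-(1 / 2), √3 / 2] := by
  have : 2 * Real.pi / 3 * ((1 : Fin 3) : ℕ) = 2 * Real.pi / 3 := by simp
  rw [vHat, this, sin_two_thirds, cos_two_thirds]

lemma vHat_two : vHat 2 = ![-(1 / 2), -(√3 / 2)] := by
  have : 2 * Real.pi / 3 * ((2 : Fin 3) : ℕ) = 4 * Real.pi / 3 := by simp; ring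
  rw [vHat, this, sin_four_thirds, cos_four_thirds]

lemma localized_inl (q : Params) (R R' : FSite Γ) :
    localized q R (Sum.inl R') = if R' = R then q.tfp else 0 := rfl

lemma localized_inr (q : Params) (R : FSite Γ) (r : PSite Γ) (o : Fin 2) :
    localized q R (Sum.inr (r, o)) = q.tf * ∑ k, if R = nbr r k then eVec k o else 0 := by
  obtain ⟨S, τ⟩ := r
  simp only [localized]
  congr 1
  rcases Classical.propComplete (R = S) with h1 | h1 <;>
  rcases Classical.propComplete (R = shift S (1, -1)) with h2 | h2 <;>
  rcases Classical.propComplete (R = shift S (1, 0)) with h3 | h3 <;>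
  rcases Classical.propComplete (R = shift S (0, 1)) with h4 | h4 <;>
  fin_cases τ <;> fin_cases o <;>
    simp [Fin.sum_univ_six, Fin.sum_univ_three, vertex, shift_eq_iff, nbr_zero, nbr_one, eVec,
      uPerp_zero, uPerp_one, uPerp_two, uPerp_three, uPerp_four, uPerp_five, pow_succ, h1, h2, h3,
      h4] <;> ring

variable [Γ.FiniteIndex]

/-- The alternating plaquette loops, superposed with the amplitudes `f`. -/
def loopSum (f : FSite Γ → ℝ) (r : PSite Γ) (o : Fin 2) : ℝ := ∑ k, eVec k o * f (nbr r k)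

/-- Translation invariance of a lattice sum. -/
lemma sum_shift {E : Type*} [AddCommMonoid E] (x : ℤ × ℤ) (f : FSite Γ → E) :
    ∑ R, f (shift R x) = ∑ R, f R :=
  Equiv.sum_comp (Equiv.addRight (QuotientAddGroup.mk x : FSite Γ)) f

end Lattice

/-! ### The hopping form as a sum of squares -/

section OneBody

variable {Γ : AddSubgroup (ℤ × ℤ)} [Γ.FiniteIndex]

/-- The component of the p amplitudes `z` at `r` along the vector `v`. -/
def along (v : Fin 2 → ℝ) (z : PSite Γ → Fin 2 → ℝ) (r : PSite Γ) : ℝ := ∑ o, v o * z r o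

lemma sqrt_three_mul_self : √3 * √3 = 3 := Real.mul_self_sqrt (by norm_num)

lemma sum_pSite {E : Type*} [AddCommMonoid E] (f : PSite Γ → E) :
    ∑ r, f r = ∑ S : FSite Γ, (f (S, 0) + f (S, 1)) := by
  rw [Fintype.sum_prod_type]
  exact Finset.sum_congr rfl fun S _ => by rw [Fin.sum_univ_two]

/-- The f-p hopping couples the f amplitudes to the plaquette loops. -/
lemma loopSum_adjoint (f : FSite Γ → ℝ) (z : PSite Γ → Fin 2 → ℝ) :
    ∑ R, ∑ i : Fin 6, (-1) ^ (i : ℕ) * (f R * along (uPerp i) z (vertex R i)) =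
      ∑ r, ∑ o, loopSum f r o * z r o := by
  have h1 := sum_shift (1, -1) fun R => f R * along (eVec 1) z (shift R (-1, 1), 0)
  have h2 := sum_shift (1, 0) fun R => f R * along (eVec 2) z (shift R (-1, 0), 0)
  have h3 := sum_shift (1, 0) fun R => f R * along (eVec 0) z (shift R (-1, 0), 1)
  have h4 := sum_shift (0, 1) fun R => f R * along (eVec 1) z (shift R (0, -1), 1)
  simp only [shift_shift, Prod.mk_add_mk] at h1 h2 h3 h4
  norm_num [shift_zero] at h1 h2 h3 h4
  calc _ = ∑ R, (f R * along (eVec 0) z (R, 0) + f R * along (eVec 2) z (R, 1)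
        + f R * along (eVec 1) z (shift R (-1, 1), 0)
        + f R * along (eVec 2) z (shift R (-1, 0), 0)
        + f R * along (eVec 0) z (shift R (-1, 0), 1)
        + f R * along (eVec 1) z (shift R (0, -1), 1)) := by
        refine Finset.sum_congr rfl fun R _ => ?_
        simp [Fin.sum_univ_six, along, eVec, vertex,
          uPerp_zero, uPerp_one, uPerp_two, uPerp_three, uPerp_four, uPerp_five, pow_succ]
        ring
    _ = ∑ R, (f R * along (eVec 0) z (R, 0) + f R * along (eVec 2) z (R, 1)
        + f (shift R (1, -1)) * along (eVec 1) z (R, 0)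
        + f (shift R (1, 0)) * along (eVec 2) z (R, 0)
        + f (shift R (1, 0)) * along (eVec 0) z (R, 1)
        + f (shift R (0, 1)) * along (eVec 1) z (R, 1)) := by
        simp only [Finset.sum_add_distrib, h1, h2, h3, h4]
    _ = _ := by
        rw [sum_pSite]
        refine Finset.sum_congr rfl fun R _ => ?_
        simp [Fin.sum_univ_three, along, eVec, loopSum, nbr_zero, nbr_one]
        ring

lemma sum_shift_mul_shift (f g : FSite Γ → ℝ) (x y : ℤ × ℤ) :
    ∑ R, f (shift R x) * g (shift R y) = ∑ R, f (shift R (x - y)) * g R := by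
  rw [← sum_shift y fun R => f (shift R (x - y)) * g R]
  simp [shift_shift]

/-- Adjacent plaquette loops overlap with amplitude `-1`: the Gram matrix of the loops is `6` minus
the adjacency matrix of the triangular lattice. -/
lemma loopSum_gram (f g : FSite Γ → ℝ) :
    ∑ r, ∑ o, loopSum f r o * loopSum g r o =
      6 * ∑ R, f R * g R - ∑ R, ∑ i, f (shift R (wVec i)) * g R := by
  have h := sum_shift_mul_shift f g
  have h0 : ∀ y, ∑ R, f R * g (shift R y) = ∑ R, f (shift R (-y)) * g R := fun y => by
    have := h (0, 0) y
    simp only [shift_zero] at this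
    rw [this, show ((0, 0) : ℤ × ℤ) = 0 from rfl, zero_sub]
  have hd : ∀ x, ∑ R, f (shift R x) * g (shift R x) = ∑ R, f R * g R := fun x => by
    rw [h, sub_self, show (0 : ℤ × ℤ) = (0, 0) from rfl]; simp only [shift_zero]
  calc _ = ∑ R, ((f R * g R + f (shift R (1, -1)) * g (shift R (1, -1))
          + f (shift R (1, 0)) * g (shift R (1, 0)) + f R * g R
          + f (shift R (0, 1)) * g (shift R (0, 1)) + f (shift R (1, 0)) * g (shift R (1, 0)))
        - 1 / 2 * (f R * g (shift R (1, -1)) + f (shift R (1, -1)) * g R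
          + f R * g (shift R (1, 0)) + f (shift R (1, 0)) * g R
          + f (shift R (1, -1)) * g (shift R (1, 0)) + f (shift R (1, 0)) * g (shift R (1, -1))
          + f R * g (shift R (0, 1)) + f (shift R (0, 1)) * g R
          + f R * g (shift R (1, 0)) + f (shift R (1, 0)) * g R
          + f (shift R (0, 1)) * g (shift R (1, 0))
          + f (shift R (1, 0)) * g (shift R (0, 1)))) := by
        rw [sum_pSite]
        refine Finset.sum_congr rfl fun R _ => ?_
        simp only [Fin.sum_univ_two, Fin.sum_univ_three, eVec, loopSum, nbr_zero, nbr_one,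
          Matrix.cons_val_zero, Matrix.cons_val_one, Matrix.cons_val]
        ring_nf
        rw [show √3 ^ 2 = 3 by rw [sq, sqrt_three_mul_self]]
        ring
    _ = _ := by
        simp only [Finset.sum_sub_distrib, ← Finset.mul_sum, Finset.sum_add_distrib, h0, hd, h,
          Fin.sum_univ_six, wVec, Matrix.cons_val_zero, Matrix.cons_val_one, Matrix.cons_val,
          Prod.neg_mk, Prod.mk_sub_mk]
        norm_num
        ring

/-- A plaquette loop has opposite components along the bond at the two ends of every bond. -/
lemma along_loopSum_add (f : FSite Γ → ℝ) (S : FSite Γ) (j : Fin 3) :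
    along (vHat j) (loopSum f) (bondEnd S j) + along (vHat j) (loopSum f) (S, 0) = 0 := by
  fin_cases j <;>
    simp [along, loopSum, Fin.sum_univ_three, bondEnd, nbr_zero, nbr_one, eVec,
      vHat_zero, vHat_one, vHat_two, shift_shift] <;>
    norm_num [← Prod.zero_eq_mk, show shift S 0 = S from shift_zero S, ← sub_eq_add_neg] <;>
    ring

/-- The three bond directions at a honeycomb site form a tight frame of the plane, with frame
constant `3 / 2`. -/
lemma sum_along_mul_along (z z' : PSite Γ → Fin 2 → ℝ) :
    ∑ S, ∑ j, along (vHat j) z (S, 0) * along (vHat j) z' (S, 0)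
      + ∑ S, ∑ j, along (vHat j) z (bondEnd S j) * along (vHat j) z' (bondEnd S j)
      = 3 / 2 * ∑ r, ∑ o, z r o * z' r o := by
  have hb : ∑ S, ∑ j, along (vHat j) z (bondEnd S j) * along (vHat j) z' (bondEnd S j)
      = ∑ S, ∑ j, along (vHat j) z (S, 1) * along (vHat j) z' (S, 1) := by
    simp only [Fin.sum_univ_three, Finset.sum_add_distrib]
    exact congrArg₂ _ (congrArg₂ _
      (sum_shift (1, -1) fun S => along (vHat 0) z (S, 1) * along (vHat 0) z' (S, 1)) rfl)
      (sum_shift (0, -1) fun S => along (vHat 2) z (S, 1) * along (vHat 2) z' (S, 1))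
  rw [hb, ← Finset.sum_add_distrib, sum_pSite, Finset.mul_sum]
  refine Finset.sum_congr rfl fun S _ => ?_
  simp only [Fin.sum_univ_two, Fin.sum_univ_three, along, vHat_zero, vHat_one, vHat_two,
    Matrix.cons_val_zero, Matrix.cons_val_one]
  ring_nf
  rw [show √3 ^ 2 = 3 by rw [sq, sqrt_three_mul_self]]
  ring

lemma along_sub (v : Fin 2 → ℝ) (z z' : PSite Γ → Fin 2 → ℝ) (r : PSite Γ) :
    along v (z - z') r = along v z r - along v z' r := by
  simp [along, mul_sub]

lemma along_smul (v : Fin 2 → ℝ) (c : ℝ) (z : PSite Γ → Fin 2 → ℝ) (r : PSite Γ) :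
    along v (c • z) r = c * along v z r := by
  simp only [along, Pi.smul_apply, smul_eq_mul, Finset.mul_sum]
  exact Finset.sum_congr rfl fun o _ => by ring

/-- The part of the amplitudes `(f, z)` outside the flat band: it vanishes exactly for the
superpositions of the localized states. -/
def offBand (q : Params) (f : FSite Γ → ℝ) (z : PSite Γ → Fin 2 → ℝ) : PSite Γ → Fin 2 → ℝ :=
  z - (q.tf / q.tfp) • loopSum f

/-- The difference of the components of `offBand` along a bond at the two ends of the bond. -/
def bondDiff (q : Params) (f : FSite Γ → ℝ) (z : PSite Γ → Fin 2 → ℝ) (S : FSite Γ) (j : Fin 3) :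
    ℝ :=
  along (vHat j) (offBand q f z) (bondEnd S j) - along (vHat j) (offBand q f z) (S, 0)

/-- The bilinear form of the hopping, plus the positive forms of `offBand` and `bondDiff`, is a
diagonal form. With the components `a`, `b` of the p amplitudes at the two ends of a bond and
`a'`, `b'` those of a second amplitude, the bond term is
`a * b' + b * a' = (a + b) * (a' + b') - a * a' - b * b'`; the sum `a + b` is unchanged when
plaquette loops are subtracted, and for the components of `offBand` the first product is
`2 * (a * a' + b * b') - (b - a) * (b' - a')`. The f hopping is absorbed by `loopSum_gram`. -/
lemma one_body_identity (q : Params) (htf : q.tf ≠ 0) (htfp : q.tfp ≠ 0)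
    (f g : FSite Γ → ℝ) (z y : PSite Γ → Fin 2 → ℝ) :
    q.tp * ∑ S, ∑ j, (along (vHat j) z (S, 0) * along (vHat j) y (bondEnd S j)
        + along (vHat j) z (bondEnd S j) * along (vHat j) y (S, 0))
      + q.tf * ∑ S, ∑ i, f S * g (shift S (wVec i))
      + q.tfp * ∑ S, ∑ i : Fin 6, (-1) ^ (i : ℕ) *
          (along (uPerp i) z (vertex S i) * g S + f S * along (uPerp i) y (vertex S i))
      + ((q.tfp ^ 2 / q.tf - 3 * q.tp) * ∑ r, ∑ o, offBand q f z r o * offBand q g y r o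
        + q.tp * ∑ S, ∑ j, bondDiff q f z S j * bondDiff q g y S j)
    = 6 * q.tf * ∑ S, f S * g S
      + (q.tfp ^ 2 / q.tf - 3 / 2 * q.tp) * ∑ r, ∑ o, z r o * y r o := by
  set x := offBand q f z with hx
  set w := offBand q g y with hw
  have e1 := loopSum_adjoint f y
  have e2 := loopSum_adjoint g z
  have e3 := loopSum_gram g f
  have e4 := sum_along_mul_along z y
  have e5 := sum_along_mul_along x w
  have ht : ∑ S, ∑ i : Fin 6, (-1) ^ (i : ℕ) *
          (along (uPerp i) z (vertex S i) * g S + f S * along (uPerp i) y (vertex S i))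
      = ∑ r, ∑ o, loopSum g r o * z r o + ∑ r, ∑ o, loopSum f r o * y r o := by
    rw [← e1, ← e2]
    simp only [← Finset.sum_add_distrib]
    exact Finset.sum_congr rfl fun S _ => Finset.sum_congr rfl fun i _ => by ring
  have ha : ∑ S, ∑ i, f S * g (shift S (wVec i)) = ∑ R, ∑ i, g (shift R (wVec i)) * f R :=
    Finset.sum_congr rfl fun S _ => Finset.sum_congr rfl fun i _ => mul_comm _ _
  have hfg : ∑ S, f S * g S = ∑ S, g S * f S := Finset.sum_congr rfl fun S _ => mul_comm _ _
  have hX : ∑ r, ∑ o, x r o * w r o = ∑ r, ∑ o, z r o * y r o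
      - q.tf / q.tfp * (∑ r, ∑ o, loopSum g r o * z r o + ∑ r, ∑ o, loopSum f r o * y r o)
      + (q.tf / q.tfp) ^ 2 * ∑ r, ∑ o, loopSum g r o * loopSum f r o := by
    simp only [Finset.mul_sum, ← Finset.sum_add_distrib, ← Finset.sum_sub_distrib]
    refine Finset.sum_congr rfl fun r _ => Finset.sum_congr rfl fun o _ => ?_
    simp only [hx, hw, offBand, Pi.sub_apply, Pi.smul_apply, smul_eq_mul]
    ring
  have hplus : ∀ (f : FSite Γ → ℝ) (z : PSite Γ → Fin 2 → ℝ) (S : FSite Γ) (j : Fin 3),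
      along (vHat j) (offBand q f z) (bondEnd S j) + along (vHat j) (offBand q f z) (S, 0) =
        along (vHat j) z (bondEnd S j) + along (vHat j) z (S, 0) := by
    intro f z S j
    have := along_loopSum_add f S j
    simp only [offBand, along_sub, along_smul]
    linear_combination (-(q.tf / q.tfp)) * this
  have hhop : ∑ S, ∑ j, (along (vHat j) z (S, 0) * along (vHat j) y (bondEnd S j)
        + along (vHat j) z (bondEnd S j) * along (vHat j) y (S, 0))
      + ∑ S, ∑ j, along (vHat j) z (S, 0) * along (vHat j) y (S, 0)
      + ∑ S, ∑ j, along (vHat j) z (bondEnd S j) * along (vHat j) y (bondEnd S j)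
      + ∑ S, ∑ j, bondDiff q f z S j * bondDiff q g y S j
      = 2 * (∑ S, ∑ j, along (vHat j) x (S, 0) * along (vHat j) w (S, 0)
      + ∑ S, ∑ j, along (vHat j) x (bondEnd S j) * along (vHat j) w (bondEnd S j)) := by
    simp only [Finset.mul_sum, ← Finset.sum_add_distrib]
    refine Finset.sum_congr rfl fun S _ => Finset.sum_congr rfl fun j _ => ?_
    have h1 := hplus f z S j
    have h2 := hplus g y S j
    rw [← hx] at h1
    rw [← hw] at h2
    simp only [bondDiff, ← hx, ← hw]
    linear_combination (-(along (vHat j) w (bondEnd S j) + along (vHat j) w (S, 0))) * h1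
      - (along (vHat j) z (bondEnd S j) + along (vHat j) z (S, 0)) * h2
  rw [ht, ha, hfg]
  have hh : ∑ S, ∑ j, (along (vHat j) z (S, 0) * along (vHat j) y (bondEnd S j)
        + along (vHat j) z (bondEnd S j) * along (vHat j) y (S, 0))
      + ∑ S, ∑ j, bondDiff q f z S j * bondDiff q g y S j
      = 3 * ∑ r, ∑ o, x r o * w r o - 3 / 2 * ∑ r, ∑ o, z r o * y r o := by
    linear_combination hhop - e4 + 2 * e5
  rw [e3] at hX
  rw [hX] at hh ⊢
  generalize ∑ r, ∑ o, loopSum g r o * z r o = a1 at *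
  generalize ∑ r, ∑ o, loopSum f r o * y r o = a2 at *
  generalize ∑ r, ∑ o, z r o * y r o = a3 at *
  generalize ∑ R, ∑ i, g (shift R (wVec i)) * f R = a4 at *
  generalize ∑ S, ∑ j, bondDiff q f z S j * bondDiff q g y S j = a5 at *
  generalize ∑ S, g S * f S = a6 at *
  field_simp
  field_simp at hh
  linear_combination q.tf * q.tp * hh

end OneBody

/-! ### One-particle operators in terms of holes -/

section SecondQuantization

variable {O : Type} [Fintype O] [DecidableEq O]

/-- The number operator of holes in the mode `m`. -/
def holeNum {M : Type} [Fintype M] [DecidableEq M] (m : M) : Matrix (Finset M) (Finset M) ℂ :=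
  annih m * creat m

lemma num_eq {M : Type} [Fintype M] [DecidableEq M] (m : M) : num m = 1 - holeNum m := by
  rw [num, holeNum, annih_mul_creat, if_pos rfl, sub_sub_cancel]

/-- The annihilation operator of the one-particle state with the real amplitudes `x`. -/
def annVec (x : O → ℝ) (σ : Fin 2) : Matrix (Finset (O × Fin 2)) (Finset (O × Fin 2)) ℂ :=
  ∑ o, (x o : ℂ) • annih (o, σ)

/-- The creation operator of the one-particle state with the real amplitudes `x`. -/
def creVec (x : O → ℝ) (σ : Fin 2) : Matrix (Finset (O × Fin 2)) (Finset (O × Fin 2)) ℂ :=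
  ∑ o, (x o : ℂ) • creat (o, σ)

lemma conjTranspose_annVec (x : O → ℝ) (σ : Fin 2) : (annVec x σ)ᴴ = creVec x σ := by
  simp [annVec, creVec, conjTranspose_sum, conjTranspose_smul, conjTranspose_annih]

lemma conjTranspose_creVec (x : O → ℝ) (σ : Fin 2) : (creVec x σ)ᴴ = annVec x σ := by
  rw [← conjTranspose_annVec, conjTranspose_conjTranspose]

lemma annVec_mul_creVec (x y : O → ℝ) (σ τ : Fin 2) :
    annVec x σ * creVec y τ =
      (if σ = τ then ((∑ o, x o * y o : ℝ) : ℂ) else 0) • 1 - creVec y τ * annVec x σ := by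
  have h : ∀ o o' : O, ((x o : ℂ) • annih (o, σ)) * ((y o' : ℂ) • creat (o', τ)) =
      (if o = o' then (if σ = τ then ((x o * y o : ℝ) : ℂ) else 0) else 0) •
        (1 : Matrix (Finset (O × Fin 2)) (Finset (O × Fin 2)) ℂ)
      - ((y o' : ℂ) • creat (o', τ)) * ((x o : ℂ) • annih (o, σ)) := by
    intro o o'
    rw [smul_mul_smul_comm, annih_mul_creat, smul_mul_smul_comm, smul_sub, mul_comm (y o' : ℂ)]
    congr 1
    by_cases h1 : o = o' <;> by_cases h2 : σ = τ <;> simp [h1, h2]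
  rw [annVec, creVec, Finset.sum_mul_sum, Finset.sum_mul_sum]
  simp only [h, Finset.sum_sub_distrib]
  congr 1
  · simp only [← Finset.sum_smul, Finset.sum_ite_eq, Finset.mem_univ, if_true]
    by_cases h2 : σ = τ <;> simp [h2]
  · exact Finset.sum_comm

/-- The second quantization, in terms of holes of spin `σ`, of the real one-particle operator
with the matrix `K`. -/
def holeQuant (σ : Fin 2) :
    (O → O → ℝ) →ₗ[ℝ] Matrix (Finset (O × Fin 2)) (Finset (O × Fin 2)) ℂ where
  toFun K := ∑ o, ∑ o', K o o' • (annih (o, σ) * creat (o', σ))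
  map_add' K K' := by simp [add_smul, Finset.sum_add_distrib]
  map_smul' c K := by simp [mul_smul, Finset.smul_sum]

/-- The rank-one kernel with the factors `x` and `y`. -/
def rankOne (x y : O → ℝ) : O → O → ℝ := fun o o' => x o * y o'

lemma holeQuant_rankOne (σ : Fin 2) (x y : O → ℝ) :
    holeQuant σ (rankOne x y) = annVec x σ * creVec y σ := by
  rw [annVec, creVec, Finset.sum_mul_sum]
  refine Finset.sum_congr rfl fun o _ => Finset.sum_congr rfl fun o' _ => ?_
  rw [smul_mul_smul_comm, rankOne, ← Complex.ofReal_mul, Complex.coe_smul]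

/-- The real multiples of the identity: Hamiltonians are compared modulo constants. -/
def constOps (O : Type) [Fintype O] [DecidableEq O] :
    Submodule ℝ (Matrix (Finset (O × Fin 2)) (Finset (O × Fin 2)) ℂ) :=
  Submodule.span ℝ {1}

lemma smul_one_mem_constOps (c : ℝ) :
    (c : ℂ) • (1 : Matrix (Finset (O × Fin 2)) (Finset (O × Fin 2)) ℂ) ∈ constOps O := by
  rw [Complex.coe_smul]
  exact Submodule.smul_mem _ _ (Submodule.mem_span_singleton_self _)

lemma conjTranspose_annVec_mul (x y : O → ℝ) (σ : Fin 2) :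
    (annVec x σ)ᴴ * annVec y σ ≡ -holeQuant σ (rankOne y x) [SMOD constOps O] := by
  rw [SModEq.sub_mem, conjTranspose_annVec, holeQuant_rankOne, annVec_mul_creVec, if_pos rfl]
  rw [sub_neg_eq_add, add_sub_cancel]
  exact smul_one_mem_constOps _

lemma annVec_mul_annVec (x y : O → ℝ) (σ τ : Fin 2) :
    annVec x σ * annVec y τ = -(annVec y τ * annVec x σ) := by
  rw [annVec, annVec, Finset.sum_mul_sum, Finset.sum_mul_sum, ← Finset.sum_neg_distrib,
    Finset.sum_comm]
  refine Finset.sum_congr rfl fun o _ => ?_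
  rw [← Finset.sum_neg_distrib]
  refine Finset.sum_congr rfl fun o' _ => ?_
  rw [smul_mul_smul_comm, annih_mul_annih, smul_mul_smul_comm, smul_neg, mul_comm]

lemma creVec_mul_creVec (x y : O → ℝ) (σ τ : Fin 2) :
    creVec x σ * creVec y τ = -(creVec y τ * creVec x σ) := by
  rw [← conjTranspose_annVec, ← conjTranspose_annVec, ← conjTranspose_mul, annVec_mul_annVec,
    conjTranspose_neg, conjTranspose_mul]

/-! ### Interaction terms in terms of holes -/

/-- The operator annihilating a pair of holes in the orbital `o`. -/
def pairOp (o : O) : Matrix (Finset (O × Fin 2)) (Finset (O × Fin 2)) ℂ :=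
  creat (o, 0) * creat (o, 1)

/-- The operator annihilating a singlet pair of holes in the orbitals `x` and `y`. -/
def singletOp (x y : O) : Matrix (Finset (O × Fin 2)) (Finset (O × Fin 2)) ℂ :=
  creat (x, 0) * creat (y, 1) - creat (x, 1) * creat (y, 0)

/-- The operator turning a hole of spin index `0` in the orbital `o` into one of index `1`. -/
def spinFlip (o : O) : Matrix (Finset (O × Fin 2)) (Finset (O × Fin 2)) ℂ :=
  annih (o, 1) * creat (o, 0)

lemma conjTranspose_spinFlip (o : O) : (spinFlip o)ᴴ = annih (o, 0) * creat (o, 1) := by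
  rw [spinFlip, conjTranspose_mul, conjTranspose_creat, conjTranspose_annih]

/-- Bilinears in a mode commute with the operators of all other modes. -/
lemma annih_mul_bilinear {M : Type} [Fintype M] [DecidableEq M] {n m m' : M} (h' : n ≠ m') :
    annih n * (annih m * creat m') = annih m * creat m' * annih n := by
  rw [← mul_assoc, annih_mul_annih, neg_mul, mul_assoc, annih_mul_creat, if_neg h', zero_sub,
    mul_neg, neg_neg, mul_assoc]

lemma pair_product {M : Type} [Fintype M] [DecidableEq M] {n n' m m' : M} (h' : n ≠ m') :
    annih n * annih m * (creat m' * creat n') = annih m * creat m' * (annih n * creat n') := by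
  rw [← mul_assoc, mul_assoc (annih n), annih_mul_bilinear h', mul_assoc (annih m * creat m')]

lemma pairOp_sq (o : O) : (pairOp o)ᴴ * pairOp o = holeNum (o, 0) * holeNum (o, 1) := by
  rw [pairOp, conjTranspose_mul, conjTranspose_creat, conjTranspose_creat,
    pair_product (by simp), holeNum, holeNum]

lemma singletOp_sq {x y : O} (h : x ≠ y) :
    (singletOp x y)ᴴ * singletOp x y = holeNum (x, 0) * holeNum (y, 1)
      + holeNum (x, 1) * holeNum (y, 0) - (spinFlip x)ᴴ * spinFlip y - spinFlip x * (spinFlip y)ᴴ := by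
  have h' : ∀ σ τ : Fin 2, (y, σ) ≠ (x, τ) := fun σ τ e => h (Prod.ext_iff.1 e).1.symm
  rw [singletOp, conjTranspose_sub, conjTranspose_mul, conjTranspose_mul]
  simp only [conjTranspose_creat, sub_mul, mul_sub, pair_product (h' _ _), conjTranspose_spinFlip]
  rw [holeNum, holeNum, holeNum, holeNum, spinFlip, spinFlip]
  abel

lemma creat_mul_annih {M : Type} [Fintype M] [DecidableEq M] {m n : M} (h : m ≠ n) :
    creat m * annih n = -(annih n * creat m) := by
  rw [annih_mul_creat, if_neg h.symm, zero_sub, neg_neg]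

lemma spinOp_zero (o : O) : spinOp o 0 = (-1 / 2 : ℂ) • (spinFlip o + (spinFlip o)ᴴ) := by
  rw [conjTranspose_spinFlip, spinOp, spinFlip]
  simp only [Fin.sum_univ_two, pauli, Matrix.cons_val_zero, Matrix.of_apply,
    Matrix.cons_val', Matrix.cons_val_one, Matrix.cons_val_fin_one]
  rw [creat_mul_annih (m := (o, 0)) (n := (o, 1)) (by simp),
    creat_mul_annih (m := (o, 1)) (n := (o, 0)) (by simp)]
  module

lemma spinOp_one (o : O) : spinOp o 1 = (Complex.I / 2 : ℂ) • (spinFlip o - (spinFlip o)ᴴ) := by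
  rw [conjTranspose_spinFlip, spinOp, spinFlip]
  simp only [Fin.sum_univ_two, pauli, Matrix.cons_val_zero, Matrix.of_apply,
    Matrix.cons_val', Matrix.cons_val_one, Matrix.cons_val_fin_one]
  rw [creat_mul_annih (m := (o, 0)) (n := (o, 1)) (by simp),
    creat_mul_annih (m := (o, 1)) (n := (o, 0)) (by simp)]
  module

lemma spinOp_two (o : O) : spinOp o 2 = (1 / 2 : ℂ) • (holeNum (o, 1) - holeNum (o, 0)) := by
  have h : ∀ m : O × Fin 2, holeNum m = 1 - creat m * annih m := fun m => by
    rw [holeNum, annih_mul_creat, if_pos rfl]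
  rw [h, h, spinOp]
  simp [Fin.sum_univ_two, pauli, ← sub_eq_add_neg]

/-- Up to a multiple of the hole number and a constant, the Hund coupling of two orbitals counts
the singlet pairs of holes. -/
lemma hund_term {x y : O} (h : x ≠ y) :
    (∑ i : Fin 3, spinOp x i * spinOp y i) - (1 / 4 : ℂ) • (numOrb x * numOrb y) =
      -((1 / 2 : ℂ) • ((singletOp x y)ᴴ * singletOp x y)) +
        (1 / 2 : ℂ) • (holeNum (x, 0) + holeNum (x, 1) + holeNum (y, 0) + holeNum (y, 1)) - 1 := by
  rw [singletOp_sq h, Fin.sum_univ_three, spinOp_zero, spinOp_zero, spinOp_one, spinOp_one,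
    spinOp_two, spinOp_two, numOrb, numOrb, Fin.sum_univ_two, Fin.sum_univ_two, num_eq, num_eq,
    num_eq, num_eq]
  simp only [smul_mul_smul_comm]
  have hI : Complex.I / 2 * (Complex.I / 2) = -1 / 4 := by
    linear_combination (1 / 4 : ℂ) * Complex.I_mul_I
  rw [hI]
  simp only [mul_add, add_mul, mul_sub, sub_mul, mul_one, one_mul]
  module

end SecondQuantization

/-! ### The Hamiltonian as a sum of positive terms -/

section Hamiltonian

variable {Γ : AddSubgroup (ℤ × ℤ)} [Γ.FiniteIndex]

/-- The indicator of the f orbital at `R`, as a function of the orbital. -/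
def fAmp (o : Orb Γ) (R : FSite Γ) : ℝ := if o = Sum.inl R then 1 else 0

/-- The indicator of the p orbital `i` at `r`, as a function of the orbital. -/
def pAmp (o : Orb Γ) (r : PSite Γ) (i : Fin 2) : ℝ := if o = Sum.inr (r, i) then 1 else 0

/-- The operator annihilating a hole outside the flat band: the p orbital `i` at `r`,
orthogonalized to the localized states. -/
def offOp (q : Params) (r : PSite Γ) (i σ : Fin 2) : Op Γ :=
  creVec (fun o => offBand q (fAmp o) (pAmp o) r i) σ

/-- The combination of the operators `offOp` given by `bondDiff`. -/
def bondOp (q : Params) (S : FSite Γ) (j : Fin 3) (σ : Fin 2) : Op Γ :=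
  creVec (fun o => bondDiff q (fAmp o) (pAmp o) S j) σ

lemma fOp_eq (R : FSite Γ) (σ : Fin 2) : fOp R σ = annVec (fun o => fAmp o R) σ := by
  simp [fOp, annVec, fAmp]

lemma annVec_pAmp (r : PSite Γ) (i σ : Fin 2) :
    annVec (fun o : Orb Γ => pAmp o r i) σ = annih (Sum.inr (r, i), σ) := by
  simp [annVec, pAmp]

lemma pOp_eq (r : PSite Γ) (v : Fin 2 → ℝ) (σ : Fin 2) :
    pOp r v σ = annVec (fun o => along v (pAmp o) r) σ := by
  simp only [pOp, annVec, along, Complex.ofReal_sum, Finset.sum_smul]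
  rw [Finset.sum_comm]
  refine Finset.sum_congr rfl fun i _ => ?_
  rw [← annVec_pAmp, annVec, Finset.smul_sum]
  exact Finset.sum_congr rfl fun o _ => by rw [smul_smul, Complex.ofReal_mul]

lemma bondOp_eq (q : Params) (S : FSite Γ) (j : Fin 3) (σ : Fin 2) :
    bondOp q S j σ = ∑ i, (vHat j i : ℂ) • (offOp q (bondEnd S j) i σ - offOp q (S, 0) i σ) := by
  simp only [bondOp, offOp, creVec, bondDiff, along, ← Finset.sum_sub_distrib, Finset.smul_sum,
    Complex.ofReal_sum, Finset.sum_smul, ← sub_smul]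
  rw [Finset.sum_comm]
  refine Finset.sum_congr rfl fun i _ => Finset.sum_congr rfl fun o _ => ?_
  rw [smul_smul]
  push_cast
  congr 1
  ring

/-- The kernel of the hopping Hamiltonian. -/
def hopKernel (q : Params) : Orb Γ → Orb Γ → ℝ :=
  q.tp • ∑ S : FSite Γ, ∑ j : Fin 3,
      (rankOne (fun o : Orb Γ => along (vHat j) (pAmp o) (S, 0))
          (fun o => along (vHat j) (pAmp o) (bondEnd S j))
        + rankOne (fun o => along (vHat j) (pAmp o) (bondEnd S j))
          (fun o => along (vHat j) (pAmp o) (S, 0)))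
    + q.tf • ∑ S : FSite Γ, ∑ i : Fin 6,
        rankOne (fun o => fAmp o S) (fun o => fAmp o (shift S (wVec i)))
    + q.tfp • ∑ S : FSite Γ, ∑ i : Fin 6, (-1 : ℝ) ^ (i : ℕ) •
        (rankOne (fun o => along (uPerp i) (pAmp o) (vertex S i)) (fun o => fAmp o S)
          + rankOne (fun o => fAmp o S) (fun o => along (uPerp i) (pAmp o) (vertex S i)))

lemma hopKernel_eq (q : Params) (htf : q.tf ≠ 0) (htfp : q.tfp ≠ 0) :
    hopKernel (Γ := Γ) q
      + ((q.tfp ^ 2 / q.tf - 3 * q.tp) • ∑ r, ∑ i,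
          rankOne (fun o => offBand q (fAmp o) (pAmp o) r i)
            (fun o => offBand q (fAmp o) (pAmp o) r i)
        + q.tp • ∑ S, ∑ j, rankOne (fun o => bondDiff q (fAmp o) (pAmp o) S j)
            (fun o => bondDiff q (fAmp o) (pAmp o) S j))
    = (6 * q.tf) • ∑ S, rankOne (fun o => fAmp o S) (fun o => fAmp o S)
      + (q.tfp ^ 2 / q.tf - 3 / 2 * q.tp) • ∑ r, ∑ i,
          rankOne (fun o => pAmp o r i) (fun o => pAmp o r i) := by
  funext o o'
  have := one_body_identity q htf htfp (fAmp o) (fAmp o') (pAmp o) (pAmp o')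
  simpa only [hopKernel, Pi.add_apply, Pi.smul_apply, Finset.sum_apply, rankOne,
    smul_eq_mul] using this

lemma hop_smodEq (q : Params) :
    hopP q + hopF q + hopFP q ≡ -∑ σ, holeQuant σ (hopKernel (Γ := Γ) q)
      [SMOD constOps (Orb Γ)] := by
  have h1 : hopP q ≡ q.tp • ∑ S : FSite Γ, ∑ σ, ∑ j : Fin 3,
      (-holeQuant σ (rankOne (fun o : Orb Γ => along (vHat j) (pAmp o) (S, 0))
          (fun o => along (vHat j) (pAmp o) (bondEnd S j)))
        + -holeQuant σ (rankOne (fun o => along (vHat j) (pAmp o) (bondEnd S j))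
          (fun o => along (vHat j) (pAmp o) (S, 0)))) [SMOD constOps (Orb Γ)] := by
    rw [hopP, Complex.coe_smul]
    refine SModEq.smul (SModEq.sum fun S _ => SModEq.sum fun σ _ => SModEq.sum fun j _ => ?_) _
    rw [conjTranspose_mul, conjTranspose_conjTranspose, pOp_eq, pOp_eq]
    exact (conjTranspose_annVec_mul _ _ _).add (conjTranspose_annVec_mul _ _ _)
  have h2 : hopF q ≡ q.tf • ∑ S : FSite Γ, ∑ σ, ∑ i : Fin 6,
      -holeQuant σ (rankOne (fun o : Orb Γ => fAmp o S) (fun o => fAmp o (shift S (wVec i))))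
        [SMOD constOps (Orb Γ)] := by
    rw [hopF, Complex.coe_smul]
    refine SModEq.smul (SModEq.sum fun S _ => SModEq.sum fun σ _ => SModEq.sum fun j _ => ?_) _
    rw [fOp_eq, fOp_eq]
    exact conjTranspose_annVec_mul _ _ _
  have h3 : hopFP q ≡ q.tfp • ∑ S : FSite Γ, ∑ σ, ∑ i : Fin 6, (-1 : ℝ) ^ (i : ℕ) •
      (-holeQuant σ (rankOne (fun o : Orb Γ => along (uPerp i) (pAmp o) (vertex S i))
          (fun o => fAmp o S))
        + -holeQuant σ (rankOne (fun o => fAmp o S)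
          (fun o => along (uPerp i) (pAmp o) (vertex S i)))) [SMOD constOps (Orb Γ)] := by
    rw [hopFP, Complex.coe_smul]
    refine SModEq.smul (SModEq.sum fun S _ => SModEq.sum fun σ _ => SModEq.sum fun i _ => ?_) _
    rw [show ((-1 : ℂ) ^ (i : ℕ)) = (((-1 : ℝ) ^ (i : ℕ) : ℝ) : ℂ) by push_cast; rfl,
      Complex.coe_smul, conjTranspose_mul, conjTranspose_conjTranspose, pOp_eq, fOp_eq]
    exact SModEq.smul ((conjTranspose_annVec_mul _ _ _).add (conjTranspose_annVec_mul _ _ _)) _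
  refine ((h1.add h2).add h3).trans ?_
  have e : ∀ (n : ℕ) (f : FSite Γ → Fin 2 → Fin n → Op Γ),
      ∑ S, ∑ σ, ∑ j, f S σ j = ∑ σ, ∑ S, ∑ j, f S σ j := fun n f => Finset.sum_comm
  rw [e, e, e]
  simp only [hopKernel, map_add, map_smul, map_sum, Finset.sum_add_distrib, ← Finset.smul_sum,
    smul_add, smul_neg, Finset.sum_neg_distrib, neg_add]
  rfl

lemma sum_mode {E : Type*} [AddCommMonoid E] (f : Mode Γ → E) :
    ∑ m, f m = ∑ R, (f (Sum.inl R, 0) + f (Sum.inl R, 1))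
      + ∑ x, (f (Sum.inr x, 0) + f (Sum.inr x, 1)) := by
  rw [Fintype.sum_prod_type, Fintype.sum_sum_type]
  simp only [Fin.sum_univ_two]

/-- Up to constants and a multiple of the particle number, the Hamiltonian is a sum of
positive terms. -/
def positivePart (q : Params) : Op Γ :=
  ∑ σ, ((q.tfp ^ 2 / q.tf - 3 * q.tp) • ∑ r, ∑ i, (offOp q r i σ)ᴴ * offOp q r i σ
      + q.tp • ∑ S, ∑ j, (bondOp q S j σ)ᴴ * bondOp q S j σ)
    + q.Up • ∑ x, (pairOp (Sum.inr x))ᴴ * pairOp (Sum.inr x)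
    + q.Uf • ∑ R, (pairOp (Sum.inl R))ᴴ * pairOp (Sum.inl R)
    + (q.J / 2) • ∑ r, (singletOp (Sum.inr (r, 0)) (Sum.inr (r, 1)))ᴴ *
        singletOp (Sum.inr (r, 0)) (Sum.inr (r, 1))

lemma hop_smodEq_holeNum (q : Params) (htf : q.tf ≠ 0) (htfp : q.tfp ≠ 0) :
    hopP q + hopF q + hopFP q ≡
      ∑ σ, ((q.tfp ^ 2 / q.tf - 3 * q.tp) • ∑ r, ∑ i, (offOp q r i σ)ᴴ * offOp q r i σ
        + q.tp • ∑ S, ∑ j, (bondOp q S j σ)ᴴ * bondOp q S j σ)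
      - ((6 * q.tf) • ∑ R : FSite Γ, (holeNum (Sum.inl R, 0) + holeNum (Sum.inl R, 1))
        + (q.tfp ^ 2 / q.tf - 3 / 2 * q.tp) •
          ∑ x : PSite Γ × Fin 2, (holeNum (Sum.inr x, 0) + holeNum (Sum.inr x, 1)))
      [SMOD constOps (Orb Γ)] := by
  have hK := eq_sub_of_add_eq (hopKernel_eq (Γ := Γ) q htf htfp)
  have hf : ∀ (R : FSite Γ) (σ : Fin 2),
      annVec (fun o : Orb Γ => fAmp o R) σ * creVec (fun o : Orb Γ => fAmp o R) σ =
        holeNum (Sum.inl R, σ) := fun R σ => by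
    rw [← conjTranspose_annVec, ← fOp_eq]; rfl
  have hp : ∀ (r : PSite Γ) (i σ : Fin 2),
      annVec (fun o : Orb Γ => pAmp o r i) σ * creVec (fun o : Orb Γ => pAmp o r i) σ =
        holeNum (Sum.inr (r, i), σ) := fun r i σ => by
    rw [← conjTranspose_annVec, annVec_pAmp]; rfl
  refine (hop_smodEq q).trans ?_
  rw [hK]
  simp only [map_add, map_sub, map_smul, map_sum, holeQuant_rankOne, hf, hp, offOp, bondOp,
    conjTranspose_creVec, Finset.sum_sub_distrib, neg_sub]
  refine Eq.subst (motive := fun z => _ ≡ z [SMOD constOps (Orb Γ)]) ?_ SModEq.rfl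
  congr 1
  simp only [Fin.sum_univ_two, Finset.sum_add_distrib, smul_add, Fintype.sum_prod_type]
  abel

lemma num_smodEq (m : Mode Γ) : num m ≡ -holeNum m [SMOD constOps (Orb Γ)] := by
  rw [num_eq, SModEq.sub_mem]
  simpa using smul_one_mem_constOps (O := Orb Γ) 1

lemma chemPot_smodEq (q : Params) :
    chemPot (Γ := Γ) q ≡ q.μp • ∑ x, (holeNum (Sum.inr x, 0) + holeNum (Sum.inr x, 1))
      + q.μf • ∑ R, (holeNum (Sum.inl R, 0) + holeNum (Sum.inl R, 1)) [SMOD constOps (Orb Γ)] := by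
  have h : ∀ o : Orb Γ, numOrb o ≡ -(holeNum (o, 0) + holeNum (o, 1)) [SMOD constOps (Orb Γ)] := by
    intro o
    rw [numOrb, Fin.sum_univ_two, neg_add]
    exact (num_smodEq _).add (num_smodEq _)
  rw [chemPot, ← Complex.ofReal_neg, Complex.coe_smul, Complex.coe_smul]
  refine (((SModEq.sum fun x _ => h _).smul _).sub ((SModEq.sum fun x _ => h _).smul _)).trans ?_
  simp only [Finset.sum_neg_distrib, smul_neg, neg_smul, neg_neg, sub_neg_eq_add]
  rfl

lemma hubbardTerm_smodEq (o : Orb Γ) :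
    hubbardTerm o ≡ (pairOp o)ᴴ * pairOp o - (1 / 2 : ℝ) • (holeNum (o, 0) + holeNum (o, 1))
      [SMOD constOps (Orb Γ)] := by
  have : hubbardTerm o = (pairOp o)ᴴ * pairOp o
      - (1 / 2 : ℝ) • (holeNum (o, 0) + holeNum (o, 1)) + ((1 / 4 : ℝ) : ℂ) • 1 := by
    rw [hubbardTerm, pairOp_sq, num_eq, num_eq, ← Complex.coe_smul]
    simp only [mul_sub, sub_mul, mul_one, one_mul, smul_mul_assoc, mul_smul_comm]
    push_cast
    module
  rw [SModEq.sub_mem, this, add_sub_cancel_left]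
  exact smul_one_mem_constOps _

lemma hubbard_smodEq (q : Params) :
    hubbard (Γ := Γ) q ≡ q.Up • ∑ x, (pairOp (Sum.inr x))ᴴ * pairOp (Sum.inr x)
      + q.Uf • ∑ R, (pairOp (Sum.inl R))ᴴ * pairOp (Sum.inl R)
      - ((q.Up / 2) • ∑ x, (holeNum (Sum.inr x, 0) + holeNum (Sum.inr x, 1))
      + (q.Uf / 2) • ∑ R, (holeNum (Sum.inl R, 0) + holeNum (Sum.inl R, 1)))
        [SMOD constOps (Orb Γ)] := by
  rw [hubbard, Complex.coe_smul, Complex.coe_smul]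
  refine (((SModEq.sum fun x _ => hubbardTerm_smodEq _).smul _).add
    ((SModEq.sum fun x _ => hubbardTerm_smodEq _).smul _)).trans ?_
  refine Eq.subst (motive := fun z => _ ≡ z [SMOD constOps (Orb Γ)]) ?_ SModEq.rfl
  simp only [Finset.sum_sub_distrib, ← Finset.smul_sum]
  module

lemma hund_smodEq (q : Params) :
    hund (Γ := Γ) q ≡ (q.J / 2) • ∑ r, (singletOp (Sum.inr (r, 0)) (Sum.inr (r, 1)))ᴴ *
        singletOp (Sum.inr (r, 0)) (Sum.inr (r, 1))
      - (q.J / 2) • ∑ x, (holeNum (Sum.inr x, 0) + holeNum (Sum.inr x, 1))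
        [SMOD constOps (Orb Γ)] := by
  have h : ∀ r : PSite Γ,
      (∑ i : Fin 3, spinOp (Sum.inr (r, 0) : Orb Γ) i * spinOp (Sum.inr (r, 1) : Orb Γ) i)
      - (1 / 4 : ℂ) • (numOrb (Sum.inr (r, 0) : Orb Γ) * numOrb (Sum.inr (r, 1) : Orb Γ)) ≡
      (-1 / 2 : ℝ) • ((singletOp (Sum.inr (r, 0)) (Sum.inr (r, 1)))ᴴ *
        singletOp (Sum.inr (r, 0)) (Sum.inr (r, 1)))
      + (1 / 2 : ℝ) • ∑ i, (holeNum (Sum.inr (r, i), 0) + holeNum (Sum.inr (r, i), 1))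
        [SMOD constOps (Orb Γ)] := by
    intro r
    rw [hund_term (by simp), SModEq.sub_mem, ← neg_mem_iff]
    convert smul_one_mem_constOps (O := Orb Γ) 1 using 1
    rw [Fin.sum_univ_two, ← Complex.coe_smul, ← Complex.coe_smul]
    push_cast
    module
  rw [hund, ← Complex.ofReal_neg, Complex.coe_smul]
  refine ((SModEq.sum fun r _ => h r).smul _).trans ?_
  refine Eq.subst (motive := fun z => _ ≡ z [SMOD constOps (Orb Γ)]) ?_ SModEq.rfl
  rw [Fintype.sum_prod_type (f := fun x : PSite Γ × Fin 2 =>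
    (holeNum (Sum.inr x, 0) + holeNum (Sum.inr x, 1) : Op Γ))]
  simp only [Finset.sum_add_distrib, ← Finset.smul_sum]
  module

/-- Up to a constant and a multiple of the particle number, the Hamiltonian is a sum of positive
terms: the condition on `μ_f` makes the energy per hole in the flat band the coefficient of the
total hole number. -/
lemma hamiltonian_decomposition (q : Params) (htf : q.tf ≠ 0) (htfp : q.tfp ≠ 0)
    (hμ : q.μf = q.μp + 6 * q.tf + 3 / 2 * q.tp - q.tfp ^ 2 / q.tf
      + q.Uf / 2 - q.Up / 2 - q.J / 2) :
    ∃ c e : ℝ, hamiltonian Γ q = positivePart q + (c : ℂ) • 1 + (e : ℂ) • ∑ m, num m := by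
  have hN : (q.μf - 6 * q.tf - q.Uf / 2) • ∑ m : Mode Γ, holeNum m ≡
      -(q.μf - 6 * q.tf - q.Uf / 2) • ∑ m : Mode Γ, num m [SMOD constOps (Orb Γ)] := by
    have := (SModEq.sum (s := Finset.univ) fun m _ => num_smodEq (Γ := Γ) m).smul
      (-(q.μf - 6 * q.tf - q.Uf / 2))
    rw [Finset.sum_neg_distrib, smul_neg, neg_smul, neg_smul, neg_neg] at this
    rw [neg_smul]
    exact this.symm
  have h := ((((hop_smodEq_holeNum (Γ := Γ) q htf htfp).add (chemPot_smodEq q)).add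
    (hubbard_smodEq q)).add (hund_smodEq q))
  have h2 : hamiltonian Γ q ≡ positivePart q + (q.μf - 6 * q.tf - q.Uf / 2) •
      ∑ m : Mode Γ, holeNum m [SMOD constOps (Orb Γ)] := by
    refine h.trans ?_
    refine Eq.subst (motive := fun z => _ ≡ z [SMOD constOps (Orb Γ)]) ?_ SModEq.rfl
    rw [sum_mode, positivePart]
    generalize ∑ x : PSite Γ × Fin 2, (holeNum (Sum.inr x, 0) + holeNum (Sum.inr x, 1) : Op Γ) = P
    generalize ∑ R : FSite Γ, (holeNum (Sum.inl R, 0) + holeNum (Sum.inl R, 1) : Op Γ) = F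
    have hμ' : q.tfp ^ 2 / q.tf - 3 / 2 * q.tp =
        q.μp - q.Up / 2 - q.J / 2 - (q.μf - 6 * q.tf - q.Uf / 2) := by linear_combination hμ
    rw [hμ']
    module
  have h3 := h2.trans ((SModEq.refl _).add hN)
  rw [SModEq.sub_mem, constOps, Submodule.mem_span_singleton] at h3
  obtain ⟨c, hc⟩ := h3
  refine ⟨c, -(q.μf - 6 * q.tf - q.Uf / 2), ?_⟩
  rw [Complex.coe_smul, Complex.coe_smul, hc]
  abel

end Hamiltonian

/-! ### Ground states of frustration-free Hamiltonians -/

section PositiveKernel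

variable {n : Type} [Fintype n] [DecidableEq n]

/-- The quadratic form of `A` is nonnegative, and its zeros have the property `K`. -/
def PosWithZeros (A : Matrix n n ℂ) (K : (n → ℂ) → Prop) : Prop :=
  ∀ v, 0 ≤ (star v ⬝ᵥ A *ᵥ v).re ∧ ((star v ⬝ᵥ A *ᵥ v).re = 0 → K v)

lemma posWithZeros_conjTranspose_mul (B : Matrix n n ℂ) :
    PosWithZeros (Bᴴ * B) fun v => B *ᵥ v = 0 := by
  intro v
  have h : star v ⬝ᵥ (Bᴴ * B) *ᵥ v = ((∑ i, Complex.normSq ((B *ᵥ v) i) : ℝ) : ℂ) := by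
    rw [← mulVec_mulVec, dotProduct_mulVec, vecMul_conjTranspose, star_star, dotProduct]
    push_cast
    exact Finset.sum_congr rfl fun i _ => by
      rw [Complex.normSq_eq_conj_mul_self]; rfl
  rw [h, Complex.ofReal_re]
  refine ⟨Finset.sum_nonneg fun i _ => Complex.normSq_nonneg _, fun h0 => funext fun i => ?_⟩
  exact Complex.normSq_eq_zero.1
    ((Finset.sum_eq_zero_iff_of_nonneg fun i _ => Complex.normSq_nonneg _).1 h0 i
      (Finset.mem_univ i))

lemma PosWithZeros.add {A B : Matrix n n ℂ} {K L : (n → ℂ) → Prop} (hA : PosWithZeros A K)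
    (hB : PosWithZeros B L) : PosWithZeros (A + B) fun v => K v ∧ L v := by
  intro v
  rw [add_mulVec, dotProduct_add, Complex.add_re]
  have h1 := hA v
  have h2 := hB v
  exact ⟨add_nonneg h1.1 h2.1, fun h => ⟨h1.2 (by linarith [h1.1, h2.1]),
    h2.2 (by linarith [h1.1, h2.1])⟩⟩

lemma PosWithZeros.sum {ι : Type} [Fintype ι] {A : ι → Matrix n n ℂ} {K : ι → (n → ℂ) → Prop}
    (h : ∀ i, PosWithZeros (A i) (K i)) : PosWithZeros (∑ i, A i) fun v => ∀ i, K i v := by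
  intro v
  rw [sum_mulVec, dotProduct_sum, Complex.re_sum]
  refine ⟨Finset.sum_nonneg fun i _ => (h i v).1, fun h0 i => (h i v).2 ?_⟩
  exact (Finset.sum_eq_zero_iff_of_nonneg fun i _ => (h i v).1).1 h0 i (Finset.mem_univ i)

lemma PosWithZeros.smul {A : Matrix n n ℂ} {K : (n → ℂ) → Prop} (h : PosWithZeros A K) {c : ℝ}
    (hc : 0 < c) : PosWithZeros (c • A) K := by
  intro v
  rw [smul_mulVec, dotProduct_smul, Complex.real_smul, Complex.re_ofReal_mul]
  refine ⟨mul_nonneg hc.le (h v).1, fun h0 => (h v).2 ?_⟩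
  exact (mul_eq_zero.1 h0).resolve_left hc.ne'

lemma re_star_dotProduct_self_pos {v : n → ℂ} (hv : v ≠ 0) : 0 < (star v ⬝ᵥ v).re := by
  have h := posWithZeros_conjTranspose_mul (1 : Matrix n n ℂ) v
  simp only [conjTranspose_one, mul_one, one_mulVec] at h
  exact lt_of_le_of_ne h.1 fun h0 => hv (h.2 h0.symm)

/-- The ground states of a frustration-free Hamiltonian are the zeros of its positive part. -/
lemma groundSpace_eq {M : Type} [Fintype M] [DecidableEq M] {N : ℕ}
    {H P : Matrix (Finset M) (Finset M) ℂ} {K : (Finset M → ℂ) → Prop} {c e : ℝ}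
    (hH : H = P + (c : ℂ) • 1 + (e : ℂ) • ∑ m, num m) (hP : PosWithZeros P K)
    (hK : ∀ v, K v → P *ᵥ v = 0) (hex : ∃ v ∈ sector N, v ≠ 0 ∧ K v) (v : Finset M → ℂ) :
    v ∈ groundSpace H N ↔ v ∈ sector N ∧ K v := by
  have hHv : ∀ v ∈ sector (M := M) N, H *ᵥ v = P *ᵥ v + ((c + e * N : ℝ) : ℂ) • v := by
    intro v hv
    rw [hH, add_mulVec, add_mulVec, smul_mulVec, smul_mulVec, one_mulVec, sum_num_mulVec hv,
      smul_smul, add_assoc, ← add_smul]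
    push_cast
    rfl
  have hE : groundEnergy H N = c + e * N := by
    refine IsLeast.csInf_eq ⟨?_, ?_⟩
    · obtain ⟨v, hv, h0, hk⟩ := hex
      exact ⟨v, hv, h0, by rw [hHv v hv, hK v hk, zero_add]⟩
    · rintro E ⟨v, hv, h0, h⟩
      rw [hHv v hv, ← eq_sub_iff_add_eq, ← sub_smul, ← Complex.ofReal_sub] at h
      have h1 := (hP v).1
      rw [h, dotProduct_smul, smul_eq_mul, Complex.re_ofReal_mul] at h1
      have := nonneg_of_mul_nonneg_left h1 (re_star_dotProduct_self_pos h0)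
      linarith
  rw [groundSpace, Submodule.mem_inf, Module.End.mem_eigenspace_iff, Matrix.toLin'_apply, hE]
  refine and_congr_right fun hv => ?_
  rw [hHv v hv, add_eq_right]
  refine ⟨fun h => (hP v).2 ?_, hK v⟩
  rw [h, dotProduct_zero, Complex.zero_re]

end PositiveKernel

/-! ### Frustration-free states -/

section FlatBand

variable {Γ : AddSubgroup (ℤ × ℤ)} [Γ.FiniteIndex]

/-- The conditions that characterize the ground states: no hole outside the flat band, no doubly
occupied orbital, no singlet pair of holes on a p site. -/
structure IsFrustrationFree (q : Params) (Ψ : Finset (Mode Γ) → ℂ) : Prop where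
  off : ∀ r i σ, offOp q r i σ *ᵥ Ψ = 0
  pair : ∀ o, pairOp o *ᵥ Ψ = 0
  singlet : ∀ r, singletOp (Sum.inr (r, 0)) (Sum.inr (r, 1)) *ᵥ Ψ = 0

lemma posWithZeros_positivePart (q : Params) (htp : 0 < q.tp) (htf : 0 < q.tf)
    (hUp : 0 < q.Up) (hUf : 0 < q.Uf) (hJ : 0 < q.J) (hgap : 3 * q.tp * q.tf < q.tfp ^ 2) :
    PosWithZeros (positivePart (Γ := Γ) q) (IsFrustrationFree q) := by
  have hg : 0 < q.tfp ^ 2 / q.tf - 3 * q.tp := by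
    rw [sub_pos, lt_div_iff₀ htf]; exact hgap
  have h := ((((PosWithZeros.sum fun σ => ((PosWithZeros.sum fun r => PosWithZeros.sum fun i =>
    posWithZeros_conjTranspose_mul (offOp (Γ := Γ) q r i σ)).smul hg).add
    ((PosWithZeros.sum fun S => PosWithZeros.sum fun j =>
      posWithZeros_conjTranspose_mul (bondOp (Γ := Γ) q S j σ)).smul htp)).add
    ((PosWithZeros.sum fun x => posWithZeros_conjTranspose_mul
      (pairOp (Sum.inr x : Orb Γ))).smul hUp)).add
    ((PosWithZeros.sum fun x => posWithZeros_conjTranspose_mul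
      (pairOp (Sum.inl x : Orb Γ))).smul hUf)).add
    ((PosWithZeros.sum fun r : PSite Γ => posWithZeros_conjTranspose_mul
      (singletOp (Sum.inr (r, 0) : Orb Γ) (Sum.inr (r, 1)))).smul (half_pos hJ)))
  intro v
  refine ⟨(h v).1, fun h0 => ?_⟩
  obtain ⟨⟨⟨h1, h2⟩, h3⟩, h4⟩ := (h v).2 h0
  refine ⟨fun r i σ => (h1 σ).1 r i, fun o => ?_, h4⟩
  rcases o with R | x
  · exact h3 R
  · exact h2 x

lemma IsFrustrationFree.positivePart_mulVec {q : Params} {Ψ : Finset (Mode Γ) → ℂ}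
    (h : IsFrustrationFree q Ψ) : positivePart q *ᵥ Ψ = 0 := by
  have hb : ∀ S j σ, bondOp q S j σ *ᵥ Ψ = 0 := fun S j σ => by
    rw [bondOp_eq, sum_mulVec]
    simp [smul_mulVec, sub_mulVec, h.off]
  simp [positivePart, add_mulVec, sum_mulVec, smul_mulVec, ← mulVec_mulVec, h.off, hb, h.pair,
    h.singlet]

/-! ### The modes of the flat band -/

/-- The labels of the flat band modes: a localized state and a spin index. -/
abbrev BandMode (Γ : AddSubgroup (ℤ × ℤ)) : Type := FSite Γ × Fin 2

/-- The operator creating a hole in a localized state. -/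
def addHole (q : Params) (x : BandMode Γ) : Op Γ := aOp q x.1 x.2

/-- The operator dual to `addHole`, removing a hole from a localized state. Since the f orbital
at `R` belongs to no localized state but that around `R`, it acts on this orbital only. -/
def removeHole (q : Params) (x : BandMode Γ) : Op Γ :=
  ((q.tfp⁻¹ : ℝ) : ℂ) • creat (Sum.inl x.1, x.2)

lemma removeHole_eq (q : Params) (x : BandMode Γ) :
    removeHole q x = creVec (fun o => q.tfp⁻¹ * fAmp o x.1) x.2 := by
  rw [removeHole, creVec, Finset.sum_eq_single (Sum.inl x.1)]
  · rw [fAmp, if_pos rfl, mul_one]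
  · intro o _ ho
    simp [fAmp, ho]
  · simp

lemma addHole_anticomm (q : Params) (x y : BandMode Γ) :
    addHole q x * addHole q y = -(addHole q y * addHole q x) :=
  annVec_mul_annVec (localized q x.1) (localized q y.1) x.2 y.2

lemma removeHole_anticomm (q : Params) (x y : BandMode Γ) :
    removeHole q x * removeHole q y = -(removeHole q y * removeHole q x) := by
  rw [removeHole_eq, removeHole_eq, creVec_mul_creVec]

lemma removeHole_mul_addHole (q : Params) (htfp : q.tfp ≠ 0) (x y : BandMode Γ) :
    removeHole q x * addHole q y = (if x = y then 1 else 0) - addHole q y * removeHole q x := by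
  have h : addHole q y * removeHole q x = _ :=
    (congrArg _ (removeHole_eq q x)).trans
      (annVec_mul_creVec (localized q y.1) (fun o => q.tfp⁻¹ * fAmp o x.1) y.2 x.2)
  rw [h, ← removeHole_eq]
  have hs : ∑ o, localized q y.1 o * (q.tfp⁻¹ * fAmp o x.1) = if x.1 = y.1 then 1 else 0 := by
    simp [fAmp, localized_inl, htfp]
  rw [hs]
  obtain ⟨R, σ⟩ := x
  obtain ⟨S, τ⟩ := y
  by_cases h1 : R = S <;> by_cases h2 : τ = σ <;>
    simp [h1, h2, eq_comm (a := σ) (b := τ), addHole, aOp, annVec]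

lemma offOp_mul_addHole (q : Params) (htfp : q.tfp ≠ 0) (r : PSite Γ) (i σ : Fin 2)
    (x : BandMode Γ) : offOp q r i σ * addHole q x = -(addHole q x * offOp q r i σ) := by
  have h : addHole q x * offOp q r i σ = _ := annVec_mul_creVec (localized q x.1)
    (fun o => offBand q (fAmp o) (pAmp o) r i) x.2 σ
  have hs : ∑ o, localized q x.1 o * offBand q (fAmp o) (pAmp o) r i = 0 := by
    simp only [offBand, Pi.sub_apply, Pi.smul_apply, smul_eq_mul, loopSum, mul_sub,
      Finset.sum_sub_distrib, Finset.mul_sum]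
    rw [Finset.sum_comm]
    have h1 : ∀ k, ∑ o, localized q x.1 o * (q.tf / q.tfp * (eVec k i * fAmp o (nbr r k))) =
        q.tf * if x.1 = nbr r k then eVec k i else 0 := by
      intro k
      simp only [fAmp, mul_ite, mul_one, mul_zero, Finset.sum_ite_eq', Finset.mem_univ, if_true,
        localized_inl, eq_comm (a := x.1)]
      split_ifs
      · field_simp
      · simp
    simp only [h1, pAmp, mul_ite, mul_one, mul_zero, Finset.sum_ite_eq', Finset.mem_univ, if_true,
      localized_inr]
    rw [Finset.mul_sum, sub_eq_zero]
    exact Finset.sum_congr rfl fun k _ => by split_ifs <;> simp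
  rw [h, hs]
  simp [offOp, addHole, aOp, annVec]

lemma offOp_mul_removeHole (q : Params) (r : PSite Γ) (i σ : Fin 2) (x : BandMode Γ) :
    offOp q r i σ * removeHole q x = -(removeHole q x * offOp q r i σ) := by
  rw [removeHole_eq, offOp, creVec_mul_creVec]

/-- Outside of `offOp`, the holes of a p orbital are those of the three localized states
around it. -/
lemma creat_inr_eq (q : Params) (r : PSite Γ) (i σ : Fin 2) :
    creat (Sum.inr (r, i), σ) = offOp q r i σ +
      ∑ k, ((q.tf * eVec k i : ℝ) : ℂ) • removeHole q (nbr r k, σ) := by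
  have h1 : creat (Sum.inr (r, i), σ) = creVec (fun o : Orb Γ => pAmp o r i) σ := by
    simp [creVec, pAmp]
  simp only [h1, removeHole_eq, offOp, creVec, Finset.smul_sum]
  rw [Finset.sum_comm, ← Finset.sum_add_distrib]
  refine Finset.sum_congr rfl fun o _ => ?_
  simp only [smul_smul, ← Finset.sum_smul, ← add_smul, offBand, loopSum, Pi.sub_apply,
    Pi.smul_apply, smul_eq_mul]
  congr 1
  rw [Finset.mul_sum]
  push_cast
  rw [sub_add, ← Finset.sum_sub_distrib, Finset.sum_eq_zero, sub_zero]
  intro k _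
  ring

lemma creat_inl_eq (q : Params) (htfp : q.tfp ≠ 0) (R : FSite Γ) (σ : Fin 2) :
    creat (Sum.inl R, σ) = (q.tfp : ℂ) • removeHole q (R, σ) := by
  rw [removeHole, smul_smul, ← Complex.ofReal_mul, mul_inv_cancel₀ htfp, Complex.ofReal_one,
    one_smul]

lemma sum_localized_smul (q : Params) (r : PSite Γ) (i : Fin 2) (f : FSite Γ → Op Γ) :
    ∑ R, (localized q R (Sum.inr (r, i)) : ℂ) • f R =
      ∑ k, ((q.tf * eVec k i : ℝ) : ℂ) • f (nbr r k) := by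
  simp only [localized_inr, Finset.mul_sum, Complex.ofReal_sum, Finset.sum_smul]
  rw [Finset.sum_comm]
  refine Finset.sum_congr rfl fun k _ => ?_
  rw [Finset.sum_eq_single (nbr r k)]
  · simp
  · intro R _ hR
    simp [hR]
  · simp

/-- The total number of holes, counted in the modes of the flat band and in those outside. -/
lemma sum_holeNum_eq (q : Params) (htfp : q.tfp ≠ 0) :
    ∑ m : Mode Γ, holeNum m = ∑ x : BandMode Γ, addHole q x * removeHole q x
      + ∑ x : PSite Γ × Fin 2, ∑ σ, annih (Sum.inr x, σ) * offOp q x.1 x.2 σ := by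
  rw [sum_mode, Fintype.sum_prod_type (f := fun x : BandMode Γ => addHole q x * removeHole q x)]
  have h1 : ∀ R σ, addHole q (R, σ) * removeHole q (R, σ) = holeNum (Sum.inl R, σ) +
      ∑ x : PSite Γ × Fin 2, (localized q R (Sum.inr x) : ℂ) •
        (annih (Sum.inr x, σ) * removeHole q (R, σ)) := by
    intro R σ
    rw [addHole, aOp, Fintype.sum_sum_type, add_mul, Finset.sum_mul, Finset.sum_mul]
    congr 1
    · rw [Finset.sum_eq_single R]
      · rw [localized_inl, if_pos rfl, holeNum, smul_mul_assoc, ← mul_smul_comm,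
          ← creat_inl_eq q htfp]
      · intro S _ hS
        simp [localized_inl, hS]
      · simp
    · exact Finset.sum_congr rfl fun x _ => smul_mul_assoc _ _ _
  have h2 : ∀ (x : PSite Γ × Fin 2) σ, annih (Sum.inr x, σ) * offOp q x.1 x.2 σ =
      holeNum (Sum.inr x, σ) - ∑ R, (localized q R (Sum.inr x) : ℂ) •
        (annih (Sum.inr x, σ) * removeHole q (R, σ)) := by
    intro x σ
    rw [sum_localized_smul q x.1 x.2 fun R => annih (Sum.inr x, σ) * removeHole q (R, σ), holeNum,
      creat_inr_eq q x.1 x.2 σ, mul_add, Finset.mul_sum]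
    simp only [mul_smul_comm, add_sub_cancel_right]
  simp only [h1, h2, Fin.sum_univ_two, Finset.sum_add_distrib, Finset.sum_sub_distrib]
  rw [Finset.sum_comm (f := fun (R : FSite Γ) x => (localized q R (Sum.inr x) : ℂ) •
        (annih (Sum.inr x, (0 : Fin 2)) * removeHole q (R, 0))),
    Finset.sum_comm (f := fun (R : FSite Γ) x => (localized q R (Sum.inr x) : ℂ) •
        (annih (Sum.inr x, (1 : Fin 2)) * removeHole q (R, 1)))]
  abel

end FlatBand

/-! ### Products of anticommuting operators -/

section ListProducts

/-- Reordering a product of pairwise anticommuting factors changes it by a sign that depends only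
on the permutation. -/
lemma exists_sign_prod_perm {κ A : Type*} [Ring A] {l l' : List κ} (h : l.Perm l') :
    ∃ s : ℤˣ, ∀ f : κ → A, (∀ x y, f x * f y = -(f y * f x)) →
      (l.map f).prod = s • (l'.map f).prod := by
  induction h with
  | nil => exact ⟨1, fun f _ => by simp⟩
  | cons x _ ih =>
    obtain ⟨s, hs⟩ := ih
    exact ⟨s, fun f hf => by
      rw [List.map_cons, List.prod_cons, hs f hf, List.map_cons, List.prod_cons, mul_smul_comm]⟩
  | swap x y l =>
    exact ⟨-1, fun f hf => by
      simp only [List.map_cons, List.prod_cons, ← mul_assoc]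
      rw [hf y x, neg_mul, Units.neg_smul, one_smul]⟩
  | trans _ _ ih1 ih2 =>
    obtain ⟨s, hs⟩ := ih1
    obtain ⟨t, ht⟩ := ih2
    exact ⟨s * t, fun f hf => by rw [hs f hf, ht f hf, mul_smul]⟩

lemma mulVec_list_prod_eq_zero {κ n : Type} [Fintype n] [DecidableEq n] {B : Matrix n n ℂ}
    {f : κ → Matrix n n ℂ} {l : List κ} (hf : ∀ x ∈ l, B * f x = -(f x * B)) {v : n → ℂ}
    (hv : B *ᵥ v = 0) : B *ᵥ ((l.map f).prod *ᵥ v) = 0 := by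
  induction l with
  | nil => simpa using hv
  | cons x l ih =>
    rw [List.map_cons, List.prod_cons, ← mulVec_mulVec, mulVec_mulVec, hf x (by simp), neg_mulVec,
      ← mulVec_mulVec, ih fun y hy => hf y (by simp [hy]), mulVec_zero, neg_zero]

end ListProducts

/-! ### Expansion in states of flat-band holes -/

section Expansion

variable {Γ : AddSubgroup (ℤ × ℤ)} [Γ.FiniteIndex]

lemma creVec_mulVec_filled {O : Type} [Fintype O] [DecidableEq O] (x : O → ℝ) (σ : Fin 2) :
    creVec x σ *ᵥ filled = 0 := by
  rw [creVec, sum_mulVec]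
  exact Finset.sum_eq_zero fun o _ => by rw [smul_mulVec, creat_mulVec_filled, smul_zero]

lemma removeHole_mulVec_filled (q : Params) (x : BandMode Γ) : removeHole q x *ᵥ filled = 0 := by
  rw [removeHole_eq, creVec_mulVec_filled]

/-- The state with holes in the band modes of the list `l`. -/
def holeState (q : Params) (l : List (BandMode Γ)) : Finset (Mode Γ) → ℂ :=
  (l.map (addHole q)).prod *ᵥ filled

/-- The operator removing, one after the other, the holes in the band modes of `l`. -/
def removeAll (q : Params) (l : List (BandMode Γ)) : Op Γ := (l.reverse.map (removeHole q)).prod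

lemma holeState_cons (q : Params) (x : BandMode Γ) (l : List (BandMode Γ)) :
    holeState q (x :: l) = addHole q x *ᵥ holeState q l := by
  rw [holeState, holeState, List.map_cons, List.prod_cons, mulVec_mulVec]

lemma removeAll_cons (q : Params) (x : BandMode Γ) (l : List (BandMode Γ)) :
    removeAll q (x :: l) = removeAll q l * removeHole q x := by
  simp [removeAll]

lemma offOp_mulVec_holeState (q : Params) (htfp : q.tfp ≠ 0) (r : PSite Γ) (i σ : Fin 2)
    (l : List (BandMode Γ)) : offOp q r i σ *ᵥ holeState q l = 0 :=
  mulVec_list_prod_eq_zero (fun x _ => offOp_mul_addHole q htfp r i σ x)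
    (creVec_mulVec_filled _ _)

lemma removeHole_mulVec_holeState (q : Params) (htfp : q.tfp ≠ 0) {x : BandMode Γ}
    {l : List (BandMode Γ)} (h : x ∉ l) : removeHole q x *ᵥ holeState q l = 0 :=
  mulVec_list_prod_eq_zero (fun y hy => by
    rw [removeHole_mul_addHole q htfp, if_neg (by rintro rfl; exact h hy), zero_sub])
    (removeHole_mulVec_filled q x)

lemma addHole_mem_sector (q : Params) (x : BandMode Γ) {N : ℕ} {Ψ : Finset (Mode Γ) → ℂ}
    (h : Ψ ∈ sector (N + 1)) : addHole q x *ᵥ Ψ ∈ sector N := by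
  rw [addHole, aOp, sum_mulVec]
  exact Submodule.sum_mem _ fun o _ => by
    rw [smul_mulVec]; exact Submodule.smul_mem _ _ (annih_mem_sector h _)

lemma removeHole_mem_sector (q : Params) (x : BandMode Γ) {N : ℕ} {Ψ : Finset (Mode Γ) → ℂ}
    (h : Ψ ∈ sector N) : removeHole q x *ᵥ Ψ ∈ sector (N + 1) := by
  rw [removeHole, smul_mulVec]
  exact Submodule.smul_mem _ _ (creat_mem_sector h _)

lemma holeState_mem_sector (q : Params) (l : List (BandMode Γ)) {N : ℕ}
    (h : l.length + N = Fintype.card (Mode Γ)) : holeState q l ∈ sector N := by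
  induction l generalizing N with
  | nil =>
    rw [List.length_nil, zero_add] at h
    rw [h, holeState, List.map_nil, List.prod_nil, one_mulVec]
    exact filled_mem_sector
  | cons x l ih =>
    rw [holeState_cons]
    exact addHole_mem_sector q x (ih (by rw [List.length_cons] at h; omega))

/-- The number of holes, counted in the flat band. -/
lemma sum_addHole_mul_removeHole (q : Params) (htfp : q.tfp ≠ 0) {n N : ℕ}
    (h : n + N = Fintype.card (Mode Γ)) {Ψ : Finset (Mode Γ) → ℂ} (hΨ : Ψ ∈ sector N)
    (hoff : ∀ r i σ, offOp q r i σ *ᵥ Ψ = 0) :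
    ∑ x : BandMode Γ, addHole q x *ᵥ (removeHole q x *ᵥ Ψ) = (n : ℂ) • Ψ := by
  have h1 : (∑ m : Mode Γ, holeNum m) *ᵥ Ψ = (n : ℂ) • Ψ := by
    have h2 : ∑ m : Mode Γ, holeNum m = ((Fintype.card (Mode Γ) : ℕ) : ℂ) • 1 - ∑ m, num m := by
      simp only [num_eq, Finset.sum_sub_distrib, Finset.sum_const, Finset.card_univ]
      rw [← Nat.cast_smul_eq_nsmul ℂ, sub_sub_cancel]
    rw [h2, sub_mulVec, smul_mulVec, one_mulVec, sum_num_mulVec hΨ, ← sub_smul, ← h]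
    push_cast
    rw [add_sub_cancel_right]
  rw [← h1, sum_holeNum_eq q htfp, add_mulVec, sum_mulVec, sum_mulVec]
  simp only [sum_mulVec, ← mulVec_mulVec, hoff, mulVec_zero, Finset.sum_const_zero, add_zero]

/-- A state in the flat band is the superposition of the states `holeState` given by the
amplitudes that remain after removing all holes. -/
lemma exists_expansion (q : Params) (htfp : q.tfp ≠ 0) (n : ℕ) :
    ∀ (N : ℕ) (Ψ : Finset (Mode Γ) → ℂ), n + N = Fintype.card (Mode Γ) → Ψ ∈ sector N →
      (∀ r i σ, offOp q r i σ *ᵥ Ψ = 0) →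
      ∃ c : (Fin n → BandMode Γ) → ℂ,
        (∀ s, removeAll q (List.ofFn s) *ᵥ Ψ = c s • filled) ∧
        (n.factorial : ℂ) • Ψ = ∑ s, c s • holeState q (List.ofFn s) := by
  induction n with
  | zero =>
    intro N Ψ hN hΨ _
    rw [zero_add] at hN
    subst hN
    obtain ⟨c, rfl⟩ := exists_smul_filled hΨ
    exact ⟨fun _ => c, fun s => by simp [removeAll], by simp [holeState]⟩
  | succ n ih =>
    intro N Ψ hN hΨ hoff
    have hstep := fun x : BandMode Γ => ih (N + 1) (removeHole q x *ᵥ Ψ) (by omega)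
      (removeHole_mem_sector q x hΨ) fun r i σ => by
        rw [mulVec_mulVec, offOp_mul_removeHole, neg_mulVec, ← mulVec_mulVec, hoff, mulVec_zero,
          neg_zero]
    choose c hc hsum using hstep
    refine ⟨fun s => c (s 0) (Fin.tail s), fun s => ?_, ?_⟩
    · rw [List.ofFn_succ, removeAll_cons, ← mulVec_mulVec]
      exact hc (s 0) (Fin.tail s)
    · rw [← (Fin.consEquiv fun _ => BandMode Γ).sum_comp, Fintype.sum_prod_type]
      have h1 := sum_addHole_mul_removeHole q htfp hN hΨ hoff
      rw [Nat.factorial_succ, mul_comm, Nat.cast_mul, mul_smul, ← h1, Finset.smul_sum]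
      refine Finset.sum_congr rfl fun x _ => ?_
      rw [← mulVec_smul, hsum x, mulVec_sum]
      refine Finset.sum_congr rfl fun s _ => ?_
      simp [Fin.consEquiv, List.ofFn_succ, holeState_cons, mulVec_smul]

/-- The band mode at `R` with the spin index prescribed by the set `D` of sites with index `1`. -/
def label (D : Finset (FSite Γ)) (R : FSite Γ) : BandMode Γ := (R, if R ∈ D then 1 else 0)

/-- The state with holes in the localized states around the sites of `l`, with spin index `1` at
the sites in `D` and `0` elsewhere. -/
def spinState (q : Params) (l : List (FSite Γ)) (D : Finset (FSite Γ)) : Finset (Mode Γ) → ℂ :=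
  holeState q (l.map (label D))

lemma spinState_cons (q : Params) (R : FSite Γ) (l : List (FSite Γ)) (D : Finset (FSite Γ)) :
    spinState q (R :: l) D = addHole q (label D R) *ᵥ spinState q l D := by
  rw [spinState, List.map_cons, holeState_cons, spinState]

lemma map_label_congr {l : List (FSite Γ)} {D D' : Finset (FSite Γ)}
    (h : ∀ R ∈ l, R ∈ D ↔ R ∈ D') : l.map (label D) = l.map (label D') :=
  List.map_congr_left fun R hR => by simp [label, h R hR]

lemma removeHole_mulVec_spinState (q : Params) (htfp : q.tfp ≠ 0) {R : FSite Γ} (σ : Fin 2)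
    {l : List (FSite Γ)} (h : R ∉ l) (D : Finset (FSite Γ)) :
    removeHole q (R, σ) *ᵥ spinState q l D = 0 :=
  removeHole_mulVec_holeState q htfp fun hm => by
    obtain ⟨S, hS, he⟩ := List.mem_map.1 hm
    exact h ((show S = R from (Prod.ext_iff.1 he).1) ▸ hS)

lemma exists_sign_spinState (q : Params) {l l' : List (FSite Γ)} (h : l.Perm l') :
    ∃ s : ℤˣ, ∀ D, spinState q l D = s • spinState q l' D := by
  obtain ⟨s, hs⟩ := exists_sign_prod_perm (A := Op Γ) h
  refine ⟨s, fun D => ?_⟩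
  have := hs (fun R => addHole q (label D R)) fun x y => addHole_anticomm _ _ _
  rw [spinState, spinState, holeState, holeState, List.map_map, List.map_map]
  exact (congrArg (· *ᵥ filled) this).trans (by rw [Units.smul_def, Units.smul_def]; exact smul_mulVec _ _ _)

lemma exists_sign_removeAll (q : Params) {l l' : List (FSite Γ)} (h : l.Perm l') :
    ∃ s : ℤˣ, ∀ D, removeAll q (l.map (label D)) = s • removeAll q (l'.map (label D)) := by
  obtain ⟨s, hs⟩ := exists_sign_prod_perm (A := Op Γ)
    ((l.reverse_perm.trans h).trans l'.reverse_perm.symm)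
  refine ⟨s, fun D => ?_⟩
  have := hs (fun R => removeHole q (label D R)) fun x y => removeHole_anticomm _ _ _
  simpa [removeAll, Function.comp_def] using this

/-- Biorthogonality of the states `spinState` and the operators `removeAll`. -/
lemma removeAll_mulVec_spinState (q : Params) (htfp : q.tfp ≠ 0) {l : List (FSite Γ)}
    (hl : l.Nodup) (D D' : Finset (FSite Γ)) :
    removeAll q (l.map (label D)) *ᵥ spinState q l D' =
      if ∀ R ∈ l, R ∈ D ↔ R ∈ D' then filled else 0 := by
  induction l with
  | nil => simp [removeAll, spinState, holeState]
  | cons R l ih =>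
    rw [List.nodup_cons] at hl
    rw [List.map_cons, removeAll_cons, spinState_cons, ← mulVec_mulVec,
      mulVec_mulVec _ (removeHole _ _) (addHole _ _), removeHole_mul_addHole q htfp, sub_mulVec, ← mulVec_mulVec, label,
      removeHole_mulVec_spinState q htfp _ hl.1, mulVec_zero, sub_zero]
    by_cases h : R ∈ D ↔ R ∈ D'
    · rw [if_pos (by simp [label, h]), one_mulVec, ih hl.2]
      simp [h]
    · rw [if_neg, zero_mulVec, mulVec_zero, if_neg]
      · exact fun h' => h (h' R (by simp))
      · by_cases h1 : R ∈ D <;> by_cases h2 : R ∈ D' <;> simp_all [label]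

lemma eq_zero_of_eq_neg {V : Type*} [AddCommGroup V] [Module ℂ V] {v : V} (h : v = -v) :
    v = 0 := by
  have h2 : (2 : ℂ) • v = 0 := by rw [two_smul]; nth_rewrite 1 [h]; exact neg_add_cancel v
  exact (smul_eq_zero.1 h2).resolve_left two_ne_zero

lemma removeHole_comm_pair {q : Params} {Ψ : Finset (Mode Γ) → ℂ}
    (h : ∀ R : FSite Γ, removeHole q (R, 0) *ᵥ (removeHole q (R, 1) *ᵥ Ψ) = 0) (R : FSite Γ)
    (σ τ : Fin 2) : removeHole q (R, σ) *ᵥ (removeHole q (R, τ) *ᵥ Ψ) = 0 := by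
  have hs : ∀ x, removeHole q x *ᵥ (removeHole q x *ᵥ Ψ) = 0 := fun x => by
    have h1 := removeHole_anticomm q x x
    rw [mulVec_mulVec, eq_zero_of_eq_neg h1, zero_mulVec]
  have h1 := h R
  have h2 : removeHole q (R, 1) *ᵥ (removeHole q (R, 0) *ᵥ Ψ) = 0 := by
    rw [mulVec_mulVec, removeHole_anticomm, neg_mulVec, ← mulVec_mulVec, h1, neg_zero]
  revert σ τ
  simp only [Fin.forall_fin_two]
  exact ⟨⟨hs _, h1⟩, h2, hs _⟩

/-- Without doubly occupied localized states, removing holes twice around the same site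
gives zero. -/
lemma removeAll_mulVec_eq_zero {q : Params} {l : List (BandMode Γ)}
    (hl : ¬ (l.map Prod.fst).Nodup) {Ψ : Finset (Mode Γ) → ℂ}
    (h : ∀ R : FSite Γ, removeHole q (R, 0) *ᵥ (removeHole q (R, 1) *ᵥ Ψ) = 0) :
    removeAll q l *ᵥ Ψ = 0 := by
  induction l generalizing Ψ with
  | nil => simp at hl
  | cons x l ih =>
    rw [removeAll_cons]
    by_cases hx : x.1 ∈ l.map Prod.fst
    · obtain ⟨y, hy, hxy⟩ := List.mem_map.1 hx
      have h2 : removeHole q y *ᵥ (removeHole q x *ᵥ Ψ) = 0 := by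
        obtain ⟨R, σ⟩ := x
        obtain ⟨S, τ⟩ := y
        obtain rfl : S = R := hxy
        exact removeHole_comm_pair h _ _ _
      obtain ⟨t, ht⟩ := exists_sign_prod_perm (A := Op Γ)
        (l.reverse_perm.trans ((List.perm_cons_erase hy).trans
          (List.perm_append_singleton y (l.erase y)).symm))
      have h3 := ht (removeHole q) fun x y => removeHole_anticomm _ _ _
      rw [removeAll, h3, List.map_append, List.prod_append, List.map_singleton,
        List.prod_singleton, Units.smul_def, smul_mul_assoc, smul_mulVec, mul_assoc,
        ← mulVec_mulVec, ← mulVec_mulVec, h2, mulVec_zero, smul_zero]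
    · rw [← mulVec_mulVec]
      refine ih (fun h' => hl ?_) fun R => ?_
      · rw [List.map_cons, List.nodup_cons]
        exact ⟨hx, h'⟩
      · have h1 : removeHole q (R, 0) * (removeHole q (R, 1) * removeHole q x) =
            removeHole q x * (removeHole q (R, 0) * removeHole q (R, 1)) := by
          rw [removeHole_anticomm q (R, 1), mul_neg, ← mul_assoc, removeHole_anticomm q (R, 0),
            neg_mul, neg_neg, mul_assoc]
        rw [mulVec_mulVec, mulVec_mulVec, mul_assoc, h1, ← mulVec_mulVec, ← mulVec_mulVec, h,
          mulVec_zero]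

end Expansion

/-! ### Exchange symmetry of overlapping holes -/

section Exchange

variable {Γ : AddSubgroup (ℤ × ℤ)} [Γ.FiniteIndex]

/-- For a state in the flat band, removing two holes from a p site amounts to removing them from
the localized states that meet there. -/
lemma creat_creat_mulVec (q : Params) {Ψ : Finset (Mode Γ) → ℂ}
    (hoff : ∀ r i σ, offOp q r i σ *ᵥ Ψ = 0) (r : PSite Γ) (i j : Fin 2) (σ τ : Fin 2) :
    (creat (Sum.inr (r, i), σ) * creat (Sum.inr (r, j), τ)) *ᵥ Ψ =
      ∑ k, ∑ l, (((q.tf * eVec k i) * (q.tf * eVec l j) : ℝ) : ℂ) •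
        removeHole q (nbr r k, σ) *ᵥ (removeHole q (nbr r l, τ) *ᵥ Ψ) := by
  have h : ∀ x, offOp q r i σ *ᵥ (removeHole q x *ᵥ Ψ) = 0 := fun x => by
    rw [mulVec_mulVec, offOp_mul_removeHole, neg_mulVec, ← mulVec_mulVec, hoff, mulVec_zero,
      neg_zero]
  rw [← mulVec_mulVec, creat_inr_eq q r j τ, add_mulVec, hoff, zero_add, sum_mulVec, mulVec_sum,
    Finset.sum_comm]
  refine Finset.sum_congr rfl fun l _ => ?_
  rw [smul_mulVec, mulVec_smul, creat_inr_eq q r i σ, add_mulVec, h, zero_add, sum_mulVec,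
    Finset.smul_sum]
  refine Finset.sum_congr rfl fun k _ => ?_
  rw [smul_mulVec, smul_smul, ← Complex.ofReal_mul, mul_comm]

/-- The symmetrized products of two different vectors `eVec k` are linearly independent
symmetric tensors. -/
lemma exchange_of_tensor_eqs {t : ℝ} (ht : t ≠ 0) {ψ : Fin 3 → Fin 3 → ℂ} (hd : ∀ k, ψ k k = 0)
    (h0 : ∑ k, ∑ l, (((t * eVec k 0) * (t * eVec l 0) : ℝ) : ℂ) * ψ k l = 0)
    (h1 : ∑ k, ∑ l, (((t * eVec k 1) * (t * eVec l 1) : ℝ) : ℂ) * ψ k l = 0)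
    (h01 : ∑ k, ∑ l, (((t * eVec k 0) * (t * eVec l 1) : ℝ) : ℂ) * ψ k l
      + ∑ k, ∑ l, (((t * eVec k 1) * (t * eVec l 0) : ℝ) : ℂ) * ψ k l = 0) (k l : Fin 3) :
    ψ k l + ψ l k = 0 := by
  have hs : ((√3 : ℝ) : ℂ) * ((√3 : ℝ) : ℂ) = 3 := by
    rw [← Complex.ofReal_mul, sqrt_three_mul_self]; norm_num
  have ht' : ((t : ℝ) : ℂ) ≠ 0 := by exact_mod_cast ht
  have hs' : ((√3 : ℝ) : ℂ) ≠ 0 := fun h => by rw [h] at hs; norm_num at hs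
  simp only [Fin.sum_univ_three, hd, eVec, Matrix.cons_val_zero, Matrix.cons_val_one,
    Matrix.cons_val] at h0 h1 h01
  push_cast at h0 h1 h01
  generalize ((√3 : ℝ) : ℂ) = s at *
  generalize ((t : ℝ) : ℂ) = u at *
  have a12 : ψ 1 2 + ψ 2 1 = 0 := by
    have : u * u * 3 * (ψ 1 2 + ψ 2 1) = 0 := by
      linear_combination (-4) * h0 - u * u * (ψ 1 2 + ψ 2 1) * hs
    simpa [ht'] using this
  have e1 : ψ 0 1 + ψ 1 0 + (ψ 0 2 + ψ 2 0) = 0 := by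
    have : u * u * (ψ 0 1 + ψ 1 0 + (ψ 0 2 + ψ 2 0)) = 0 := by
      linear_combination (-2) * h1 + u * u / 2 * a12
    simpa [ht'] using this
  have e2 : ψ 0 2 + ψ 2 0 - (ψ 0 1 + ψ 1 0) = 0 := by
    have : u * u * s * (ψ 0 2 + ψ 2 0 - (ψ 0 1 + ψ 1 0)) = 0 := by
      linear_combination 2 * h01
    simpa [ht', hs'] using this
  have a01 : ψ 0 1 + ψ 1 0 = 0 := by linear_combination (e1 - e2) / 2
  have a02 : ψ 0 2 + ψ 2 0 = 0 := by linear_combination (e1 + e2) / 2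
  fin_cases k <;> fin_cases l <;> simp only [Fin.zero_eta, Fin.mk_one, Fin.reduceFinMk, hd] <;>
    first
      | exact add_zero 0
      | linear_combination a01
      | linear_combination a02
      | linear_combination a12

lemma exists_nbr_of_localized_ne_zero {q : Params} {R : FSite Γ} {r : PSite Γ} {i : Fin 2}
    (h : localized q R (Sum.inr (r, i)) ≠ 0) : ∃ k, R = nbr r k := by
  by_contra! h'
  exact h (by simp [localized_inr, h'])

/-- Localized states that overlap are equal or share a vertex. -/
lemma Overlap.eq_or_nbr {q : Params} {R R' : FSite Γ} (h : Overlap q R R') :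
    R = R' ∨ ∃ r k l, R = nbr r k ∧ R' = nbr r l := by
  obtain ⟨o, h1, h2⟩ := h
  rcases o with S | ⟨r, i⟩
  · simp only [localized_inl, ne_eq, ite_eq_right_iff, not_forall] at h1 h2
    exact Or.inl (h1.1.symm.trans h2.1)
  · obtain ⟨k, hk⟩ := exists_nbr_of_localized_ne_zero h1
    obtain ⟨l, hl⟩ := exists_nbr_of_localized_ne_zero h2
    exact Or.inr ⟨r, k, l, hk, hl⟩

lemma localized_nbr (hΓ : ∀ i, wVec i ∉ Γ) (q : Params) (r : PSite Γ) (k : Fin 3) (i : Fin 2) :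
    localized q (nbr r k) (Sum.inr (r, i)) = q.tf * eVec k i := by
  simp [localized_inr, (nbr_injective hΓ r).eq_iff]

lemma eVec_one_ne_zero (k : Fin 3) : eVec k 1 ≠ 0 := by
  fin_cases k <;> simp [eVec]

lemma overlap_nbr (hΓ : ∀ i, wVec i ∉ Γ) {q : Params} (htf : q.tf ≠ 0) (r : PSite Γ)
    (k l : Fin 3) : Overlap q (nbr r k) (nbr r l) :=
  ⟨Sum.inr (r, 1), by rw [localized_nbr hΓ]; exact mul_ne_zero htf (eVec_one_ne_zero k),
    by rw [localized_nbr hΓ]; exact mul_ne_zero htf (eVec_one_ne_zero l)⟩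

lemma singletOp_eq {O : Type} [Fintype O] [DecidableEq O] (x y : O) :
    singletOp x y = creat (x, 0) * creat (y, 1) + creat (y, 0) * creat (x, 1) := by
  rw [singletOp, creat_mul_creat (x, 1), sub_neg_eq_add]

/-- In a ground state, two holes in the same localized state do not occur. -/
lemma IsFrustrationFree.no_double {q : Params} (htfp : q.tfp ≠ 0) {Ψ : Finset (Mode Γ) → ℂ}
    (h : IsFrustrationFree q Ψ) (R : FSite Γ) :
    removeHole q (R, 0) *ᵥ (removeHole q (R, 1) *ᵥ Ψ) = 0 := by
  have h1 := h.pair (Sum.inl R)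
  rw [pairOp, creat_inl_eq q htfp, creat_inl_eq q htfp, smul_mul_smul_comm, smul_mulVec,
    ← mulVec_mulVec] at h1
  exact (smul_eq_zero.1 h1).resolve_left (by simpa using htfp)

/-- In a ground state, the spin amplitude is symmetric under the exchange of two holes in
overlapping localized states. -/
lemma IsFrustrationFree.exchange {q : Params} (htf : q.tf ≠ 0) (htfp : q.tfp ≠ 0)
    {Ψ : Finset (Mode Γ) → ℂ} (h : IsFrustrationFree q Ψ) {R R' : FSite Γ}
    (hR : Overlap q R R') :
    removeHole q (R, 0) *ᵥ (removeHole q (R', 1) *ᵥ Ψ)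
      + removeHole q (R', 0) *ᵥ (removeHole q (R, 1) *ᵥ Ψ) = 0 := by
  rcases hR.eq_or_nbr with rfl | ⟨r, k, l, rfl, rfl⟩
  · rw [h.no_double htfp, add_zero]
  · have h0 := h.pair (Sum.inr (r, 0))
    have h1 := h.pair (Sum.inr (r, 1))
    have h01 := h.singlet r
    rw [pairOp, creat_creat_mulVec q h.off] at h0 h1
    rw [singletOp_eq, add_mulVec, creat_creat_mulVec q h.off, creat_creat_mulVec q h.off] at h01
    ext S
    have := congrFun h0 S
    have := congrFun h1 S
    have := congrFun h01 S
    simp only [Finset.sum_apply, Pi.add_apply, Pi.smul_apply, smul_eq_mul, Pi.zero_apply] at *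
    exact exchange_of_tensor_eqs htf
      (ψ := fun k l => (removeHole q (nbr r k, 0) *ᵥ (removeHole q (nbr r l, 1) *ᵥ Ψ)) S)
      (fun k => by simp [h.no_double htfp]) ‹_› ‹_› ‹_› k l

/-- The converse of `IsFrustrationFree.no_double` and `IsFrustrationFree.exchange`. -/
lemma isFrustrationFree_of_exchange {q : Params} (htfp : q.tfp ≠ 0)
    {Ψ : Finset (Mode Γ) → ℂ} (hoff : ∀ r i σ, offOp q r i σ *ᵥ Ψ = 0)
    (hdouble : ∀ R : FSite Γ, removeHole q (R, 0) *ᵥ (removeHole q (R, 1) *ᵥ Ψ) = 0)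
    (hex : ∀ r k l, removeHole q (nbr r k, 0) *ᵥ (removeHole q (nbr r l, 1) *ᵥ Ψ)
      + removeHole q (nbr r l, 0) *ᵥ (removeHole q (nbr r k, 1) *ᵥ Ψ) = 0) :
    IsFrustrationFree q Ψ := by
  -- only the part of the coefficients symmetric in `k` and `l` contributes
  have key : ∀ (r : PSite Γ) (i j : Fin 2),
      (creat (Sum.inr (r, i), 0) * creat (Sum.inr (r, j), 1)) *ᵥ Ψ +
        (creat (Sum.inr (r, j), 0) * creat (Sum.inr (r, i), 1)) *ᵥ Ψ = 0 := by
    intro r i j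
    rw [creat_creat_mulVec q hoff, creat_creat_mulVec q hoff]
    nth_rewrite 2 [Finset.sum_comm]
    simp only [← Finset.sum_add_distrib]
    refine Finset.sum_eq_zero fun k _ => Finset.sum_eq_zero fun l _ => ?_
    rw [mul_comm (q.tf * eVec l j), ← smul_add, hex, smul_zero]
  refine ⟨hoff, fun o => ?_, fun r => ?_⟩
  · rcases o with R | ⟨r, i⟩
    · rw [pairOp, creat_inl_eq q htfp, creat_inl_eq q htfp, smul_mul_smul_comm, smul_mulVec,
        ← mulVec_mulVec, hdouble, smul_zero]
    · have h := key r i i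
      exact eq_zero_of_eq_neg (eq_neg_of_add_eq_zero_left h)
  · rw [singletOp_eq, add_mulVec, key]

end Exchange

/-! ### Clusters of localized states -/

section Clusters

variable {Γ : AddSubgroup (ℤ × ℤ)} {q : Params} {A : Finset (FSite Γ)}

lemma Overlap.symm {R R' : FSite Γ} (h : Overlap q R R') : Overlap q R' R :=
  let ⟨o, h1, h2⟩ := h
  ⟨o, h2, h1⟩

variable [Γ.FiniteIndex]

/-- The step relation whose paths define the clusters. -/
def LinkedIn (q : Params) (A : Finset (FSite Γ)) (x y : FSite Γ) : Prop :=
  x ∈ A ∧ y ∈ A ∧ Overlap q x y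

lemma mem_clusterOf {R R' : FSite Γ} :
    R' ∈ clusterOf q A R ↔ R' ∈ A ∧ Relation.ReflTransGen (LinkedIn q A) R R' := by
  simp only [clusterOf, Finset.mem_filter]
  rfl

lemma LinkedIn.reverse {x y : FSite Γ} (h : Relation.ReflTransGen (LinkedIn q A) x y) :
    Relation.ReflTransGen (LinkedIn q A) y x :=
  haveI : Std.Symm (LinkedIn q A) := ⟨fun _ _ h => ⟨h.2.1, h.1, h.2.2.symm⟩⟩
  Relation.ReflTransGen.stdSymm.symm _ _ h

lemma clusterOf_eq_of_mem {R R' : FSite Γ} (h : R' ∈ clusterOf q A R) :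
    clusterOf q A R' = clusterOf q A R := by
  rw [mem_clusterOf] at h
  ext x
  rw [mem_clusterOf, mem_clusterOf]
  exact and_congr_right fun _ => ⟨h.2.trans, (LinkedIn.reverse h.2).trans⟩

lemma self_mem_clusterOf {R : FSite Γ} (h : R ∈ A) : R ∈ clusterOf q A R :=
  mem_clusterOf.2 ⟨h, Relation.ReflTransGen.refl⟩

lemma clusterOf_mem_clusters {R : FSite Γ} (h : R ∈ A) : clusterOf q A R ∈ clusters q A :=
  Finset.mem_image_of_mem _ h

lemma eq_clusterOf {C : Finset (FSite Γ)} (hC : C ∈ clusters q A) {R : FSite Γ} (hR : R ∈ C) :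
    C = clusterOf q A R := by
  obtain ⟨S, -, rfl⟩ := Finset.mem_image.1 hC
  exact (clusterOf_eq_of_mem hR).symm

lemma subset_of_mem_clusters {C : Finset (FSite Γ)} (hC : C ∈ clusters q A) : C ⊆ A := by
  obtain ⟨S, -, rfl⟩ := Finset.mem_image.1 hC
  exact fun x hx => (mem_clusterOf.1 hx).1

lemma eq_of_mem_of_mem {C C' : Finset (FSite Γ)} (hC : C ∈ clusters q A) (hC' : C' ∈ clusters q A)
    {R : FSite Γ} (h : R ∈ C) (h' : R ∈ C') : C = C' :=
  (eq_clusterOf hC h).trans (eq_clusterOf hC' h').symm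

lemma mem_of_overlap {C : Finset (FSite Γ)} (hC : C ∈ clusters q A) {R R' : FSite Γ} (h : R ∈ C)
    (hR' : R' ∈ A) (ho : Overlap q R R') : R' ∈ C := by
  rw [eq_clusterOf hC h, mem_clusterOf]
  exact ⟨hR', Relation.ReflTransGen.single ⟨subset_of_mem_clusters hC h, hR', ho⟩⟩

lemma mem_clusterOrbitals {C : Finset (FSite Γ)} {o : Orb Γ} :
    o ∈ clusterOrbitals q C ↔ ∃ R ∈ C, localized q R o ≠ 0 := by
  simp [clusterOrbitals]

lemma localized_eq_zero_of_notMem {C : Finset (FSite Γ)} {R : FSite Γ} (h : R ∈ C) {o : Orb Γ}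
    (ho : o ∉ clusterOrbitals q C) : localized q R o = 0 := by
  by_contra h0
  exact ho (mem_clusterOrbitals.2 ⟨R, h, h0⟩)

lemma localized_eq_zero_of_mem {C : Finset (FSite Γ)} (hC : C ∈ clusters q A) {R : FSite Γ}
    (hR : R ∈ A) (h : R ∉ C) {o : Orb Γ} (ho : o ∈ clusterOrbitals q C) : localized q R o = 0 := by
  by_contra h0
  obtain ⟨S, hS, h1⟩ := mem_clusterOrbitals.1 ho
  exact h (mem_of_overlap hC hS hR ⟨o, h1, h0⟩)

lemma inl_mem_clusterOrbitals (htfp : q.tfp ≠ 0) {C : Finset (FSite Γ)} {R : FSite Γ} :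
    (Sum.inl R : Orb Γ) ∈ clusterOrbitals q C ↔ R ∈ C := by
  simp [mem_clusterOrbitals, localized_inl, htfp]

end Clusters

/-! ### Symmetry of the amplitudes within a cluster -/

section Symmetry

variable {Γ : AddSubgroup (ℤ × ℤ)} [Γ.FiniteIndex] {q : Params} {A : Finset (FSite Γ)}

lemma map_swap_eq_self {α : Type*} [DecidableEq α] {D : Finset α} {x y : α} (h : x ∈ D ↔ y ∈ D) :
    D.map (Equiv.swap x y).toEmbedding = D := by
  ext z
  rw [Finset.mem_map_equiv, Equiv.symm_swap]
  rcases eq_or_ne z x with rfl | hx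
  · rw [Equiv.swap_apply_left, h]
  rcases eq_or_ne z y with rfl | hy
  · rw [Equiv.swap_apply_right, h]
  rw [Equiv.swap_apply_of_ne_of_ne hx hy]

/-- The amplitudes of a ground state do not change when the spins of two holes in overlapping
localized states are exchanged. -/
lemma removeAll_swap_of_mem_of_notMem (htf : q.tf ≠ 0) (htfp : q.tfp ≠ 0)
    {Ψ : Finset (Mode Γ) → ℂ} (h : IsFrustrationFree q Ψ) {l : List (FSite Γ)} (hl : l.Nodup)
    {R R' : FSite Γ} (hR : R ∈ l) (hR' : R' ∈ l) (ho : Overlap q R R') {D : Finset (FSite Γ)}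
    (hD : R ∈ D) (hD' : R' ∉ D) :
    removeAll q (l.map (label (D.map (Equiv.swap R R').toEmbedding))) *ᵥ Ψ =
      removeAll q (l.map (label D)) *ᵥ Ψ := by
  have hne : R' ≠ R := fun e => hD' (e ▸ hD)
  have hp : l.Perm (R :: R' :: (l.erase R).erase R') :=
    (List.perm_cons_erase hR).trans
      ((List.perm_cons_erase ((List.mem_erase_of_ne hne).2 hR')).cons R)
  obtain ⟨s, hs⟩ := exists_sign_removeAll q hp
  rw [hs, hs]
  have hrest : ((l.erase R).erase R').map (label (D.map (Equiv.swap R R').toEmbedding)) =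
      ((l.erase R).erase R').map (label D) := by
    refine map_label_congr fun z hz => ?_
    rw [(hl.erase R).mem_erase_iff, hl.mem_erase_iff] at hz
    rw [Finset.mem_map_equiv, Equiv.symm_swap, Equiv.swap_apply_of_ne_of_ne hz.2.1 hz.1]
  have e1 : label (D.map (Equiv.swap R R').toEmbedding) R = (R, 0) := by
    rw [label, if_neg (by simpa [Finset.mem_map_equiv] using hD')]
  have e2 : label (D.map (Equiv.swap R R').toEmbedding) R' = (R', 1) := by
    rw [label, if_pos (by simpa [Finset.mem_map_equiv] using hD)]
  have e3 : label D R = (R, 1) := by rw [label, if_pos hD]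
  have e4 : label D R' = (R', 0) := by rw [label, if_neg hD']
  simp only [List.map_cons, removeAll_cons, hrest, e1, e2, e3, e4]
  have key : removeHole q (R', 1) *ᵥ (removeHole q (R, 0) *ᵥ Ψ) =
      removeHole q (R', 0) *ᵥ (removeHole q (R, 1) *ᵥ Ψ) := by
    rw [mulVec_mulVec Ψ (removeHole q (R', 1)), removeHole_anticomm, neg_mulVec, ← mulVec_mulVec]
    exact neg_eq_of_add_eq_zero_right (h.exchange htf htfp ho)
  simp only [Units.smul_def, smul_mulVec, ← mulVec_mulVec, key]

lemma removeAll_swap_of_overlap (htf : q.tf ≠ 0) (htfp : q.tfp ≠ 0)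
    {Ψ : Finset (Mode Γ) → ℂ} (h : IsFrustrationFree q Ψ) {l : List (FSite Γ)} (hl : l.Nodup)
    {R R' : FSite Γ} (hR : R ∈ l) (hR' : R' ∈ l) (ho : Overlap q R R') (D : Finset (FSite Γ)) :
    removeAll q (l.map (label (D.map (Equiv.swap R R').toEmbedding))) *ᵥ Ψ =
      removeAll q (l.map (label D)) *ᵥ Ψ := by
  by_cases h1 : R ∈ D <;> by_cases h2 : R' ∈ D
  · rw [map_swap_eq_self (iff_of_true h1 h2)]
  · exact removeAll_swap_of_mem_of_notMem htf htfp h hl hR hR' ho h1 h2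
  · rw [Equiv.swap_comm]
    exact removeAll_swap_of_mem_of_notMem htf htfp h hl hR' hR ho.symm h2 h1
  · rw [map_swap_eq_self (iff_of_false h1 h2)]

/-- Within a cluster the spins of any two holes can be exchanged, since transpositions along the
steps of a path generate that of its end points. -/
lemma removeAll_swap_of_linked (htf : q.tf ≠ 0) (htfp : q.tfp ≠ 0)
    {Ψ : Finset (Mode Γ) → ℂ} (h : IsFrustrationFree q Ψ) {l : List (FSite Γ)} (hl : l.Nodup)
    (hA : ∀ x ∈ A, x ∈ l) {R R' : FSite Γ}
    (hRR' : Relation.ReflTransGen (LinkedIn q A) R R') :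
    ∀ D : Finset (FSite Γ), removeAll q (l.map (label (D.map (Equiv.swap R R').toEmbedding))) *ᵥ Ψ =
      removeAll q (l.map (label D)) *ᵥ Ψ := by
  -- the permutations of the spins that leave all amplitudes unchanged
  let G : Submonoid (Equiv.Perm (FSite Γ)) :=
    { carrier := {π | ∀ D : Finset (FSite Γ), removeAll q (l.map (label (D.map π.toEmbedding))) *ᵥ Ψ
        = removeAll q (l.map (label D)) *ᵥ Ψ}
      one_mem' := fun D => by
        rw [show D.map (1 : Equiv.Perm (FSite Γ)).toEmbedding = D from Finset.map_refl]
      mul_mem' := fun {π ρ} hπ hρ D => by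
        rw [show D.map (π * ρ).toEmbedding = (D.map ρ.toEmbedding).map π.toEmbedding by
          rw [Finset.map_map]; rfl, hπ, hρ] }
  change Equiv.swap R R' ∈ G
  induction hRR' with
  | refl => rw [Equiv.swap_self]; exact G.one_mem
  | tail _ hs ih =>
    exact SubmonoidClass.swap_mem_trans G ih
      (removeAll_swap_of_overlap htf htfp h hl (hA _ hs.1) (hA _ hs.2.1) hs.2.2)

lemma mem_swap_of_mem {D : Finset (FSite Γ)} {x y : FSite Γ} (hx : x ∈ D) (hy : y ∉ D) :
    D.map (Equiv.swap x y).toEmbedding = insert y (D.erase x) := by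
  have hne : y ≠ x := fun e => hy (e ▸ hx)
  ext z
  rw [Finset.mem_map_equiv, Equiv.symm_swap, Finset.mem_insert, Finset.mem_erase]
  rcases eq_or_ne z x with rfl | h1
  · simp [hy, hne.symm]
  rcases eq_or_ne z y with rfl | h2
  · simp [hx]
  · simp [Equiv.swap_apply_of_ne_of_ne h1 h2, h1, h2]

/-- The amplitudes of a ground state depend only on the numbers of spins of index `1` in the
clusters. -/
lemma removeAll_eq_of_profile (htf : q.tf ≠ 0) (htfp : q.tfp ≠ 0)
    {Ψ : Finset (Mode Γ) → ℂ} (h : IsFrustrationFree q Ψ) {l : List (FSite Γ)} (hl : l.Nodup)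
    (hA : ∀ x ∈ A, x ∈ l) {D' : Finset (FSite Γ)} (hD' : D' ⊆ A) (n : ℕ) :
    ∀ D ⊆ A, (D \ D').card = n → (∀ C ∈ clusters q A, (D ∩ C).card = (D' ∩ C).card) →
      removeAll q (l.map (label D)) *ᵥ Ψ = removeAll q (l.map (label D')) *ᵥ Ψ := by
  induction n with
  | zero =>
    intro D hD hn hC
    have hsub : D ⊆ D' := Finset.sdiff_eq_empty_iff_subset.1 (Finset.card_eq_zero.1 hn)
    have : D = D' := by
      refine hsub.antisymm fun x hx => ?_
      have e := Finset.eq_of_subset_of_card_le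
        (Finset.inter_subset_inter_right hsub : D ∩ clusterOf q A x ⊆ D' ∩ clusterOf q A x)
        (hC _ (clusterOf_mem_clusters (hD' hx))).ge
      have : x ∈ D' ∩ clusterOf q A x := Finset.mem_inter.2 ⟨hx, self_mem_clusterOf (hD' hx)⟩
      rw [← e] at this
      exact (Finset.mem_inter.1 this).1
    rw [this]
  | succ n ih =>
    intro D hD hn hC
    obtain ⟨x, hx⟩ := Finset.card_pos.1 (by omega : 0 < (D \ D').card)
    rw [Finset.mem_sdiff] at hx
    set C := clusterOf q A x with hCdef
    have hCm : C ∈ clusters q A := clusterOf_mem_clusters (hD hx.1)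
    have hxC : x ∈ C := self_mem_clusterOf (hD hx.1)
    obtain ⟨y, hy, hyD⟩ : ∃ y ∈ D' ∩ C, y ∉ D ∩ C := by
      by_contra! hcon
      have := Finset.eq_of_subset_of_card_le hcon (hC C hCm).le
      have hx' : x ∈ D ∩ C := Finset.mem_inter.2 ⟨hx.1, hxC⟩
      rw [← this] at hx'
      exact hx.2 (Finset.mem_inter.1 hx').1
    rw [Finset.mem_inter] at hy
    have hyD' : y ∉ D := fun h' => hyD (Finset.mem_inter.2 ⟨h', hy.2⟩)
    have hlink : Relation.ReflTransGen (LinkedIn q A) x y := (mem_clusterOf.1 hy.2).2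
    rw [← removeAll_swap_of_linked htf htfp h hl hA hlink D]
    refine ih _ ?_ ?_ ?_
    · rw [mem_swap_of_mem hx.1 hyD']
      exact Finset.insert_subset (hD' hy.1) ((Finset.erase_subset _ _).trans hD)
    · rw [mem_swap_of_mem hx.1 hyD', Finset.insert_sdiff_of_mem _ hy.1, Finset.erase_sdiff_comm,
        Finset.card_erase_of_mem (Finset.mem_sdiff.2 hx), hn]
      rfl
    · intro C' hC'
      rw [← hC C' hC']
      have hxy : x ∈ C' ↔ y ∈ C' :=
        ⟨fun hh => eq_of_mem_of_mem hCm hC' hxC hh ▸ hy.2,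
          fun hh => eq_of_mem_of_mem hCm hC' hy.2 hh ▸ hxC⟩
      conv_lhs => rw [← map_swap_eq_self hxy, ← Finset.map_inter, Finset.card_map]

end Symmetry

/-! ### Action of the spin operators on the hole states -/

section Lowering

/-- Every subset of `n + 1` elements arises in `n + 1` ways by adding an element to one of `n`
elements. -/
lemma sum_powersetCard_insert {α V : Type*} [DecidableEq α] [AddCommGroup V] [Module ℂ V]
    (C : Finset α) (n : ℕ) (g : Finset α → V) :
    ∑ E ∈ C.powersetCard n, ∑ x ∈ C \ E, g (insert x E) =
      ((n + 1 : ℕ) : ℂ) • ∑ E ∈ C.powersetCard (n + 1), g E := by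
  have h : ((n + 1 : ℕ) : ℂ) • ∑ E ∈ C.powersetCard (n + 1), g E =
      ∑ E ∈ C.powersetCard (n + 1), ∑ _x ∈ E, g E := by
    rw [Finset.smul_sum]
    refine Finset.sum_congr rfl fun E hE => ?_
    rw [Finset.sum_const, (Finset.mem_powersetCard.1 hE).2, Nat.cast_smul_eq_nsmul]
  rw [h, Finset.sum_sigma', Finset.sum_sigma']
  refine Finset.sum_bij' (fun p _ => ⟨insert p.2 p.1, p.2⟩) (fun p _ => ⟨p.1.erase p.2, p.2⟩)
    ?_ ?_ ?_ ?_ ?_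
  · rintro ⟨E, x⟩ hp
    simp only [Finset.mem_sigma, Finset.mem_powersetCard, Finset.mem_sdiff] at hp ⊢
    exact ⟨⟨Finset.insert_subset hp.2.1 hp.1.1, by
      rw [Finset.card_insert_of_notMem hp.2.2, hp.1.2]⟩, Finset.mem_insert_self _ _⟩
  · rintro ⟨E, x⟩ hp
    simp only [Finset.mem_sigma, Finset.mem_powersetCard, Finset.mem_sdiff] at hp ⊢
    exact ⟨⟨(Finset.erase_subset _ _).trans hp.1.1, by
      rw [Finset.card_erase_of_mem hp.2, hp.1.2]; rfl⟩, hp.1.1 hp.2, Finset.notMem_erase _ _⟩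
  · rintro ⟨E, x⟩ hp
    simp only [Finset.mem_sigma, Finset.mem_sdiff] at hp
    simp [Finset.erase_insert hp.2.2]
  · rintro ⟨E, x⟩ hp
    simp only [Finset.mem_sigma] at hp
    simp [Finset.insert_erase hp.2]
  · rintro ⟨E, x⟩ _
    rfl

variable {Γ : AddSubgroup (ℤ × ℤ)} [Γ.FiniteIndex] {q : Params} {A : Finset (FSite Γ)}

lemma bilinear_mul_annih {M : Type} [Fintype M] [DecidableEq M] (m n k : M) :
    annih m * creat n * annih k = annih k * (annih m * creat n)
      + if k = n then annih m else 0 := by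
  have h : creat n * annih k = (if k = n then 1 else 0) - annih k * creat n := by
    rw [annih_mul_creat, sub_sub_cancel]
  rw [mul_assoc, h, mul_sub, ← mul_assoc, annih_mul_annih m, neg_mul, sub_neg_eq_add,
    mul_assoc, add_comm]
  split_ifs <;> simp

/-- The bilinears generating the rotations of the hole spins in the set `V` of orbitals. -/
def spinBil {O : Type} [Fintype O] [DecidableEq O] (V : Finset O) (μ ν : Fin 2) :
    Matrix (Finset (O × Fin 2)) (Finset (O × Fin 2)) ℂ :=
  ∑ o ∈ V, annih (o, μ) * creat (o, ν)

lemma holeLower_eq {O : Type} [Fintype O] [DecidableEq O] (V : Finset O) :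
    holeLower V = spinBil V 1 0 := rfl

/-- On the localized states that live in `V` or in its complement, the spin operators of `V`
act by rotating the spins of the holes in `V`. -/
lemma spinBil_mul_addHole (V : Finset (Orb Γ)) {R : FSite Γ} {p : Prop} [Decidable p]
    (hin : p → ∀ o, o ∉ V → localized q R o = 0) (hout : ¬ p → ∀ o ∈ V, localized q R o = 0)
    (μ ν σ : Fin 2) :
    spinBil V μ ν * addHole q (R, σ) = addHole q (R, σ) * spinBil V μ ν
      + if p ∧ σ = ν then addHole q (R, μ) else 0 := by
  have h1 : spinBil V μ ν * addHole q (R, σ) = addHole q (R, σ) * spinBil V μ ν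
      + ∑ o' : Orb Γ, ∑ o ∈ V, (localized q R o' : ℂ) •
        (if o' = o ∧ σ = ν then annih (o, μ) else 0 : Op Γ) := by
    rw [spinBil, addHole, aOp, Finset.mul_sum, Finset.sum_mul, ← Finset.sum_add_distrib]
    refine Finset.sum_congr rfl fun o' _ => ?_
    rw [Finset.sum_mul, Finset.mul_sum, ← Finset.sum_add_distrib]
    refine Finset.sum_congr rfl fun o _ => ?_
    rw [mul_smul_comm, bilinear_mul_annih, smul_add, smul_mul_assoc]
    simp only [Prod.mk.injEq]
  rw [h1]
  congr 1
  by_cases hσ : σ = ν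
  · simp only [hσ, and_true]
    have h2 : ∀ o' : Orb Γ, ∑ o ∈ V, (localized q R o' : ℂ) •
        (if o' = o then annih (o, μ) else 0 : Op Γ) =
        if o' ∈ V then (localized q R o' : ℂ) • annih (o', μ) else 0 := by
      intro o'
      rw [← Finset.smul_sum, Finset.sum_ite_eq]
      split_ifs <;> simp
    simp only [h2]
    by_cases hp : p
    · rw [if_pos hp, addHole, aOp]
      refine Finset.sum_congr rfl fun o _ => ?_
      split_ifs with ho
      · rfl
      · rw [hin hp o ho, Complex.ofReal_zero, zero_smul]
    · rw [if_neg hp]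
      refine Finset.sum_eq_zero fun o _ => ?_
      split_ifs with ho
      · rw [hout hp o ho, Complex.ofReal_zero, zero_smul]
      · rfl
  · simp [hσ]

lemma spinBil_mulVec_filled {O : Type} [Fintype O] [DecidableEq O] (V : Finset O) (μ ν : Fin 2) :
    spinBil V μ ν *ᵥ filled = 0 := by
  rw [spinBil, sum_mulVec]
  exact Finset.sum_eq_zero fun o _ => by rw [← mulVec_mulVec, creat_mulVec_filled, mulVec_zero]

lemma spinState_congr {l : List (FSite Γ)} {D D' : Finset (FSite Γ)}
    (h : ∀ R ∈ l, R ∈ D ↔ R ∈ D') : spinState q l D = spinState q l D' := by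
  rw [spinState, map_label_congr h, spinState]

/-- The spin lowering operator of a cluster flips one spin after the other. -/
lemma holeLower_mulVec_spinState {C : Finset (FSite Γ)} (hC : C ∈ clusters q A)
    {l : List (FSite Γ)} (hl : l.Nodup) (hA : ∀ R ∈ l, R ∈ A) (D : Finset (FSite Γ)) :
    holeLower (clusterOrbitals q C) *ᵥ spinState q l D =
      ∑ R ∈ (l.toFinset ∩ C) \ D, spinState q l (insert R D) := by
  induction l with
  | nil => simpa [spinState, holeState, holeLower_eq] using spinBil_mulVec_filled _ 1 0
  | cons R l ih =>
    rw [List.nodup_cons] at hl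
    have hc := spinBil_mul_addHole (q := q) (clusterOrbitals q C) (R := R) (p := R ∈ C)
      (fun h o ho => localized_eq_zero_of_notMem h ho)
      (fun h o ho => localized_eq_zero_of_mem hC (hA R (by simp)) h ho) 1 0 (label D R).2
    have hc' : holeLower (clusterOrbitals q C) * addHole q (label D R) =
      addHole q (label D R) * holeLower (clusterOrbitals q C)
        + if R ∈ C ∧ R ∉ D then addHole q (R, 1) else 0 := by
      refine hc.trans ?_
      have : (label D R).2 = 0 ↔ R ∉ D := by simp [label]
      simp only [this]
      rfl
    rw [spinState_cons, mulVec_mulVec, hc', add_mulVec, ← mulVec_mulVec,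
      ih hl.2 fun S hS => hA S (by simp [hS]), mulVec_sum]
    have h1 : ∀ S ∈ (l.toFinset ∩ C) \ D, addHole q (label D R) *ᵥ spinState q l (insert S D) =
        spinState q (R :: l) (insert S D) := by
      intro S hS
      have hSR : R ≠ S := by
        rintro rfl
        simp [hl.1] at hS
      rw [spinState_cons, label, label]
      simp [hSR]
    rw [Finset.sum_congr rfl h1]
    by_cases h2 : R ∈ C ∧ R ∉ D
    · have h3 : ((R :: l).toFinset ∩ C) \ D = insert R ((l.toFinset ∩ C) \ D) := by
        rw [List.toFinset_cons, Finset.insert_inter_of_mem h2.1, Finset.insert_sdiff_of_notMem _ h2.2]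
      rw [if_pos h2, h3, Finset.sum_insert (by simp [hl.1]), add_comm, spinState_cons,
        spinState_congr (l := l) (D := D) (D' := insert R D) fun S hS => by
          have : S ≠ R := fun e => hl.1 (e ▸ hS)
          simp [this]]
      simp [label]
    · have h3 : ((R :: l).toFinset ∩ C) \ D = (l.toFinset ∩ C) \ D := by
        ext S
        simp only [List.toFinset_cons, Finset.mem_sdiff, Finset.mem_inter, Finset.mem_insert]
        constructor
        · rintro ⟨⟨rfl | h4, h5⟩, h6⟩
          · exact absurd ⟨h5, h6⟩ h2
          · exact ⟨⟨h4, h5⟩, h6⟩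
        · rintro ⟨⟨h4, h5⟩, h6⟩
          exact ⟨⟨Or.inr h4, h5⟩, h6⟩
      rw [if_neg h2, zero_mulVec, add_zero, h3]

/-- Powers of the lowering operator produce the symmetric superposition of all ways of flipping the
spins. -/
lemma holeLower_pow_mulVec_spinState {C : Finset (FSite Γ)} (hC : C ∈ clusters q A)
    {D : Finset (FSite Γ)} (hD : Disjoint D C) (n : ℕ) :
    holeLower (clusterOrbitals q C) ^ n *ᵥ spinState q A.toList D =
      (n.factorial : ℂ) • ∑ E ∈ C.powersetCard n, spinState q A.toList (D ∪ E) := by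
  induction n with
  | zero => simp
  | succ n ih =>
    rw [pow_succ', ← mulVec_mulVec, ih, mulVec_smul, mulVec_sum]
    have h1 : ∀ E ∈ C.powersetCard n,
        holeLower (clusterOrbitals q C) *ᵥ spinState q A.toList (D ∪ E) =
          ∑ R ∈ C \ E, spinState q A.toList (D ∪ insert R E) := by
      intro E _
      rw [holeLower_mulVec_spinState hC (Finset.nodup_toList A) (by simp), Finset.toList_toFinset,
        Finset.inter_eq_right.2 (subset_of_mem_clusters hC)]
      refine Finset.sum_congr ?_ fun R _ => by rw [Finset.union_insert]
      ext R
      simp only [Finset.mem_sdiff, Finset.mem_union, not_or]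
      exact ⟨fun h => ⟨h.1, h.2.2⟩, fun h => ⟨h.1, fun h' => Finset.disjoint_left.1 hD h' h.1, h.2⟩⟩
    rw [Finset.sum_congr rfl h1, sum_powersetCard_insert C n fun E => spinState q A.toList (D ∪ E),
      smul_smul, Nat.factorial_succ, mul_comm (n + 1), Nat.cast_mul]

open Classical in
/-- The sets of sites in the clusters of the list `ks` with `n C` elements in each cluster `C`. -/
def profileSets (ks : List (Finset (FSite Γ))) (A : Finset (FSite Γ))
    (n : Finset (FSite Γ) → ℕ) : Finset (Finset (FSite Γ)) :=
  A.powerset.filter fun D => (∀ C ∈ ks, (D ∩ C).card = n C) ∧ ∀ x ∈ D, ∃ C ∈ ks, x ∈ C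

lemma mem_profileSets {ks : List (Finset (FSite Γ))} {n : Finset (FSite Γ) → ℕ}
    {D : Finset (FSite Γ)} : D ∈ profileSets ks A n ↔
      D ⊆ A ∧ (∀ C ∈ ks, (D ∩ C).card = n C) ∧ ∀ x ∈ D, ∃ C ∈ ks, x ∈ C := by
  simp [profileSets]

/-- The cluster lowering operators, applied to the polarized state, produce the uniform
superposition of the spin states with given numbers of flipped spins in the clusters. -/
lemma prod_holeLower_mulVec (n : Finset (FSite Γ) → ℕ) {ks : List (Finset (FSite Γ))}
    (hks : ks.Nodup) (hk : ∀ C ∈ ks, C ∈ clusters q A) :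
    (ks.map fun C => holeLower (clusterOrbitals q C) ^ n C).prod *ᵥ spinState q A.toList ∅ =
      ((ks.map fun C => (n C).factorial).prod : ℂ) •
        ∑ D ∈ profileSets ks A n, spinState q A.toList D := by
  induction ks with
  | nil =>
    have : profileSets [] A n = {∅} := by
      ext D
      simp only [mem_profileSets, List.not_mem_nil, false_imp_iff, implies_true, true_and,
        false_and, exists_false, Finset.mem_singleton, imp_false]
      exact ⟨fun h => Finset.eq_empty_of_forall_notMem h.2, by rintro rfl; simp⟩
    simp [this]
  | cons C ks ih =>
    rw [List.nodup_cons] at hks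
    have hC := hk C (by simp)
    have hdisj : ∀ C' ∈ ks, Disjoint C C' := fun C' hC' =>
      Finset.disjoint_left.2 fun x h1 h2 =>
        hks.1 (eq_of_mem_of_mem hC (hk C' (by simp [hC'])) h1 h2 ▸ hC')
    have hD0 : ∀ D ∈ profileSets ks A n, Disjoint D C := by
      intro D hD
      refine Finset.disjoint_left.2 fun x hx hxC => ?_
      obtain ⟨C', hC', hx'⟩ := (mem_profileSets.1 hD).2.2 x hx
      exact Finset.disjoint_left.1 (hdisj C' hC') hxC hx'
    rw [List.map_cons, List.prod_cons, ← mulVec_mulVec,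
      ih hks.2 fun C' hC' => hk C' (by simp [hC']), mulVec_smul, mulVec_sum,
      Finset.sum_congr rfl fun D hD => holeLower_pow_mulVec_spinState hC (hD0 D hD) (n C),
      ← Finset.smul_sum, smul_smul, List.map_cons, List.prod_cons]
    push_cast
    rw [mul_comm]
    congr 1
    rw [Finset.sum_sigma']
    have hunion : ∀ {D E : Finset (FSite Γ)}, D ∈ profileSets ks A n → E ⊆ C →
        (D ∪ E) ∩ C = E ∧ (D ∪ E) \ C = D := by
      intro D E hD hE
      have h1 := hD0 D hD
      constructor
      · rw [Finset.union_inter_distrib_right, Finset.disjoint_iff_inter_eq_empty.1 h1,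
          Finset.empty_union, Finset.inter_eq_left.2 hE]
      · rw [Finset.union_sdiff_distrib, Finset.sdiff_eq_self_of_disjoint h1,
          Finset.sdiff_eq_empty_iff_subset.2 hE, Finset.union_empty]
    refine Finset.sum_bij' (fun p _ => p.1 ∪ p.2) (fun D _ => ⟨D \ C, D ∩ C⟩) ?_ ?_ ?_ ?_ ?_
    · rintro ⟨D, E⟩ hp
      rw [Finset.mem_sigma, Finset.mem_powersetCard] at hp
      obtain ⟨hD, hE, hE'⟩ := hp
      have hD' := mem_profileSets.1 hD
      rw [mem_profileSets]
      refine ⟨Finset.union_subset hD'.1 (hE.trans (subset_of_mem_clusters hC)), ?_, ?_⟩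
      · intro C' hC'
        rcases List.mem_cons.1 hC' with rfl | hC''
        · exact (congrArg _ (hunion hD hE).1).trans hE'
        · change ((D ∪ E) ∩ C').card = _
          rw [Finset.union_inter_distrib_right, (Finset.disjoint_iff_inter_eq_empty.1
            ((hdisj C' hC'').mono_left hE) : E ∩ C' = ∅), Finset.union_empty, hD'.2.1 C' hC'']
      · intro x hx
        rcases Finset.mem_union.1 hx with h1 | h1
        · obtain ⟨C', hC', hx'⟩ := hD'.2.2 x h1
          exact ⟨C', by simp [hC'], hx'⟩
        · exact ⟨C, by simp, hE h1⟩
    · intro D hD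
      rw [mem_profileSets] at hD
      rw [Finset.mem_sigma, Finset.mem_powersetCard, mem_profileSets]
      refine ⟨⟨Finset.sdiff_subset.trans hD.1, fun C' hC' => ?_, fun x hx => ?_⟩,
        Finset.inter_subset_right, hD.2.1 C (by simp)⟩
      · rw [← hD.2.1 C' (by simp [hC'])]
        congr 1
        ext x
        simp only [Finset.mem_inter, Finset.mem_sdiff]
        exact ⟨fun h => ⟨h.1.1, h.2⟩, fun h => ⟨⟨h.1, fun hx =>
          Finset.disjoint_left.1 (hdisj C' hC') hx h.2⟩, h.2⟩⟩
      · rw [Finset.mem_sdiff] at hx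
        obtain ⟨C', hC', hx'⟩ := hD.2.2 x hx.1
        rcases List.mem_cons.1 hC' with rfl | hC''
        · exact absurd hx' hx.2
        · exact ⟨C', hC'', hx'⟩
    · rintro ⟨D, E⟩ hp
      rw [Finset.mem_sigma, Finset.mem_powersetCard] at hp
      have := hunion hp.1 hp.2.1
      simp only [this.1, this.2]
    · intro D _
      exact Finset.sdiff_union_inter D C
    · rintro ⟨D, E⟩ _
      rfl

end Lowering

/-! ### Commutation relations of the spin operators -/

section SpinAlgebra

variable {O : Type} [Fintype O] [DecidableEq O]

lemma bilinear_mul_bilinear {M : Type} [Fintype M] [DecidableEq M] (m m' n n' : M) :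
    annih m * creat m' * (annih n * creat n') = annih n * creat n' * (annih m * creat m')
      + ((if m' = n then annih m * creat n' else 0) - if m = n' then annih n * creat m' else 0) := by
  have h : annih n * creat n' * annih m * creat m' =
      annih n * creat n' * (annih m * creat m') := mul_assoc _ _ _
  rw [← mul_assoc, bilinear_mul_annih, add_mul, ← h, bilinear_mul_annih, add_mul,
    mul_assoc (annih n), mul_assoc (annih m), mul_assoc, creat_mul_creat m' n', mul_neg, mul_neg,
    ← mul_assoc (annih n), annih_mul_annih n m]
  simp only [ite_mul, zero_mul, mul_assoc, neg_mul, neg_neg, eq_comm (a := n)]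
  abel

/-- The bilinears `spinBil V` satisfy the commutation relations of the matrix units. -/
lemma spinBil_mul_spinBil (V : Finset O) (μ ν κ l : Fin 2) :
    spinBil V μ ν * spinBil V κ l = spinBil V κ l * spinBil V μ ν
      + ((if ν = κ then spinBil V μ l else 0) - if μ = l then spinBil V κ ν else 0) := by
  have h : ∀ o ∈ V, ∑ o' ∈ V, annih (o, μ) * creat (o, ν) * (annih (o', κ) * creat (o', l)) =
      ∑ o' ∈ V, annih (o', κ) * creat (o', l) * (annih (o, μ) * creat (o, ν))
      + ((if ν = κ then annih (o, μ) * creat (o, l) else 0)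
        - if μ = l then annih (o, κ) * creat (o, ν) else 0) := by
    intro o ho
    simp only [bilinear_mul_bilinear (o, μ), Finset.sum_add_distrib, Finset.sum_sub_distrib,
      Prod.mk.injEq, ite_and, Finset.sum_ite_eq, ho, if_true]
  rw [spinBil, spinBil, Finset.sum_mul_sum, Finset.sum_congr rfl h, Finset.sum_add_distrib,
    Finset.sum_sub_distrib, Finset.sum_comm, ← Finset.sum_mul_sum]
  congr 2 <;> split_ifs <;> simp [spinBil]

lemma spinBil_comm_of_disjoint {V W : Finset O} (h : Disjoint V W) (μ ν κ l : Fin 2) :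
    Commute (spinBil V μ ν) (spinBil W κ l) := by
  refine Commute.sum_left _ _ _ fun o ho => Commute.sum_right _ _ _ fun o' ho' => ?_
  have hne : o ≠ o' := fun e => Finset.disjoint_left.1 h ho (e ▸ ho')
  rw [commute_iff_eq, bilinear_mul_bilinear]
  simp [hne]

/-- The squared spin in terms of the bilinears: spin lowering times spin raising, plus a function
of the spin component `(spinBil V 0 0 - spinBil V 1 1) / 2` of the holes. -/
lemma spinSq_eq (V : Finset O) :
    spinSq V = spinBil V 1 0 * spinBil V 0 1 + (1 / 2 : ℂ) • (spinBil V 0 0 - spinBil V 1 1)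
      + (1 / 4 : ℂ) • ((spinBil V 0 0 - spinBil V 1 1) * (spinBil V 0 0 - spinBil V 1 1)) := by
  have h0 : ∑ o ∈ V, spinOp o 0 = (-1 / 2 : ℂ) • (spinBil V 1 0 + spinBil V 0 1) := by
    simp only [spinOp_zero, conjTranspose_spinFlip, ← Finset.smul_sum, Finset.sum_add_distrib]
    rfl
  have h1 : ∑ o ∈ V, spinOp o 1 = (Complex.I / 2 : ℂ) • (spinBil V 1 0 - spinBil V 0 1) := by
    simp only [spinOp_one, conjTranspose_spinFlip, ← Finset.smul_sum, Finset.sum_sub_distrib]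
    rfl
  have h2 : ∑ o ∈ V, spinOp o 2 = (1 / 2 : ℂ) • (spinBil V 1 1 - spinBil V 0 0) := by
    simp only [spinOp_two, ← Finset.smul_sum, Finset.sum_sub_distrib]
    rfl
  have hc := spinBil_mul_spinBil V 0 1 1 0
  simp only [if_true] at hc
  have hI : Complex.I / 2 * (Complex.I / 2) = -1 / 4 := by
    linear_combination (1 / 4 : ℂ) * Complex.I_mul_I
  rw [spinSq, Fin.sum_univ_three, h0, h1, h2]
  simp only [sq, smul_mul_smul_comm, hI]
  simp only [mul_add, add_mul, mul_sub, sub_mul, hc]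
  module

/-- The squared spin commutes with the lowering operator of the same set. -/
lemma spinSq_comm_self (V : Finset O) : Commute (spinSq V) (holeLower V) := by
  have h1 := spinBil_mul_spinBil V 0 1 1 0
  have h2 := spinBil_mul_spinBil V 0 0 1 0
  have h3 := spinBil_mul_spinBil V 1 1 1 0
  simp only [if_true, Fin.isValue, zero_ne_one, one_ne_zero, if_false, zero_sub, sub_zero]
    at h1 h2 h3
  rw [spinSq_eq, holeLower_eq, commute_iff_eq]
  generalize spinBil V 1 0 = L at *
  generalize spinBil V 0 1 = K at *
  have hZ : (spinBil V 0 0 - spinBil V 1 1) * L = L * (spinBil V 0 0 - spinBil V 1 1)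
      - (2 : ℂ) • L := by
    rw [sub_mul, h2, h3]
    simp only [mul_sub]
    module
  generalize spinBil V 0 0 - spinBil V 1 1 = Z at *
  have hZZ : Z * Z * L = L * (Z * Z) - (4 : ℂ) • (L * Z) + (4 : ℂ) • L := by
    rw [mul_assoc, hZ, mul_sub, mul_smul_comm, ← mul_assoc, hZ, sub_mul, smul_mul_assoc, mul_assoc]
    module
  simp only [add_mul, mul_add, smul_mul_assoc, mul_smul_comm, hZZ, hZ]
  rw [mul_assoc L K L, h1]
  simp only [mul_add]
  module

lemma spinSq_comm_of_disjoint {V W : Finset O} (h : Disjoint V W) :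
    Commute (spinSq V) (holeLower W) := by
  have hc := fun μ ν => spinBil_comm_of_disjoint h μ ν 1 0
  rw [spinSq_eq, holeLower_eq]
  have hZ := (hc 0 0).sub_left (hc 1 1)
  exact (((hc 1 0).mul_left (hc 0 1)).add_left (hZ.smul_left _)).add_left
    ((hZ.mul_left hZ).smul_left _)

end SpinAlgebra

/-! ### Hole-cluster states -/

section ClusterStates

variable {Γ : AddSubgroup (ℤ × ℤ)} [Γ.FiniteIndex] {q : Params} {A : Finset (FSite Γ)}

lemma holeClusterState_eq_mulVec (q : Params) (A : Finset (FSite Γ))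
    (n : Finset (FSite Γ) → ℕ) : holeClusterState q A n =
      ((clusters q A).toList.map fun C => holeLower (clusterOrbitals q C) ^ n C).prod *ᵥ
        spinState q A.toList ∅ := by
  have : (A.toList.map fun R => aOp q R 0) = (A.toList.map (label ∅)).map (addHole q) := by
    rw [List.map_map]
    exact List.map_congr_left fun R _ => by simp [label, addHole]
  rw [holeClusterState, this, ← mulVec_mulVec, spinState, holeState]

/-- Operators commuting with all cluster lowering operators act on the fully polarized state. -/
lemma mulVec_holeClusterState {B : Op Γ} (n : Finset (FSite Γ) → ℕ)
    (h : ∀ C ∈ clusters q A, Commute B (holeLower (clusterOrbitals q C))) :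
    B *ᵥ holeClusterState q A n =
      ((clusters q A).toList.map fun C => holeLower (clusterOrbitals q C) ^ n C).prod *ᵥ
        (B *ᵥ spinState q A.toList ∅) := by
  have hc : Commute B
      ((clusters q A).toList.map fun C => holeLower (clusterOrbitals q C) ^ n C).prod :=
    Commute.list_prod_right _ _ fun x hx => by
      obtain ⟨C, hC, rfl⟩ := List.mem_map.1 hx
      exact (h C (Finset.mem_toList.1 hC)).pow_right _
  rw [holeClusterState_eq_mulVec, mulVec_mulVec, hc.eq, ← mulVec_mulVec]

lemma holeClusterState_eq_sum (q : Params) (A : Finset (FSite Γ)) (n : Finset (FSite Γ) → ℕ) :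
    ∃ c : ℂ, c ≠ 0 ∧ holeClusterState q A n =
      c • ∑ D ∈ profileSets (clusters q A).toList A n, spinState q A.toList D := by
  refine ⟨_, ?_, (holeClusterState_eq_mulVec q A n).trans (prod_holeLower_mulVec n
    (Finset.nodup_toList _) fun C hC => Finset.mem_toList.1 hC)⟩
  rw [Nat.cast_ne_zero]
  refine List.prod_ne_zero fun h => ?_
  obtain ⟨C, -, hC⟩ := List.mem_map.1 h
  exact Nat.factorial_ne_zero _ hC

lemma mem_profileSets_clusters {n : Finset (FSite Γ) → ℕ} {D : Finset (FSite Γ)} :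
    D ∈ profileSets (clusters q A).toList A n ↔
      D ⊆ A ∧ ∀ C ∈ clusters q A, (D ∩ C).card = n C := by
  rw [mem_profileSets]
  simp only [Finset.mem_toList]
  exact ⟨fun h => ⟨h.1, h.2.1⟩, fun h => ⟨h.1, h.2, fun x hx =>
    ⟨_, clusterOf_mem_clusters (h.1 hx), self_mem_clusterOf (h.1 hx)⟩⟩⟩

lemma exists_mem_profileSets {n : Finset (FSite Γ) → ℕ}
    (hn : ∀ C ∈ clusters q A, n C ≤ C.card) :
    ∃ D, D ∈ profileSets (clusters q A).toList A n := by
  have h : ∀ C, ∃ E : Finset (FSite Γ), C ∈ clusters q A → E ⊆ C ∧ E.card = n C := fun C => by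
    by_cases hC : C ∈ clusters q A
    · obtain ⟨E, hE⟩ := Finset.exists_subset_card_eq (hn C hC)
      exact ⟨E, fun _ => hE⟩
    · exact ⟨∅, fun h => absurd h hC⟩
  choose E hE using h
  refine ⟨(clusters q A).biUnion E, mem_profileSets_clusters.2 ⟨?_, fun C hC => ?_⟩⟩
  · exact Finset.biUnion_subset.2 fun C hC => (hE C hC).1.trans (subset_of_mem_clusters hC)
  · rw [← (hE C hC).2]
    congr 1
    ext x
    rw [Finset.mem_inter, Finset.mem_biUnion]
    constructor
    · rintro ⟨⟨C', hC', hx⟩, hxC⟩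
      rwa [eq_of_mem_of_mem hC hC' hxC ((hE C' hC').1 hx)]
    · exact fun hx => ⟨⟨C, hC, hx⟩, (hE C hC).1 hx⟩

/-- By biorthogonality, removing the holes of one of the superposed spin states leaves a nonzero
multiple of the filled state. -/
lemma holeClusterState_ne_zero (htfp : q.tfp ≠ 0) {n : Finset (FSite Γ) → ℕ}
    (hn : ∀ C ∈ clusters q A, n C ≤ C.card) : holeClusterState q A n ≠ 0 := by
  obtain ⟨c, hc, h⟩ := holeClusterState_eq_sum q A n
  obtain ⟨D, hD⟩ := exists_mem_profileSets hn
  intro h0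
  have h1 : removeAll q (A.toList.map (label D)) *ᵥ holeClusterState q A n = c • filled := by
    rw [h, mulVec_smul, mulVec_sum, Finset.sum_eq_single D]
    · rw [removeAll_mulVec_spinState q htfp (Finset.nodup_toList A), if_pos fun R _ => Iff.rfl]
    · intro D' hD' hne
      rw [removeAll_mulVec_spinState q htfp (Finset.nodup_toList A), if_neg]
      intro he
      refine hne (Finset.ext fun x => ?_)
      by_cases hx : x ∈ A
      · exact (he x (Finset.mem_toList.2 hx)).symm
      · exact iff_of_false (fun h' => hx ((mem_profileSets.1 hD').1 h'))
          fun h' => hx ((mem_profileSets.1 hD).1 h')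
    · exact fun h' => absurd hD h'
  rw [h0, mulVec_zero] at h1
  exact filled_ne_zero ((smul_eq_zero.1 h1.symm).resolve_left hc)

lemma holeClusterState_mem_sector {N : ℕ} (hN : A.card + N = Fintype.card (Mode Γ))
    (n : Finset (FSite Γ) → ℕ) : holeClusterState q A n ∈ sector N := by
  obtain ⟨c, -, h⟩ := holeClusterState_eq_sum q A n
  rw [h]
  exact Submodule.smul_mem _ _ (Submodule.sum_mem _ fun D _ =>
    holeState_mem_sector q _ (by rw [List.length_map, Finset.length_toList]; exact hN))

lemma removeHole_mulVec_holeClusterState (htfp : q.tfp ≠ 0) {R : FSite Γ} (hR : R ∉ A)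
    (σ : Fin 2) (n : Finset (FSite Γ) → ℕ) :
    removeHole q (R, σ) *ᵥ holeClusterState q A n = 0 := by
  obtain ⟨c, -, h⟩ := holeClusterState_eq_sum q A n
  rw [h, mulVec_smul, mulVec_sum, Finset.sum_eq_zero, smul_zero]
  exact fun D _ => removeHole_mulVec_spinState q htfp σ (by simpa using hR) D

/-- Commutation relations of the lowering operators with the removal of a hole: the removed spin is
flipped as well if it belongs to `C`. -/
lemma holeLower_mul_removeHole (htfp : q.tfp ≠ 0) (C : Finset (FSite Γ)) (R : FSite Γ) :
    removeHole q (R, 0) * holeLower (clusterOrbitals q C) =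
      holeLower (clusterOrbitals q C) * removeHole q (R, 0) ∧
    removeHole q (R, 1) * holeLower (clusterOrbitals q C) =
      holeLower (clusterOrbitals q C) * removeHole q (R, 1)
        + if R ∈ C then removeHole q (R, 0) else 0 := by
  have h : ∀ (m n k : Mode Γ), creat k * (annih m * creat n) = annih m * creat n * creat k
      + if k = m then creat n else 0 := by
    intro m n k
    have h1 : creat k * annih m = (if k = m then 1 else 0) - annih m * creat k := by
      simp only [annih_mul_creat, eq_comm (a := k) (b := m), sub_sub_cancel]
    rw [← mul_assoc, h1, sub_mul, mul_assoc (annih m), creat_mul_creat k n, mul_neg,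
      sub_neg_eq_add, ← mul_assoc, add_comm]
    split_ifs <;> simp
  have h2 : ∀ σ : Fin 2, creat (Sum.inl R, σ) * holeLower (clusterOrbitals q C) =
      holeLower (clusterOrbitals q C) * creat (Sum.inl R, σ)
        + if σ = 1 then (if R ∈ C then creat (Sum.inl R, 0) else 0) else 0 := by
    intro σ
    rw [holeLower, Finset.mul_sum, Finset.sum_mul, Finset.sum_congr rfl fun o _ => h _ _ _,
      Finset.sum_add_distrib]
    congr 1
    by_cases hσ : σ = 1
    · simp only [Prod.mk.injEq, hσ, and_true, if_true, Finset.sum_ite_eq,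
        inl_mem_clusterOrbitals htfp]
    · simp [hσ]
  constructor
  · rw [removeHole, smul_mul_assoc, h2, mul_smul_comm]
    simp
  · simp only [removeHole]
    rw [smul_mul_assoc, h2, mul_smul_comm, smul_add]
    congr 1
    rw [if_pos rfl]
    by_cases hR : R ∈ C
    · rw [if_pos hR, if_pos hR]
    · rw [if_neg hR, if_neg hR, smul_zero]

/-- In a hole-cluster state, the spins of holes in overlapping localized states are symmetric. -/
lemma holeClusterState_exchange (htfp : q.tfp ≠ 0) (n : Finset (FSite Γ) → ℕ) {R R' : FSite Γ}
    (ho : Overlap q R R') :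
    removeHole q (R, 0) *ᵥ (removeHole q (R', 1) *ᵥ holeClusterState q A n)
      + removeHole q (R', 0) *ᵥ (removeHole q (R, 1) *ᵥ holeClusterState q A n) = 0 := by
  have hout : ∀ {S : FSite Γ}, S ∉ A → ∀ σ x,
      removeHole q (S, σ) *ᵥ (removeHole q x *ᵥ holeClusterState q A n) = 0 := by
    intro S hS σ x
    rw [mulVec_mulVec, removeHole_anticomm, neg_mulVec, ← mulVec_mulVec,
      removeHole_mulVec_holeClusterState htfp hS, mulVec_zero, neg_zero]
  by_cases hR : R ∈ A
  swap
  · rw [hout hR, removeHole_mulVec_holeClusterState htfp hR, mulVec_zero, add_zero]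
  by_cases hR' : R' ∈ A
  swap
  · rw [hout hR', removeHole_mulVec_holeClusterState htfp hR', mulVec_zero, add_zero]
  set T : Op Γ := removeHole q (R, 0) * removeHole q (R', 1)
    + removeHole q (R', 0) * removeHole q (R, 1) with hT
  -- the pair operator commutes with the lowering operators, which act on both spins or on none
  have hcomm : ∀ C ∈ clusters q A, Commute T (holeLower (clusterOrbitals q C)) := by
    intro C hC
    have hiff : R' ∈ C ↔ R ∈ C :=
      ⟨fun h => mem_of_overlap hC h hR ho.symm, fun h => mem_of_overlap hC h hR' ho⟩
    obtain ⟨h1, h2⟩ := holeLower_mul_removeHole (q := q) htfp C R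
    obtain ⟨h3, h4⟩ := holeLower_mul_removeHole (q := q) htfp C R'
    simp only [hiff] at h4
    rw [commute_iff_eq, hT, add_mul, mul_assoc, h4, mul_assoc, h2, mul_add, mul_add, ← mul_assoc, h1,
      ← mul_assoc, h3]
    have h5 := removeHole_anticomm q (R, 0) (R', 0)
    split_ifs
    · rw [h5, mul_add]
      simp only [mul_assoc]
      abel
    · rw [mul_add]
      simp only [mul_assoc, mul_zero, add_zero]
  have hup : ∀ S : FSite Γ, removeHole q (S, 1) *ᵥ spinState q A.toList ∅ = 0 := fun S =>
    removeHole_mulVec_holeState q htfp (by simp [label])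
  have := mulVec_holeClusterState (A := A) n hcomm
  rw [hT, add_mulVec, add_mulVec, ← mulVec_mulVec, ← mulVec_mulVec, ← mulVec_mulVec,
    ← mulVec_mulVec, hup, hup, mulVec_zero, mulVec_zero, add_zero, mulVec_zero] at this
  exact this

lemma overlap_self (htfp : q.tfp ≠ 0) (R : FSite Γ) : Overlap q R R :=
  ⟨Sum.inl R, by simpa [localized_inl] using htfp, by simpa [localized_inl] using htfp⟩

/-- The hole-cluster states are symmetric in the spins of overlapping holes, hence frustration-free. -/
lemma isFrustrationFree_holeClusterState (hΓ : ∀ i, wVec i ∉ Γ) (htf : q.tf ≠ 0)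
    (htfp : q.tfp ≠ 0) (n : Finset (FSite Γ) → ℕ) :
    IsFrustrationFree q (holeClusterState q A n) := by
  refine isFrustrationFree_of_exchange htfp (fun r i σ => ?_) (fun R => ?_) fun r k l => ?_
  · obtain ⟨c, -, h⟩ := holeClusterState_eq_sum q A n
    rw [h, mulVec_smul, mulVec_sum, Finset.sum_eq_zero, smul_zero]
    exact fun D _ => offOp_mulVec_holeState q htfp r i σ _
  · exact eq_zero_of_eq_neg (eq_neg_of_add_eq_zero_left
      (holeClusterState_exchange htfp n (overlap_self htfp R)))
  · exact holeClusterState_exchange htfp n (overlap_nbr hΓ htf r k l)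

/-! ### Spin of the clusters -/

/-- The fully polarized state is a highest weight vector for the spin of each cluster. -/
lemma spinBil_mulVec_polarized {C : Finset (FSite Γ)} (hC : C ∈ clusters q A) (μ ν : Fin 2)
    {l : List (FSite Γ)} (hl : l.Nodup) (hA : ∀ R ∈ l, R ∈ A) (hμν : ν = 0 → μ = 0) :
    spinBil (clusterOrbitals q C) μ ν *ᵥ spinState q l ∅ =
      (if ν = 0 then ((l.toFinset ∩ C).card : ℂ) else 0) • spinState q l ∅ := by
  induction l with
  | nil => simpa [spinState, holeState] using spinBil_mulVec_filled _ _ _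
  | cons R l ih =>
    rw [List.nodup_cons] at hl
    have hc := spinBil_mul_addHole (q := q) (clusterOrbitals q C) (R := R) (p := R ∈ C)
      (fun h o ho => localized_eq_zero_of_notMem h ho)
      (fun h o ho => localized_eq_zero_of_mem hC (hA R (by simp)) h ho) μ ν 0
    have hlab : label (∅ : Finset (FSite Γ)) R = (R, 0) := by simp [label]
    rw [spinState_cons, hlab, mulVec_mulVec, hc, add_mulVec, ← mulVec_mulVec,
      ih hl.2 fun S hS => hA S (by simp [hS]), mulVec_smul]
    by_cases hν : ν = 0
    · rw [if_pos hν, if_pos hν, hμν hν]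
      by_cases hRC : R ∈ C
      · rw [if_pos ⟨hRC, hν.symm⟩, List.toFinset_cons, Finset.insert_inter_of_mem hRC,
          Finset.card_insert_of_notMem (by simp [hl.1])]
        push_cast
        rw [add_smul, one_smul]
      · rw [if_neg fun h => hRC h.1, List.toFinset_cons, Finset.insert_inter_of_notMem hRC,
          zero_mulVec, add_zero]
    · rw [if_neg hν, if_neg hν, if_neg fun h => hν h.2.symm, zero_mulVec, zero_smul, add_zero]

lemma disjoint_clusterOrbitals {C C' : Finset (FSite Γ)} (hC : C ∈ clusters q A)
    (hC' : C' ∈ clusters q A) (hne : C ≠ C') :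
    Disjoint (clusterOrbitals q C) (clusterOrbitals q C') := by
  refine Finset.disjoint_left.2 fun o h h' => ?_
  obtain ⟨R, hR, h0⟩ := mem_clusterOrbitals.1 h
  refine h0 (localized_eq_zero_of_mem hC' (subset_of_mem_clusters hC hR) (fun hR' => ?_) h')
  exact hne (eq_of_mem_of_mem hC hC' hR hR')

/-- The squared spin of a cluster commutes with all lowering operators, so that it has the same
value as in the fully polarized state. -/
lemma spinSq_mulVec_holeClusterState (n : Finset (FSite Γ) → ℕ) {C : Finset (FSite Γ)}
    (hC : C ∈ clusters q A) :
    spinSq (clusterOrbitals q C) *ᵥ holeClusterState q A n =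
      ((C.card : ℂ) / 2 * ((C.card : ℂ) / 2 + 1)) • holeClusterState q A n := by
  have h := fun μ ν => spinBil_mulVec_polarized hC μ ν (Finset.nodup_toList A)
    (fun R hR => Finset.mem_toList.1 hR)
  have h01 := h 0 1 (by simp)
  have h00 := h 0 0 (by simp)
  have h11 := h 1 1 (by simp)
  simp only [one_ne_zero, if_false, zero_smul, if_true, Finset.toList_toFinset,
    Finset.inter_eq_right.2 (subset_of_mem_clusters hC)] at h01 h00 h11
  have hpol : spinSq (clusterOrbitals q C) *ᵥ spinState q A.toList ∅ =
      ((C.card : ℂ) / 2 * ((C.card : ℂ) / 2 + 1)) • spinState q A.toList ∅ := by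
    rw [spinSq_eq]
    simp only [add_mulVec, smul_mulVec, sub_mulVec, ← mulVec_mulVec, h01, h00, h11, mulVec_zero,
      sub_zero, mulVec_smul, zero_add]
    module
  rw [mulVec_holeClusterState n, hpol, mulVec_smul, ← holeClusterState_eq_mulVec]
  intro C' hC'
  by_cases hne : C = C'
  · rw [← hne]
    exact spinSq_comm_self _
  · exact spinSq_comm_of_disjoint (disjoint_clusterOrbitals hC hC' hne)

end ClusterStates

/-! ### Spanning by the hole-cluster states -/

section Spanning

variable {Γ : AddSubgroup (ℤ × ℤ)} [Γ.FiniteIndex] {q : Params}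

/-- For a fixed list `l` of sites, a superposition of spin states whose amplitudes depend only on
the spins of the clusters is a superposition of hole-cluster states. -/
lemma sum_spinState_mem_span (q : Params) (A : Finset (FSite Γ)) {l : List (FSite Γ)}
    (hl : l.Perm A.toList) {c : Finset (FSite Γ) → ℂ}
    (hc : ∀ D ⊆ A, ∀ D' ⊆ A, (∀ C ∈ clusters q A, (D ∩ C).card = (D' ∩ C).card) → c D = c D')
    (W : Submodule ℂ (Finset (Mode Γ) → ℂ))
    (hW : ∀ n : Finset (FSite Γ) → ℕ, (∀ C ∈ clusters q A, n C ≤ C.card) →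
      holeClusterState q A n ∈ W) :
    ∑ D ∈ A.powerset, c D • spinState q l D ∈ W := by
  classical
  obtain ⟨s, hs⟩ := exists_sign_spinState q hl
  let pr : Finset (FSite Γ) → Finset (FSite Γ) → ℕ := fun D C =>
    if C ∈ clusters q A then (D ∩ C).card else 0
  have hpr : ∀ {D D'}, pr D = pr D' → ∀ C ∈ clusters q A, (D ∩ C).card = (D' ∩ C).card := by
    intro D D' h C hC
    simpa [pr, hC] using congrFun h C
  rw [← Finset.sum_fiberwise_of_maps_to (g := pr) (t := A.powerset.image pr)
    fun D hD => Finset.mem_image_of_mem pr hD]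
  refine Submodule.sum_mem _ fun π hπ => ?_
  obtain ⟨D₀, hD₀, rfl⟩ := Finset.mem_image.1 hπ
  rw [Finset.mem_powerset] at hD₀
  obtain ⟨a, ha, h⟩ := holeClusterState_eq_sum q A (pr D₀)
  have hset : A.powerset.filter (fun D => pr D = pr D₀) =
      profileSets (clusters q A).toList A (pr D₀) := by
    ext D
    rw [Finset.mem_filter, Finset.mem_powerset, mem_profileSets_clusters]
    refine and_congr_right fun _ => ⟨fun h C hC => ?_, fun h => funext fun C => ?_⟩
    · rw [← h]
      simp [pr, hC]
    · by_cases hC : C ∈ clusters q A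
      · rw [← h C hC]
        simp [pr, hC]
      · simp [pr, hC]
  have hsum : ∑ D ∈ A.powerset.filter (fun D => pr D = pr D₀), c D • spinState q l D =
      (s : ℤ) • (c D₀ * a⁻¹) • holeClusterState q A (pr D₀) := by
    rw [h, smul_smul, mul_assoc, inv_mul_cancel₀ ha, mul_one, ← hset, Finset.smul_sum,
      Finset.smul_sum]
    refine Finset.sum_congr rfl fun D hD => ?_
    rw [Finset.mem_filter, Finset.mem_powerset] at hD
    rw [hc D hD.1 D₀ hD₀ (hpr hD.2), hs, Units.smul_def, smul_comm]
  rw [hsum]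
  refine W.smul_of_tower_mem _ (W.smul_mem _ (hW _ fun C hC => ?_))
  simp only [pr, hC, if_true]
  exact Finset.card_le_card Finset.inter_subset_right

/-- The sequences of spin indices at distinct sites correspond to the sets of sites with
index `1`. -/
lemma sum_spins_eq_sum_powerset {α E : Type*} [DecidableEq α] [AddCommMonoid E] {n : ℕ}
    {ρ : Fin n → α} (hρ : Function.Injective ρ) (G : (Fin n → Fin 2) → E) :
    ∑ σ, G σ = ∑ D ∈ (Finset.univ.image ρ).powerset, G fun i => if ρ i ∈ D then 1 else 0 := by
  refine Finset.sum_bij' (fun σ _ => (Finset.univ.filter fun i => σ i = 1).image ρ)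
    (fun D _ i => if ρ i ∈ D then 1 else 0) ?_ ?_ ?_ ?_ ?_
  · intro σ _
    exact Finset.mem_powerset.2 (Finset.image_subset_image (Finset.filter_subset _ _))
  · intro D _
    exact Finset.mem_univ _
  · intro σ _
    funext i
    simp only [Finset.mem_image, Finset.mem_filter, Finset.mem_univ, true_and, hρ.eq_iff,
      exists_eq_right]
    split_ifs with h
    · exact h.symm
    · have : ∀ x : Fin 2, x ≠ 1 → 0 = x := by decide
      exact this _ h
  · intro D hD
    rw [Finset.mem_powerset] at hD
    ext x
    simp only [Finset.mem_image, Finset.mem_filter, Finset.mem_univ, true_and, ite_eq_left_iff,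
      zero_ne_one, imp_false, not_not]
    constructor
    · rintro ⟨i, hi, rfl⟩
      exact hi
    · intro hx
      obtain ⟨i, -, rfl⟩ := Finset.mem_image.1 (hD hx)
      exact ⟨i, hx, rfl⟩
  · intro σ _
    congr 1
    funext i
    simp only [Finset.mem_image, Finset.mem_filter, Finset.mem_univ, true_and, hρ.eq_iff,
      exists_eq_right]
    split_ifs with h
    · exact h
    · have : ∀ x : Fin 2, x ≠ 1 → x = 0 := by decide
      exact this _ h

/-- The ground states are superpositions of hole-cluster states. -/
lemma IsFrustrationFree.mem_span (htf : q.tf ≠ 0) (htfp : q.tfp ≠ 0) {n N : ℕ}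
    (hN : n + N = Fintype.card (Mode Γ)) {Ψ : Finset (Mode Γ) → ℂ} (hΨ : Ψ ∈ sector N)
    (h : IsFrustrationFree q Ψ) (W : Submodule ℂ (Finset (Mode Γ) → ℂ))
    (hW : ∀ (A : Finset (FSite Γ)) (m : Finset (FSite Γ) → ℕ), A.card = n →
      (∀ C ∈ clusters q A, m C ≤ C.card) → holeClusterState q A m ∈ W) : Ψ ∈ W := by
  classical
  obtain ⟨c, hc, hsum⟩ := exists_expansion q htfp n N Ψ hN hΨ h.off
  have hn : (n.factorial : ℂ) ≠ 0 := Nat.cast_ne_zero.2 (Nat.factorial_ne_zero n)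
  rw [← W.smul_mem_iff hn, hsum, ← (Equiv.arrowProdEquivProdArrow (Fin n) (fun _ => FSite Γ)
    (fun _ => Fin 2)).symm.sum_comp, Fintype.sum_prod_type]
  refine Submodule.sum_mem _ fun ρ _ => ?_
  by_cases hρ : Function.Injective ρ
  · rw [sum_spins_eq_sum_powerset hρ]
    set A : Finset (FSite Γ) := Finset.univ.image ρ with hA
    set l : List (FSite Γ) := List.ofFn ρ with hl
    have hnodup : l.Nodup := List.nodup_ofFn.2 hρ
    have hmem : ∀ x, x ∈ l ↔ x ∈ A := fun x => by
      simp [hl, hA, List.mem_ofFn]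
    have hperm : l.Perm A.toList :=
      (List.perm_ext_iff_of_nodup hnodup (Finset.nodup_toList A)).2 fun x => by
        rw [hmem, Finset.mem_toList]
    have hcard : A.card = n := by
      rw [hA, Finset.card_image_of_injective _ hρ, Finset.card_univ, Fintype.card_fin]
    have hlist : ∀ D : Finset (FSite Γ), List.ofFn ((Equiv.arrowProdEquivProdArrow (Fin n)
        (fun _ => FSite Γ) (fun _ => Fin 2)).symm (ρ, fun i => if ρ i ∈ D then 1 else 0)) =
        l.map (label D) := fun D => by
      rw [hl, List.map_ofFn]
      rfl
    have := sum_spinState_mem_span q A hperm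
      (c := fun D => c ((Equiv.arrowProdEquivProdArrow (Fin n)
        (fun _ => FSite Γ) (fun _ => Fin 2)).symm (ρ, fun i => if ρ i ∈ D then 1 else 0)))
      (fun D hD D' hD' hprof => ?_) W fun m hm => hW A m hcard hm
    · simpa only [hlist, spinState] using this
    · have e := removeAll_eq_of_profile htf htfp h hnodup (fun x hx => (hmem x).2 hx) hD' _ D hD rfl
        hprof
      rw [← hlist, ← hlist, hc, hc] at e
      exact smul_left_injective ℂ filled_ne_zero e
  · refine Submodule.sum_mem _ fun σ _ => ?_
    have h0 := removeAll_mulVec_eq_zero (q := q) (Ψ := Ψ)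
      (l := List.ofFn ((Equiv.arrowProdEquivProdArrow (Fin n)
        (fun _ => FSite Γ) (fun _ => Fin 2)).symm (ρ, σ))) (by
        rw [List.map_ofFn]
        exact fun h' => hρ (List.nodup_ofFn.1 h')) (h.no_double htfp)
    rw [hc] at h0
    rw [(smul_eq_zero.1 h0).resolve_right filled_ne_zero, zero_smul]
    exact W.zero_mem

end Spanning

/-! ### Half filling of the flat band -/

section HalfFilling

variable {Γ : AddSubgroup (ℤ × ℤ)} [Γ.FiniteIndex] {q : Params}

lemma linkedIn_univ_shift (hΓ : ∀ i, wVec i ∉ Γ) (htf : q.tf ≠ 0) (R : FSite Γ) :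
    LinkedIn q Finset.univ R (shift R (1, 0)) ∧ LinkedIn q Finset.univ R (shift R (0, 1)) := by
  refine ⟨⟨Finset.mem_univ _, Finset.mem_univ _, ?_⟩, Finset.mem_univ _, Finset.mem_univ _, ?_⟩
  · simpa [nbr_zero] using overlap_nbr hΓ htf (R, 0) 0 2
  · simpa [nbr_one] using overlap_nbr hΓ htf (R, 1) 2 1

/-- The set of all sites is a single cluster. -/
lemma clusterOf_univ (hΓ : ∀ i, wVec i ∉ Γ) (htf : q.tf ≠ 0) (R : FSite Γ) :
    clusterOf q Finset.univ R = Finset.univ := by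
  have hstep : ∀ x : ℤ × ℤ, (∀ S : FSite Γ, LinkedIn q Finset.univ S (shift S x)) →
      ∀ (k : ℤ) (S : FSite Γ), Relation.ReflTransGen (LinkedIn q Finset.univ) S
        (shift S (k • x)) := by
    intro x hx k S
    induction k with
    | zero =>
      rw [zero_smul, show (0 : ℤ × ℤ) = (0, 0) from rfl, shift_zero]
    | succ k ih =>
      rw [add_smul, one_smul, ← shift_shift]
      exact ih.tail (hx _)
    | pred k ih =>
      refine ih.trans (LinkedIn.reverse (Relation.ReflTransGen.single ?_))
      convert hx _ using 1
      rw [shift_shift, sub_smul, one_smul, sub_add_cancel]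
  refine Finset.eq_univ_of_forall fun S => mem_clusterOf.2 ⟨Finset.mem_univ _, ?_⟩
  obtain ⟨⟨a, b⟩, hab⟩ := QuotientAddGroup.mk_surjective (S - R)
  have e : S = shift (shift R (a • (1, 0))) (b • (0, 1)) := by
    rw [shift_shift, shift]
    simp only [Prod.smul_mk, smul_eq_mul, mul_one, mul_zero, Prod.mk_add_mk, add_zero, zero_add]
    rw [hab, add_sub_cancel]
  rw [e]
  exact (hstep _ (fun S => (linkedIn_univ_shift hΓ htf S).1) a R).trans
    (hstep _ (fun S => (linkedIn_univ_shift hΓ htf S).2) b _)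

lemma univ_mem_clusters (hΓ : ∀ i, wVec i ∉ Γ) (htf : q.tf ≠ 0) :
    (Finset.univ : Finset (FSite Γ)) ∈ clusters q Finset.univ := by
  have h := clusterOf_mem_clusters (q := q) (Finset.mem_univ (0 : FSite Γ))
  rwa [clusterOf_univ hΓ htf] at h

lemma clusterOrbitals_univ (hΓ : ∀ i, wVec i ∉ Γ) (htf : q.tf ≠ 0) (htfp : q.tfp ≠ 0) :
    clusterOrbitals q (Finset.univ : Finset (FSite Γ)) = Finset.univ := by
  refine Finset.eq_univ_of_forall fun o => mem_clusterOrbitals.2 ?_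
  rcases o with R | ⟨r, i⟩
  · exact ⟨R, Finset.mem_univ _, by simpa [localized_inl] using htfp⟩
  · refine ⟨nbr r 1, Finset.mem_univ _, ?_⟩
    rw [localized_nbr hΓ]
    refine mul_ne_zero htf ?_
    fin_cases i <;> simp [eVec]

lemma card_mode : Fintype.card (Mode Γ) =
    4 * Fintype.card (PSite Γ) + 2 * Fintype.card (FSite Γ) := by
  simp only [Fintype.card_prod, Fintype.card_sum, Fintype.card_fin]
  ring

end HalfFilling

end

theorem theorem2 (Γ : AddSubgroup (ℤ × ℤ)) [Γ.FiniteIndex] (hΓ : ∀ i, wVec i ∉ Γ)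
    (q : Params) (htp : 0 < q.tp) (htf : 0 < q.tf) (htfp : 0 < q.tfp)
    (hUp : 0 < q.Up) (hUf : 0 < q.Uf) (hJ : 0 < q.J) (hgap : 3 * q.tp * q.tf < q.tfp ^ 2)
    (hμ : q.μf = q.μp + 6 * q.tf + 3 / 2 * q.tp - q.tfp ^ 2 / q.tf
      + q.Uf / 2 - q.Up / 2 - q.J / 2)
    (Ne : ℕ) (hNe : 4 * Fintype.card (PSite Γ) + Fintype.card (FSite Γ) ≤ Ne) :
    -- the ground state space is spanned by the hole-cluster states
    groundSpace (hamiltonian Γ q) Ne = Submodule.span ℂ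
      {Φ | ∃ (A : Finset (FSite Γ)) (n : Finset (FSite Γ) → ℕ),
        A.card + Ne = 4 * Fintype.card (PSite Γ) + 2 * Fintype.card (FSite Γ) ∧
        (∀ C ∈ clusters q A, n C ≤ C.card) ∧ Φ = holeClusterState q A n} ∧
    -- these states are nonzero, and have maximal spin on each cluster
    (∀ (A : Finset (FSite Γ)) (n : Finset (FSite Γ) → ℕ),
      A.card + Ne = 4 * Fintype.card (PSite Γ) + 2 * Fintype.card (FSite Γ) →
      (∀ C ∈ clusters q A, n C ≤ C.card) →
      holeClusterState q A n ≠ 0 ∧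
      ∀ C ∈ clusters q A, spinSq (clusterOrbitals q C) *ᵥ holeClusterState q A n =
        ((C.card : ℂ) / 2 * ((C.card : ℂ) / 2 + 1)) • holeClusterState q A n) ∧
    -- at exact half filling of the flat band, every ground state has maximal total spin
    (Ne = 4 * Fintype.card (PSite Γ) + Fintype.card (FSite Γ) →
      ∀ Ψ ∈ groundSpace (hamiltonian Γ q) Ne, spinSq (Finset.univ : Finset (Orb Γ)) *ᵥ Ψ =
        ((Fintype.card (FSite Γ) : ℂ) / 2 * ((Fintype.card (FSite Γ) : ℂ) / 2 + 1)) • Ψ) := by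
  obtain ⟨c, e, hH⟩ := hamiltonian_decomposition (Γ := Γ) q htf.ne' htfp.ne' hμ
  have hpos := posWithZeros_positivePart (Γ := Γ) q htp htf hUp hUf hJ hgap
  have hspan : groundSpace (hamiltonian Γ q) Ne = Submodule.span ℂ
      {Φ | ∃ (A : Finset (FSite Γ)) (n : Finset (FSite Γ) → ℕ),
        A.card + Ne = 4 * Fintype.card (PSite Γ) + 2 * Fintype.card (FSite Γ) ∧
        (∀ C ∈ clusters q A, n C ≤ C.card) ∧ Φ = holeClusterState q A n} := by
    rw [← card_mode]
    by_cases hmax : Ne ≤ Fintype.card (Mode Γ)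
    · have hFF : ∀ (A : Finset (FSite Γ)) (n : Finset (FSite Γ) → ℕ),
          A.card + Ne = Fintype.card (Mode Γ) →
          holeClusterState q A n ∈ sector Ne ∧ IsFrustrationFree q (holeClusterState q A n) :=
        fun A n hA => ⟨holeClusterState_mem_sector hA n,
          isFrustrationFree_holeClusterState hΓ htf.ne' htfp.ne' n⟩
      have hground : ∀ Ψ, Ψ ∈ groundSpace (hamiltonian Γ q) Ne ↔
          Ψ ∈ sector Ne ∧ IsFrustrationFree q Ψ := by
        obtain ⟨A, -, hA⟩ := Finset.exists_subset_card_eq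
          (s := (Finset.univ : Finset (FSite Γ))) (n := Fintype.card (Mode Γ) - Ne) (by
            rw [card_mode, Finset.card_univ]; omega)
        have := hFF A (fun _ => 0) (by omega)
        exact groundSpace_eq hH hpos (fun v hv => hv.positivePart_mulVec)
          ⟨_, this.1, holeClusterState_ne_zero htfp.ne' fun _ _ => Nat.zero_le _, this.2⟩
      refine le_antisymm (fun Ψ hΨ => ?_) (Submodule.span_le.2 ?_)
      · rw [hground] at hΨ
        refine hΨ.2.mem_span htf.ne' htfp.ne' (n := Fintype.card (Mode Γ) - Ne)
          (Nat.sub_add_cancel hmax) hΨ.1 _ fun A m hA hm => Submodule.subset_span ?_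
        exact ⟨A, m, by rw [hA, Nat.sub_add_cancel hmax], hm, rfl⟩
      · rintro _ ⟨A, n, hA, -, rfl⟩
        exact (hground _).2 (hFF A n hA)
    · have hbot : groundSpace (hamiltonian Γ q) Ne = ⊥ := by
        rw [groundSpace, sector_eq_bot (not_le.1 hmax), bot_inf_eq]
      rw [hbot, eq_comm, Submodule.span_eq_bot]
      rintro _ ⟨A, n, hA, -, -⟩
      omega
  refine ⟨hspan, fun A n _ hn => ⟨holeClusterState_ne_zero htfp.ne' hn,
    fun C hC => spinSq_mulVec_holeClusterState n hC⟩, fun hhalf Ψ hΨ => ?_⟩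
  rw [hspan] at hΨ
  induction hΨ using Submodule.span_induction with
  | mem Φ hΦ =>
    obtain ⟨A, n, hA, -, rfl⟩ := hΦ
    obtain rfl : A = Finset.univ := (Finset.card_eq_iff_eq_univ A).1 (by omega)
    have := spinSq_mulVec_holeClusterState n (univ_mem_clusters hΓ htf.ne' (q := q))
    rwa [clusterOrbitals_univ hΓ htf.ne' htfp.ne', Finset.card_univ] at this
  | zero => rw [mulVec_zero, smul_zero]
  | add x y _ _ hx hy => rw [mulVec_add, hx, hy, smul_add]
  | smul a x _ hx => rw [mulVec_smul, hx, smul_comm]
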